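/- **Setting.** A convex quadrilateral $Q\subset\mathbb R^2$ is open and non-degenerate, with vertices $v_1,\dots,v_4$ in counter-clockwise order (indices modulo $4$, no three vertices collinear), edge vectors $t^{(i)}=v_{i+1}-v_i$, edges $e_i$ (the open segments from $v_i$ to $v_{i+1}$) parametrized by $F_{e_i}(s)=(1-s)v_i+s\,v_{i+1}$, and a chosen unit normal $n_i$ (of either orientation) to each edge $e_i$. Let $h_Q=\max_i\|t^{(i)}\|$ and let $\rho_Q>0$ be the smallest of the angles of the four triangles $v_iv_{i+1}v_{i+2}$ formed by the edges and the diagonals of $Q$. Let $F_Q:[0,1]^2\to\overline Q$ be the bilinear map $$F_Q(\xi_1,\xi_2)=(1-\xi_1)(1-\xi_2)v_1+\xi_1(1-\xi_2)v_2+\xi_1\xi_2v_3+(1-\xi_1)\xi_2v_4 .$$ Write $\mathbb P^{(p,p)}$ for the bivariate polynomials of bi-degree at most $(p,p)$ and $\mathbb P^{p-1}$ for the univariate polynomials of degree at most $p-1$. Let $p\ge 3$ be an integer. *Local space.* For $p\ge5$, $\mathcal P_Q^p$ is the set of functions $\varphi:\overline Q\to\mathbb R$ with $\varphi\circ F_Q\in\mathbb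 P^{(p,p)}$ and $(\partial_{n_i}\varphi)\circ F_{e_i}\in\mathbb P^{p-1}$ for $1\le i\le4$. For $p\in\{3,4\}$, put $k=6-p$ and divide $[0,1]^2$ into $k\times k$ congruent closed squares and $[0,1]$ into $k$ closed intervals of equal length; $\mathcal P_Q^p$ is the set of functions $\varphi:\overline Q\to\mathbb R$ such that $\varphi\in C^{p-2}(Q)$, $\varphi\circ F_Q$ agrees on each of the small squares with an element of $\mathbb P^{(p,p)}$, and, for $1\le i\le 4$, $\varphi\circ F_{e_i}\in C^{p-1}((0,1))$ and $(\partial_{n_i}\varphi)\circ F_{e_i}$ agrees on the part in $(0,1)$ of each of the small intervals with an element of $\mathbb P^{p-1}$. *Degrees of freedom.* $\Lambda_Q^p$ consists of the functionals, for $1\le i\le 4$, - $\varphi(v_i)$, $\partial_1\varphi(v_i)$, $\partial_2\varphi(v_i)$, $\partial_1\partial_1\varphi(v_i)$, $\partial_1\partial_2\varphi(v_i)$, $\partial_2\partial_2\varphi(v_i)$; - if $p\in\{3,4\}$: $\partial_{n_i}\varphi(F_{e_i}(\tfrac12))$; if $p\ge5$: $\varphi(F_{e_i}(\tfrac jp))$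 for $3\le j\le p-3$ and $\partial_{n_i}\varphi(F_{e_i}(\tfrac j{p-1}))$ for $2\le j\le p-3$; - $\varphi(F_Q(\eta_1,\eta_2))$ with $\eta_1,\eta_2\in\{\tfrac29,\tfrac49,\tfrac59,\tfrac79\}$ if $p=3$, $\eta_1,\eta_2\in\{\tfrac14,\tfrac24,\tfrac34\}$ if $p=4$, and $\eta_1,\eta_2\in\{\tfrac2p,\dots,\tfrac{p-2}p\}$ if $p\ge5$. Derivatives at boundary points are taken within $\overline Q$. A dual basis is a family $(\beta_\lambda)_{\lambda\in\Lambda_Q^p}$ in $\mathcal P_Q^p$ with $\lambda(\beta_\lambda)=1$ and $\lambda'(\beta_\lambda)=0$ for all $\lambda'\ne\lambda$ in $\Lambda_Q^p$. **Lemma.** For every convex quadrilateral $Q$ and every integer $p\ge3$ a dual basis exists, and there is a constant $C=C(h_Q,\rho_Q,p)>0$, depending only on $h_Q$, $\rho_Q$ and $p$, such that every dual basis satisfies, for all $\lambda\in\Lambda_Q^p$, $$\|\beta_\lambda\|_{L^\infty(Q)}\le C,\qquad \|\beta_\lambda\|_{L^2(Q)}\le C,\qquad \|\beta_\lambda\|_{H^\ell(Q)}\le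 C\quad(\ell=0,1,2),$$ where $\|f\|_{H^\ell(Q)}=\bigl(\sum_{|\alpha|\le\ell}\|D^\alpha f\|_{L^2(Q)}^2\bigr)^{1/2}$ with weak derivatives $D^\alpha f$; in particular $\beta_\lambda\in H^2(Q)$. -/

import Mathlib

open MeasureTheory Set
open scoped ENNReal ContDiff

noncomputable section

namespace BSQuad

/-- The Euclidean plane. -/
abbrev Plane : Type := EuclideanSpace ℝ (Fin 2)

/-- The determinant of the `2 × 2` matrix with columns `u` and `w`. -/
def det2 (u w : Plane) : ℝ := u 0 * w 1 - u 1 * w 0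

/-- A non-degenerate convex quadrilateral, given by its four vertices in counter-clockwise order
(indices modulo 4): the boundary makes a strict left turn at each vertex.  For four points this says
exactly that every vertex off an edge lies strictly to the left of that edge. -/
structure ConvexQuad where
  vertex : Fin 4 → Plane
  convex : ∀ i, 0 < det2 (vertex i - vertex (i - 1)) (vertex (i + 1) - vertex i)

namespace ConvexQuad

variable (Q : ConvexQuad)

/-- The edge vector `t⁽ⁱ⁾ = v_{i+1} - v_i`. -/
def edge (i : Fin 4) : Plane := Q.vertex (i + 1) - Q.vertex i

/-- The closed quadrilateral. -/
def closed : Set Plane := convexHull ℝ (Set.range Q.vertex)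

/-- The open quadrilateral. -/
def inner : Set Plane := interior Q.closed

/-- `h_Q`, the length of the longest edge. -/
def size : ℝ := ⨆ i : Fin 4, ‖Q.edge i‖

/-- `ρ_Q`, the smallest of the angles of the four triangles `v_i v_{i+1} v_{i+2}` whose sides are two
consecutive edges and a diagonal. -/
def minAngle : ℝ :=
  ⨅ i : Fin 4,
    min (EuclideanGeometry.angle (Q.vertex i) (Q.vertex (i + 1)) (Q.vertex (i + 2)))
      (min (EuclideanGeometry.angle (Q.vertex (i + 1)) (Q.vertex (i + 2)) (Q.vertex i))
        (EuclideanGeometry.angle (Q.vertex (i + 2)) (Q.vertex i) (Q.vertex (i + 1))))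

/-- The bilinear parametrization `F_Q` of the closed quadrilateral over the unit square. -/
def param (s t : ℝ) : Plane :=
  ((1 - s) * (1 - t)) • Q.vertex 0 + (s * (1 - t)) • Q.vertex 1 + (s * t) • Q.vertex 2 +
    ((1 - s) * t) • Q.vertex 3

/-- The linear parametrization of the `i`-th edge, which is the restriction of `F_Q` to the
corresponding side of the unit square. -/
def edgeParam (i : Fin 4) (s : ℝ) : Plane := (1 - s) • Q.vertex i + s • Q.vertex (i + 1)

/-- The edge parametrizations are the restrictions of `F_Q` to the sides of the unit square. -/
theorem edgeParam_eq (s : ℝ) :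
    Q.edgeParam 0 s = Q.param s 0 ∧ Q.edgeParam 1 s = Q.param 1 s ∧
      Q.edgeParam 2 s = Q.param (1 - s) 1 ∧ Q.edgeParam 3 s = Q.param 0 (1 - s) := by
  have h3 : (3 : Fin 4) + 1 = 0 := rfl
  refine ⟨?_, ?_, ?_, ?_⟩ <;> ext a <;> simp [edgeParam, param, h3] <;> ring_nf

/-- `n i` is one of the two unit normal vectors of the `i`-th edge. -/
def IsUnitNormal (n : Fin 4 → Plane) : Prop :=
  ∀ i, ‖n i‖ = 1 ∧ Inner.inner ℝ (n i) (Q.edge i) = 0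

/-- The derivative at `x`, in direction `d`, of a function on the closed quadrilateral
(only the values of `f` on the closed quadrilateral enter). -/
def dirDeriv (d : Plane) (f : Plane → ℝ) (x : Plane) : ℝ := fderivWithin ℝ f Q.closed x d

end ConvexQuad

/-- The standard unit vectors. -/
def unitVec (a : Fin 2) : Plane := EuclideanSpace.single a 1

/-- The number `k` of sub-intervals in each parameter direction: `6 - p` for `p ∈ {3, 4}`, and `1`
for `p ≥ 5`. -/
def numSub (p : ℕ) : ℕ := max 1 (6 - p)

/-- The `m`-th of the `k` closed sub-intervals of `[0, 1]` of equal length. -/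
def subInterval (k : ℕ) (m : Fin k) : Set ℝ := Set.Icc ((m : ℝ) / k) (((m : ℝ) + 1) / k)

/-- The local space of degree `p`.  Its elements are functions on the closed quadrilateral; they are
represented by functions on the plane whose values elsewhere are irrelevant. -/
structure MemSpace (p : ℕ) (Q : ConvexQuad) (n : Fin 4 → Plane) (f : Plane → ℝ) : Prop where
  /-- On each sub-square, the pull-back is a polynomial of bi-degree `(p, p)`. -/
  poly : ∀ a b : Fin (numSub p), ∃ c : Fin (p + 1) → Fin (p + 1) → ℝ,
    ∀ s ∈ subInterval (numSub p) a, ∀ t ∈ subInterval (numSub p) b,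
      f (Q.param s t) = ∑ i, ∑ j, c i j * s ^ (i : ℕ) * t ^ (j : ℕ)
  /-- On each sub-interval of each edge, the normal derivative is a polynomial of degree at most
  `p - 1`. -/
  normal : ∀ i : Fin 4, ∀ a : Fin (numSub p), ∃ P : Polynomial ℝ, P.natDegree ≤ p - 1 ∧
    ∀ s ∈ subInterval (numSub p) a ∩ Set.Ioo 0 1,
      Q.dirDeriv (n i) f (Q.edgeParam i s) = P.eval s
  /-- Macro-elements: the function is of class `C^{p-2}`. -/
  smooth : p ≤ 4 → ContDiffOn ℝ ((p - 2 : ℕ) : ℕ∞) f Q.inner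
  /-- Macro-elements: the traces on the edges are of class `C^{p-1}`. -/
  trace : p ≤ 4 → ∀ i : Fin 4,
    ContDiffOn ℝ ((p - 1 : ℕ) : ℕ∞) (fun s => f (Q.edgeParam i s)) (Set.Ioo 0 1)

/-- The edge parameters of the point evaluations on the edges (none for `p ≤ 5`). -/
def edgeValueNodes (p : ℕ) : Set ℝ := {s | ∃ j : ℕ, 3 ≤ j ∧ j + 3 ≤ p ∧ s = (j : ℝ) / p}

/-- The edge parameters of the normal derivatives on the edges (the midpoint for `p ≤ 5`). -/
def edgeNormalNodes (p : ℕ) : Set ℝ :=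
  if p ≤ 4 then {1 / 2} else {s | ∃ j : ℕ, 2 ≤ j ∧ j + 3 ≤ p ∧ s = (j : ℝ) / ((p : ℝ) - 1)}

/-- The parameters whose pairs give the face points. -/
def faceNodes (p : ℕ) : Set ℝ :=
  if p = 3 then {2 / 9, 4 / 9, 5 / 9, 7 / 9}
  else if p = 4 then {1 / 4, 2 / 4, 3 / 4}
  else {s | ∃ j : ℕ, 2 ≤ j ∧ j + 2 ≤ p ∧ s = (j : ℝ) / p}

/-- The index set of the local degrees of freedom. -/
inductive Dof (p : ℕ) : Type
  /-- `f (v_i)` -/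
  | value (i : Fin 4) : Dof p
  /-- `∂_a f (v_i)` -/
  | grad (i : Fin 4) (a : Fin 2) : Dof p
  /-- `∂_1 ∂_1 f (v_i)`, `∂_1 ∂_2 f (v_i)`, `∂_2 ∂_2 f (v_i)` -/
  | hess (i : Fin 4) (ab : {ab : Fin 2 × Fin 2 // ab.1 ≤ ab.2}) : Dof p
  /-- point evaluation on the `i`-th edge -/
  | edgeValue (i : Fin 4) (s : edgeValueNodes p) : Dof p
  /-- normal derivative on the `i`-th edge -/
  | edgeNormal (i : Fin 4) (s : edgeNormalNodes p) : Dof p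
  /-- point evaluation at a face point -/
  | face (s t : faceNodes p) : Dof p

/-- The local degrees of freedom. -/
def Dof.eval {p : ℕ} (Q : ConvexQuad) (n : Fin 4 → Plane) (f : Plane → ℝ) : Dof p → ℝ
  | .value i => f (Q.vertex i)
  | .grad i a => Q.dirDeriv (unitVec a) f (Q.vertex i)
  | .hess i ab =>
      Q.dirDeriv (unitVec ab.1.1) (Q.dirDeriv (unitVec ab.1.2) f) (Q.vertex i)
  | .edgeValue i s => f (Q.edgeParam i s)
  | .edgeNormal i s => Q.dirDeriv (n i) f (Q.edgeParam i s)
  | .face s t => f (Q.param s t)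

open Classical in
/-- `β` is a family of functions in the local space which is dual to the degrees of freedom. -/
def IsDualBasis (p : ℕ) (Q : ConvexQuad) (n : Fin 4 → Plane) (β : Dof p → Plane → ℝ) : Prop :=
  ∀ l, MemSpace p Q n (β l) ∧ ∀ l', Dof.eval Q n (β l) l' = if l' = l then 1 else 0

/-- The classical partial derivative `∂_1^{α.1} ∂_2^{α.2} ψ`. -/
def partialDeriv (α : ℕ × ℕ) (ψ : Plane → ℝ) : Plane → ℝ :=
  (fun g x => fderiv ℝ g x (unitVec 0))^[α.1] ((fun g x => fderiv ℝ g x (unitVec 1))^[α.2] ψ)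

/-- `g` is the weak derivative `D^α f` on the open set `U`. -/
def IsWeakDeriv (U : Set Plane) (α : ℕ × ℕ) (f g : Plane → ℝ) : Prop :=
  LocallyIntegrableOn f U ∧ LocallyIntegrableOn g U ∧
    ∀ ψ : Plane → ℝ, ContDiff ℝ ∞ ψ → HasCompactSupport ψ → tsupport ψ ⊆ U →
      ∫ x in U, f x * partialDeriv α ψ x = (-1) ^ (α.1 + α.2) * ∫ x in U, g x * ψ x

/-- The multi-indices of order at most `l`. -/
def multiIndices (l : ℕ) : Finset (ℕ × ℕ) :=
  (Finset.range (l + 1) ×ˢ Finset.range (l + 1)).filter fun α => α.1 + α.2 ≤ l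

/-- The Sobolev norm `(∑_{|α| ≤ l} ‖D^α f‖²_{L²(U)})^{1/2}`, with value `∞` if `f` is not in
`H^l(U)`.  Weak derivatives are unique almost everywhere, so that the infimum is over equal values;
it is `∞` if one of the weak derivatives does not exist. -/
def sobolevNorm (l : ℕ) (U : Set Plane) (f : Plane → ℝ) : ℝ≥0∞ :=
  ⨅ (g : ℕ × ℕ → Plane → ℝ) (_ : ∀ α ∈ multiIndices l, IsWeakDeriv U α f (g α)),
    (∑ α ∈ multiIndices l, eLpNorm (g α) 2 (volume.restrict U) ^ 2) ^ (1 / 2 : ℝ)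

end BSQuad

end

/-! Pulled back to the unit square, a member `f` of the local space is a tensor product spline:
along each axis-parallel line it is a spline of degree `p` and smoothness `p - 2` (`FaceSpl`; a
single polynomial if `p ≥ 5`). It is therefore given by a square matrix of coefficients in the basis
dual to the conditions "value and first derivative at `0` and `1`, values at the face nodes". In
this basis the entries that belong to two face nodes are the values at the face points, and all
other entries are interpolation data of the traces and of the transversal derivatives on the four
sides of the square.

On an edge of the quadrilateral the trace is a spline of degree `p` and smoothness `p - 1`
(`EdgeSpl`), the normal derivative one of degree `p - 1` and smoothness `p - 2` (`NormalSpl`). The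
vertex and edge degrees of freedom are Hermite data that determine them, of order two for the trace
and of order one for the normal derivative. The two pictures are linked by `inward_eq`: along an
edge, the image of the transversal parameter direction is a combination of the unit normal and the
edge vector with coefficients that are affine in the edge parameter. So the transversal derivative
of the pull-back is an affine combination of the normal and the tangential derivative, and the
degree `p - 1` rises to the admissible `p`. The three univariate problems are unisolvent by counting
zeros if `p ≥ 5` and by solving a linear system if `p` is `3` or `4`.

Existence: interpolate the prescribed data on each edge and form the transversal derivatives. At a
vertex all data stem from one gradient and one symmetric Hessian, so neighbouring sides agree there
on values, first derivatives and the mixed second derivative, and the edge functions glue to a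
coefficient matrix (`exists_coef`, `exists_memSpace`).

Bounds: if the degrees of freedom are at most `1` in absolute value, the matrix is bounded
(`exists_coef_bound`). The Jacobian of the bilinear map is a convex combination of the four corner
determinants, so the inverse map is Lipschitz with a controlled constant, and `f` has a bounded
Lipschitz gradient because `p - 2 ≥ 1` (`exists_bddLip_lift`). Lipschitz first derivatives have
bounded weak derivatives, which gives the bound in `H²` (`sobolevNorm_le`). The law of sines bounds
the edges and the corner determinants from below in terms of `h_Q` and `ρ_Q` (`shapeBounds`). -/

noncomputable section

namespace BSQuad

open Polynomial Filter Topology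

/-! ### Univariate splines -/

/-- Coefficients of a spline of degree `d` and smoothness `r` with the knots `m / k`, `0 < m < k`. -/
abbrev SplCoef (k d r : ℕ) : Type := (Fin (d + 1) → ℝ) × (Fin (k - 1) → Fin (d - r) → ℝ)

/-- The spline with the given coefficients with respect to monomials and truncated powers. -/
def splEval (k d r : ℕ) : SplCoef k d r →ₗ[ℝ] (ℝ → ℝ) where
  toFun x s := ∑ i, x.1 i * s ^ (i : ℕ) +
    ∑ m, ∑ i, x.2 m i * (max (s - ((m : ℝ) + 1) / k) 0) ^ (r + 1 + (i : ℕ))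
  map_add' x y := by
    ext s
    simp only [Prod.fst_add, Prod.snd_add, Pi.add_apply, add_mul, Finset.sum_add_distrib]
    ring
  map_smul' c x := by
    ext s
    simp only [Prod.smul_fst, Prod.smul_snd, Pi.smul_apply, smul_eq_mul, RingHom.id_apply,
      mul_assoc, mul_add, Finset.mul_sum]

theorem splEval_apply (k d r : ℕ) (x : SplCoef k d r) (s : ℝ) :
    splEval k d r x s = ∑ i, x.1 i * s ^ (i : ℕ) +
      ∑ m, ∑ i, x.2 m i * (max (s - ((m : ℝ) + 1) / k) 0) ^ (r + 1 + (i : ℕ)) := rfl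

/-- The space of splines of degree `d` and smoothness `r` with the knots `m / k`, `0 < m < k`. -/
def Spl (k d r : ℕ) : Submodule ℝ (ℝ → ℝ) := LinearMap.range (splEval k d r)

/-- The `a`-th of the `k` intervals into which the knots divide the real line. -/
def linePiece (k a : ℕ) : Set ℝ := {s | (0 < a → (a : ℝ) / k ≤ s) ∧ (a + 1 < k → s ≤ ((a : ℝ) + 1) / k)}

/-- On `Z`, the function agrees on each of the intervals with a polynomial of degree at most `d`. -/
def IsPiecewise (k d : ℕ) (Z : Set ℝ) (u : ℝ → ℝ) : Prop :=
  ∀ a : Fin k, ∃ P : ℝ[X], P.natDegree ≤ d ∧ ∀ s ∈ Z, s ∈ linePiece k a → u s = P.eval s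

theorem hasDerivAt_posPart_pow (a : ℝ) (n : ℕ) (s : ℝ) :
    HasDerivAt (fun s => (max (s - a) 0) ^ (n + 2)) ((n + 2) * (max (s - a) 0) ^ (n + 1)) s := by
  rcases lt_trichotomy s a with h | h | h
  · have : (fun s => (max (s - a) 0) ^ (n + 2)) =ᶠ[𝓝 s] fun _ => (0 : ℝ) := by
      filter_upwards [Iio_mem_nhds h] with x hx
      rw [max_eq_right (by simp at hx; linarith)]; simp
    rw [max_eq_right (by linarith)]
    simpa using (hasDerivAt_const s (0 : ℝ)).congr_of_eventuallyEq this
  · subst h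
    simp only [sub_self, max_self, ne_eq, Nat.add_eq_zero_iff, one_ne_zero, and_false,
      not_false_eq_true, zero_pow, mul_zero]
    rw [hasDerivAt_iff_isLittleO]
    simp only [sub_self, max_self, ne_eq, Nat.add_eq_zero_iff, OfNat.ofNat_ne_zero, and_false,
      not_false_eq_true, zero_pow, sub_zero, smul_eq_mul, mul_zero]
    -- At the knot, the truncated power is dominated by `|x' - s| ^ (n + 2)`, which is of smaller
    -- order than `x' - s`.
    have h1 : (fun x' : ℝ => (max (x' - s) 0) ^ (n + 2)) =O[𝓝 s] fun x' => (x' - s) ^ (n + 2) := by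
      refine Asymptotics.IsBigO.of_bound 1 (Eventually.of_forall fun x => ?_)
      rw [one_mul, norm_pow, norm_pow]
      gcongr
      rw [Real.norm_eq_abs, Real.norm_eq_abs, abs_of_nonneg (le_max_right _ _)]
      exact max_le (le_abs_self _) (abs_nonneg _)
    refine h1.trans_isLittleO ?_
    have h2 : (fun y : ℝ => y ^ (n + 2)) =o[𝓝 0] fun y => y :=
      Asymptotics.isLittleO_pow_id (by omega)
    have h3 : Tendsto (fun x' : ℝ => x' - s) (𝓝 s) (𝓝 0) := by
      have : Continuous fun x' : ℝ => x' - s := by fun_prop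
      simpa using this.tendsto s
    exact h2.comp_tendsto h3
  · have : (fun s => (max (s - a) 0) ^ (n + 2)) =ᶠ[𝓝 s] fun s => (s - a) ^ (n + 2) := by
      filter_upwards [Ioi_mem_nhds h] with x hx
      rw [max_eq_left (by simp at hx; linarith)]
    rw [max_eq_left (by linarith)]
    have h4 := (((hasDerivAt_id s).sub_const a).pow (n + 2)).congr_of_eventuallyEq this
    simpa using h4

theorem contDiff_posPart_pow (a : ℝ) (n : ℕ) :
    ContDiff ℝ n (fun s => (max (s - a) 0) ^ (n + 1)) := by
  induction n with
  | zero => simp only [Nat.cast_zero, zero_add, pow_one, contDiff_zero]; fun_prop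
  | succ n ih =>
    have hd : deriv (fun s => (max (s - a) 0) ^ (n + 2)) =
        fun s => ((n : ℝ) + 2) * (max (s - a) 0) ^ (n + 1) :=
      funext fun s => (hasDerivAt_posPart_pow a n s).deriv
    rw [Nat.cast_add, Nat.cast_one, contDiff_succ_iff_deriv]
    refine ⟨fun s => (hasDerivAt_posPart_pow a n s).differentiableAt, by simp, ?_⟩
    rw [hd]
    exact contDiff_const.mul ih

theorem Spl.contDiff {k d r : ℕ} {u : ℝ → ℝ} (hu : u ∈ Spl k d r) : ContDiff ℝ r u := by
  obtain ⟨x, rfl⟩ := hu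
  have : splEval k d r x = fun s => splEval k d r x s := rfl
  rw [this]
  simp only [splEval_apply]
  refine ContDiff.add (ContDiff.sum fun i _ => by fun_prop) (ContDiff.sum fun m _ =>
    ContDiff.sum fun i _ => contDiff_const.mul ?_)
  rw [show r + 1 + (i : ℕ) = (r + i) + 1 by ring]
  exact (contDiff_posPart_pow _ _).of_le (by exact_mod_cast Nat.le_add_right _ _)

/-- The polynomial with which the spline agrees on the `a`-th interval. -/
def splPoly {k d r : ℕ} (x : SplCoef k d r) (a : ℕ) : ℝ[X] :=
  ∑ i, C (x.1 i) * X ^ (i : ℕ) + ∑ m : Fin (k - 1), if (m : ℕ) < a then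
    ∑ i, C (x.2 m i) * (X - C (((m : ℝ) + 1) / k)) ^ (r + 1 + (i : ℕ)) else 0

theorem splPoly_natDegree {k d r : ℕ} (x : SplCoef k d r) (a : ℕ) :
    (splPoly x a).natDegree ≤ d := by
  unfold splPoly
  refine (natDegree_add_le _ _).trans (max_le ?_ ?_)
  · refine natDegree_sum_le_of_forall_le _ _ fun i _ => ?_
    exact (natDegree_C_mul_X_pow_le _ _).trans (by omega)
  · refine natDegree_sum_le_of_forall_le _ _ fun m _ => ?_
    split_ifs
    · refine natDegree_sum_le_of_forall_le _ _ fun i _ => ?_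
      refine (natDegree_C_mul_le _ _).trans ((natDegree_pow_le).trans ?_)
      rw [natDegree_X_sub_C]
      omega
    · simp

theorem splEval_eq_splPoly {k d r : ℕ} (x : SplCoef k d r) {a : ℕ} (ha : a < k) {s : ℝ}
    (hs : s ∈ linePiece k a) : splEval k d r x s = (splPoly x a).eval s := by
  have hk : (0 : ℝ) < k := by exact_mod_cast (by omega : 0 < k)
  rw [splEval_apply, splPoly, eval_add, eval_finsetSum, eval_finsetSum]
  congr 1
  · simp
  · refine Finset.sum_congr rfl fun m _ => ?_
    split_ifs with hm
    · rw [eval_finsetSum]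
      have h1 := hs.1 (by omega)
      have h2 : ((m : ℝ) + 1) / k ≤ s := by
        refine le_trans ?_ h1
        gcongr
        exact_mod_cast hm
      simp [max_eq_left (sub_nonneg.2 h2)]
    · have hma : a + 1 < k := by have := m.2; omega
      have h1 := hs.2 hma
      have h2 : s ≤ ((m : ℝ) + 1) / k := by
        refine h1.trans ?_
        gcongr
        exact_mod_cast (not_lt.1 hm)
      simp [max_eq_right (sub_nonpos.2 h2)]

theorem Spl.isPiecewise {k d r : ℕ} {u : ℝ → ℝ} (hu : u ∈ Spl k d r) (Z : Set ℝ) :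
    IsPiecewise k d Z u := by
  obtain ⟨x, rfl⟩ := hu
  exact fun a => ⟨splPoly x a, splPoly_natDegree x a, fun s _ hs => splEval_eq_splPoly x a.2 hs⟩

theorem exists_mem_linePiece {k : ℕ} (hk : 0 < k) (s : ℝ) : ∃ a < k, s ∈ linePiece k a := by
  have hk' : (0 : ℝ) < k := by exact_mod_cast hk
  -- The natural floor is `0` on negative numbers and the minimum caps it at `k - 1`; this fits the
  -- two unbounded end pieces.
  refine ⟨min ⌊s * k⌋₊ (k - 1), by omega, fun h => ?_, fun h => ?_⟩
  · rw [div_le_iff₀ hk']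
    have h1 : ⌊s * k⌋₊ ≠ 0 := by omega
    have h2 : 0 ≤ s * k := by
      by_contra h0
      exact h1 (Nat.floor_of_nonpos (by linarith))
    refine le_trans ?_ (Nat.floor_le h2)
    exact_mod_cast min_le_left _ _
  · have h1 : min ⌊s * k⌋₊ (k - 1) = ⌊s * k⌋₊ := by omega
    rw [h1, le_div_iff₀ hk']
    exact (Nat.lt_floor_add_one _).le

theorem iterate_deriv_eval (P : ℝ[X]) (i : ℕ) :
    deriv^[i] (fun x => P.eval x) = fun x => (derivative^[i] P).eval x := by
  induction i generalizing P with
  | zero => rfl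
  | succ i ih =>
    rw [Function.iterate_succ_apply, Function.iterate_succ_apply, ← ih]
    congr 1
    ext x
    simp

/-- Two polynomials that continue each other as a function of class `C^r` have the same derivatives
up to order `r` at the common point. -/
theorem iterate_derivative_eval_eq_of_contDiffOn {Z : Set ℝ} (hZ : IsOpen Z) {r : ℕ} {u : ℝ → ℝ}
    (hu : ContDiffOn ℝ r u Z) {κ : ℝ} (hκ : κ ∈ Z) {P R : ℝ[X]}
    (hP : ∀ᶠ s in 𝓝[<] κ, u s = P.eval s) (hR : ∀ᶠ s in 𝓝[>] κ, u s = R.eval s) {i : ℕ}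
    (hi : i ≤ r) : (derivative^[i] P).eval κ = (derivative^[i] R).eval κ := by
  -- The `i`-th derivative of `u` is continuous at `κ`, so it equals both one-sided limits, which
  -- are the derivatives of the two polynomials.
  have hcont : ContinuousAt (deriv^[i] u) κ := by
    have h1 := hu.continuousOn_iteratedDerivWithin (m := i) (by exact_mod_cast hi) hZ.uniqueDiffOn
    have h2 := h1.congr (iteratedDerivWithin_of_isOpen_eq_iterate hZ (f := u) (n := i)).symm
    exact h2.continuousAt (hZ.mem_nhds hκ)
  have key : ∀ (R : ℝ[X]) (I : Set ℝ), IsOpen I → (𝓝[I] κ).NeBot → (∀ᶠ s in 𝓝[I] κ, u s = R.eval s) →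
      deriv^[i] u κ = (derivative^[i] R).eval κ := by
    intro R I hI hne hR
    have h3 : ∀ᶠ s in 𝓝[I] κ, deriv^[i] u s = (derivative^[i] R).eval s := by
      have h4 := eventually_eventually_nhdsWithin.2 hR
      filter_upwards [h4, self_mem_nhdsWithin] with s hs hsI
      rw [hI.nhdsWithin_eq hsI] at hs
      have h5 : deriv^[i] u s = deriv^[i] (fun x => R.eval x) s := by
        have h7 : u =ᶠ[𝓝 s] fun x => R.eval x := hs
        have h6 := h7.iteratedDeriv_eq i
        rwa [iteratedDeriv_eq_iterate, iteratedDeriv_eq_iterate] at h6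
      rw [h5, iterate_deriv_eval]
    have h6 : Tendsto (deriv^[i] u) (𝓝[I] κ) (𝓝 ((derivative^[i] R).eval κ)) := by
      refine Tendsto.congr' (EventuallyEq.symm h3) ?_
      exact ((derivative^[i] R).continuous.tendsto κ).mono_left nhdsWithin_le_nhds
    exact tendsto_nhds_unique (hcont.tendsto.mono_left nhdsWithin_le_nhds) h6
  rw [← key P _ isOpen_Iio inferInstance hP, ← key R _ isOpen_Ioi inferInstance hR]

theorem coeff_taylor_eq_zero_of_iterate_derivative {P : ℝ[X]} {κ : ℝ} {i : ℕ}
    (h : (derivative^[i] P).eval κ = 0) : (taylor κ P).coeff i = 0 := by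
  rw [taylor_coeff]
  have h1 := congrArg (eval κ) (congrFun (factorial_smul_hasseDeriv (R := ℝ) i) P)
  simp only [h] at h1
  have h2 : ((i.factorial : ℝ)) * eval κ (hasseDeriv i P) = 0 := by
    rw [← h1]
    simp [nsmul_eq_mul]
  exact (mul_eq_zero.1 h2).resolve_left (by exact_mod_cast i.factorial_ne_zero)

/-- A piecewise polynomial of class `C^r` agrees with a spline of smoothness `r`. -/
theorem exists_spl_eqOn {k d r : ℕ} {Z : Set ℝ} {u : ℝ → ℝ} (hk : 0 < k) (hZ : IsOpen Z)
    (hknot : ∀ m : ℕ, 0 < m → m < k → (m : ℝ) / k ∈ Z) (hp : IsPiecewise k d Z u)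
    (hu : 1 < k → ContDiffOn ℝ r u Z) : ∃ v ∈ Spl k d r, EqOn u v Z := by
  have hk' : (0 : ℝ) < k := by exact_mod_cast hk
  have hp' : ∀ a : ℕ, ∃ P : ℝ[X], P.natDegree ≤ d ∧ (a < k → ∀ s ∈ Z, s ∈ linePiece k a →
      u s = P.eval s) := by
    intro a
    by_cases ha : a < k
    · obtain ⟨P, h1, h2⟩ := hp ⟨a, ha⟩
      exact ⟨P, h1, fun _ => h2⟩
    · exact ⟨0, by simp, fun h => absurd h ha⟩
  choose P hPd hP using hp'
  -- The monomial part is the first piece; the truncated powers at a knot carry the Taylor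
  -- coefficients of the jump between the adjacent pieces, from order `r + 1` on.
  let x : SplCoef k d r := (fun i => (P 0).coeff i,
    fun m i => (taylor (((m : ℝ) + 1) / k) (P (m + 1) - P m)).coeff (r + 1 + i))
  have hjump : ∀ m : Fin (k - 1), P (m + 1) - P m =
      ∑ i, C (x.2 m i) * (X - C (((m : ℝ) + 1) / k)) ^ (r + 1 + (i : ℕ)) := by
    intro m
    have hmk : (m : ℕ) + 1 < k := by have := m.2; omega
    set κ : ℝ := ((m : ℝ) + 1) / k with hκ
    have hκZ : κ ∈ Z := by
      have := hknot (m + 1) (by omega) hmk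
      rwa [Nat.cast_add, Nat.cast_one] at this
    -- Smoothness of order `r` annihilates the jump up to order `r`.
    have hz : ∀ i < r + 1, (taylor κ (P (m + 1) - P m)).coeff i = 0 := by
      intro i hi
      refine coeff_taylor_eq_zero_of_iterate_derivative ?_
      rw [iterate_derivative_sub, eval_sub, sub_eq_zero, eq_comm]
      refine iterate_derivative_eval_eq_of_contDiffOn hZ (hu (by omega)) hκZ ?_ ?_
        (Nat.lt_succ_iff.1 hi)
      · have h1 : Ioo ((m : ℝ) / k) κ ∈ 𝓝[<] κ :=
          Ioo_mem_nhdsLT (by rw [hκ]; gcongr; linarith)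
        filter_upwards [h1, mem_nhdsWithin_of_mem_nhds (hZ.mem_nhds hκZ)] with s hs hsZ
        exact hP m (by omega) s hsZ ⟨fun _ => hs.1.le, fun _ => hs.2.le⟩
      · have h1 : Ioo κ (((m : ℝ) + 1 + 1) / k) ∈ 𝓝[>] κ :=
          Ioo_mem_nhdsGT (by rw [hκ]; gcongr; linarith)
        filter_upwards [h1, mem_nhdsWithin_of_mem_nhds (hZ.mem_nhds hκZ)] with s hs hsZ
        exact hP (m + 1) hmk s hsZ ⟨fun _ => by push_cast; exact hs.1.le,
          fun _ => by push_cast; exact hs.2.le⟩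
    have hdeg : (P (m + 1) - P m).natDegree ≤ d :=
      (natDegree_sub_le _ _).trans (max_le (hPd _) (hPd _))
    conv_lhs => rw [← sum_taylor_eq (P (m + 1) - P m) κ]
    rw [sum_over_range' _ (by simp) ((r + 1) + (d - r)) (by rw [natDegree_taylor]; omega),
      Finset.sum_range_add, Finset.sum_eq_zero, zero_add, Finset.sum_range]
    intro i hi
    rw [hz i (Finset.mem_range.1 hi)]
    simp
  -- Telescoping: each knot that is passed adds its jump.
  have hpoly : ∀ a < k, splPoly x a = P a := by
    intro a
    induction a with
    | zero =>
      intro _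
      simp only [splPoly, Nat.not_lt_zero, if_false, Finset.sum_const_zero, add_zero]
      conv_rhs => rw [as_sum_range_C_mul_X_pow' (P 0) (n := d + 1) (Nat.lt_succ_of_le (hPd 0))]
      rw [Finset.sum_range]
    | succ a ih =>
      intro ha
      have h1 : P (a + 1) = P a + (P (a + 1) - P a) := by ring
      have h2 := hjump ⟨a, by omega⟩
      simp only at h2
      rw [h1, h2, ← ih (by omega), splPoly, splPoly, add_assoc]
      congr 1
      rw [← Finset.sum_erase_add _ _ (Finset.mem_univ (⟨a, by omega⟩ : Fin (k - 1))),
        ← Finset.sum_erase_add (a := (⟨a, by omega⟩ : Fin (k - 1))) _ _ (Finset.mem_univ _)]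
      simp only [lt_add_iff_pos_right, zero_lt_one, if_true, lt_irrefl, if_false, add_zero]
      congr 1
      refine Finset.sum_congr rfl fun m hm => ?_
      have : (m : ℕ) ≠ a := fun h => (Finset.mem_erase.1 hm).1 (Fin.ext h)
      have h3 : ((m : ℕ) < a + 1) ↔ (m : ℕ) < a := by omega
      simp only [h3]
  refine ⟨splEval k d r x, ⟨x, rfl⟩, fun s hs => ?_⟩
  obtain ⟨a, ha, has⟩ := exists_mem_linePiece hk s
  rw [splEval_eq_splPoly x ha has, hpoly a ha, hP a ha s hs has]

theorem mem_Spl_iff {k d r : ℕ} (hk : 0 < k) {u : ℝ → ℝ} :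
    u ∈ Spl k d r ↔ IsPiecewise k d univ u ∧ (1 < k → ContDiff ℝ r u) := by
  refine ⟨fun hu => ⟨Spl.isPiecewise hu univ, fun _ => Spl.contDiff hu⟩, fun ⟨h1, h2⟩ => ?_⟩
  obtain ⟨v, hv, huv⟩ := exists_spl_eqOn hk isOpen_univ (fun _ _ _ => mem_univ _) h1
    (fun h => contDiffOn_univ.2 (h2 h))
  rwa [show u = v from funext fun s => huv (mem_univ s)]

theorem div_nat_mem_Ioo {m k : ℕ} (h0 : 0 < m) (h1 : m < k) : (m : ℝ) / k ∈ Ioo (0 : ℝ) 1 := by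
  have hm : (0 : ℝ) < m := by exact_mod_cast h0
  have hmk : (m : ℝ) < k := by exact_mod_cast h1
  exact ⟨div_pos hm (hm.trans hmk), (div_lt_one (hm.trans hmk)).2 hmk⟩

/-- Every piece, also an unbounded one, meets `(0, 1)` in an open interval, and infinitely many
common values identify its polynomial. -/
theorem IsPiecewise.eq_of_eqOn {k d : ℕ} {u v : ℝ → ℝ} (hk : 0 < k)
    (hu : IsPiecewise k d univ u) (hv : IsPiecewise k d univ v) (h : EqOn u v (Ioo 0 1)) :
    u = v := by
  have hk' : (0 : ℝ) < k := by exact_mod_cast hk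
  ext s
  obtain ⟨a, ha, has⟩ := exists_mem_linePiece hk s
  obtain ⟨P, -, hP⟩ := hu ⟨a, ha⟩
  obtain ⟨R, -, hR⟩ := hv ⟨a, ha⟩
  have hPR : P = R := by
    refine eq_of_infinite_eval_eq P R (Set.Infinite.mono ?_ (Ioo_infinite
      (show (a : ℝ) / k < ((a : ℝ) + 1) / k by gcongr; linarith)))
    intro x hx
    have hxp : x ∈ linePiece k a := ⟨fun _ => hx.1.le, fun _ => hx.2.le⟩
    have hx0 : x ∈ Ioo (0 : ℝ) 1 := by
      refine ⟨lt_of_le_of_lt (by positivity) hx.1, hx.2.trans_le ?_⟩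
      rw [div_le_one hk']
      exact_mod_cast ha
    rw [mem_ofPred_eq, ← hP x (mem_univ _) hxp, ← hR x (mem_univ _) hxp, h hx0]
  rw [hP s (mem_univ _) has, hR s (mem_univ _) has, hPR]

theorem Spl.eq_of_eqOn {k d r d' r' : ℕ} {u v : ℝ → ℝ} (hk : 0 < k) (hu : u ∈ Spl k d r)
    (hv : v ∈ Spl k d' r') (h : EqOn u v (Ioo 0 1)) : u = v := by
  refine IsPiecewise.eq_of_eqOn (d := max d d') hk (fun a => ?_) (fun a => ?_) h
  · obtain ⟨P, h1, h2⟩ := Spl.isPiecewise hu univ a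
    exact ⟨P, h1.trans (le_max_left _ _), h2⟩
  · obtain ⟨P, h1, h2⟩ := Spl.isPiecewise hv univ a
    exact ⟨P, h1.trans (le_max_right _ _), h2⟩

theorem Spl.mono {k d d' r r' : ℕ} (hk : 0 < k) (hd : d ≤ d') (hr : r' ≤ r) :
    Spl k d r ≤ Spl k d' r' := by
  intro u hu
  refine (mem_Spl_iff hk).2 ⟨fun a => ?_, fun _ => (Spl.contDiff hu).of_le (by exact_mod_cast hr)⟩
  obtain ⟨P, h1, h2⟩ := Spl.isPiecewise hu univ a
  exact ⟨P, h1.trans hd, h2⟩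

theorem Spl.comp_one_sub {k d r : ℕ} (hk : 0 < k) {u : ℝ → ℝ} (hu : u ∈ Spl k d r) :
    (fun s => u (1 - s)) ∈ Spl k d r := by
  have hk' : (0 : ℝ) < k := by exact_mod_cast hk
  refine (mem_Spl_iff hk).2 ⟨fun a => ?_, fun _ => (Spl.contDiff hu).comp (by fun_prop)⟩
  obtain ⟨P, h1, h2⟩ := Spl.isPiecewise hu univ a.rev
  refine ⟨P.comp (1 - X), ?_, fun s _ hs => ?_⟩
  · refine natDegree_comp_le.trans ?_
    have : (1 - X : ℝ[X]).natDegree ≤ 1 := by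
      refine (natDegree_sub_le _ _).trans ?_
      simp
    calc _ ≤ d * 1 := Nat.mul_le_mul h1 this
      _ = d := mul_one d
  · show u (1 - s) = _
    rw [h2 (1 - s) (mem_univ _), eval_comp]
    · simp
    · have hr : ((a.rev : ℕ) : ℝ) = k - 1 - a := by
        rw [Fin.val_rev, Nat.cast_sub (by have := a.2; omega)]
        push_cast
        ring
      constructor
      · intro h
        rw [Fin.val_rev] at h
        have h3 := hs.2 (by omega)
        rw [hr, div_le_iff₀ hk']
        rw [le_div_iff₀ hk'] at h3
        linarith
      · intro h
        rw [Fin.val_rev] at h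
        have h3 := hs.1 (by omega)
        rw [hr, le_div_iff₀ hk']
        rw [div_le_iff₀ hk'] at h3
        linarith

theorem Spl.affine_mul {k d r : ℕ} (hk : 0 < k) {u : ℝ → ℝ} (hu : u ∈ Spl k d r) (x y : ℝ) :
    (fun s => ((1 - s) * x + s * y) * u s) ∈ Spl k (d + 1) r := by
  refine (mem_Spl_iff hk).2 ⟨fun a => ?_, fun _ => ContDiff.mul (by fun_prop) (Spl.contDiff hu)⟩
  obtain ⟨P, h1, h2⟩ := Spl.isPiecewise hu univ a
  refine ⟨(C (y - x) * X + C x) * P, ?_, fun s hs hsa => ?_⟩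
  · refine natDegree_mul_le.trans ?_
    have := natDegree_linear_le (a := y - x) (b := x)
    omega
  · show ((1 - s) * x + s * y) * u s = _
    rw [h2 s hs hsa]
    simp
    left
    ring

theorem linePiece_uniqueDiffOn {k a : ℕ} (ha : a < k) : UniqueDiffOn ℝ (linePiece k a) := by
  have hk' : (0 : ℝ) < k := by exact_mod_cast (by omega : 0 < k)
  have hconv : Convex ℝ (linePiece k a) := by
    have : linePiece k a = {s | 0 < a → (a : ℝ) / k ≤ s} ∩ {s | a + 1 < k → s ≤ ((a : ℝ) + 1) / k} :=
      rfl
    rw [this]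
    refine Convex.inter ?_ ?_
    · by_cases h : 0 < a
      · simp only [h, true_imp_iff]; exact convex_Ici _
      · simp only [h, false_imp_iff, ofPred_true]; exact convex_univ
    · by_cases h : a + 1 < k
      · simp only [h, true_imp_iff]; exact convex_Iic _
      · simp only [h, false_imp_iff, ofPred_true]; exact convex_univ
  refine uniqueDiffOn_convex hconv ?_
  have hlt : (a : ℝ) / k < ((a : ℝ) + 1) / k := by gcongr; linarith
  have : Ioo ((a : ℝ) / k) (((a : ℝ) + 1) / k) ⊆ linePiece k a :=
    fun x hx => ⟨fun _ => hx.1.le, fun _ => hx.2.le⟩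
  exact (nonempty_Ioo.2 hlt).mono (interior_maximal this isOpen_Ioo)

theorem Spl.deriv_mem {k d r : ℕ} (hk : 0 < k) {u : ℝ → ℝ} (hu : u ∈ Spl k (d + 1) (r + 1)) :
    deriv u ∈ Spl k d r := by
  have hcd := Spl.contDiff hu
  refine (mem_Spl_iff hk).2 ⟨fun a => ?_, fun _ => ?_⟩
  · obtain ⟨P, h1, h2⟩ := Spl.isPiecewise hu univ a
    refine ⟨derivative P, (natDegree_derivative_le P).trans (by omega), fun s _ hs => ?_⟩
    have hd : DifferentiableAt ℝ u s := hcd.differentiable (by simp) s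
    -- A piece is no neighbourhood of its knots, so there the derivative is identified within the
    -- piece.
    exact (linePiece_uniqueDiffOn a.2 s hs).eq_deriv _
      hd.hasDerivAt.hasDerivWithinAt
      (((P.hasDerivAt s).hasDerivWithinAt (s := linePiece k a)).congr
        (fun x hx => h2 x (mem_univ _) hx) (h2 s (mem_univ _) hs))
  · have := (contDiff_succ_iff_deriv (n := r) (f := u)).1 (by exact_mod_cast hcd)
    exact this.2.2

/-- There is no knot at `0`, and by symmetry none at `1`. Near the end points a spline is thus
smooth of every order, which gives meaning to second derivatives at the vertices although `FaceSpl
3` is only of class `C¹`. -/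
theorem Spl.eventuallyEq_zero {k d r : ℕ} (hk : 0 < k) {u : ℝ → ℝ} (hu : u ∈ Spl k d r) :
    ∃ P : ℝ[X], u =ᶠ[𝓝 0] fun s => P.eval s := by
  have hk' : (0 : ℝ) < k := by exact_mod_cast hk
  obtain ⟨P, -, h⟩ := Spl.isPiecewise hu univ ⟨0, hk⟩
  refine ⟨P, ?_⟩
  filter_upwards [Iio_mem_nhds (show (0 : ℝ) < 1 / k by positivity)] with s hs
  refine h s (mem_univ _) ⟨fun h => absurd h (lt_irrefl 0), fun _ => ?_⟩
  simpa using (mem_Iio.1 hs).le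

theorem Spl.eventuallyEq_one {k d r : ℕ} (hk : 0 < k) {u : ℝ → ℝ} (hu : u ∈ Spl k d r) :
    ∃ P : ℝ[X], u =ᶠ[𝓝 1] fun s => P.eval s := by
  obtain ⟨P, hP⟩ := Spl.eventuallyEq_zero hk (Spl.comp_one_sub hk hu)
  refine ⟨P.comp (1 - X), ?_⟩
  have h1 : Tendsto (fun s : ℝ => 1 - s) (𝓝 1) (𝓝 0) := by
    have : Continuous fun s : ℝ => 1 - s := by fun_prop
    simpa using this.tendsto 1
  filter_upwards [h1.eventually hP] with s hs
  rw [eval_comp]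
  simpa using hs

theorem Spl.contDiffAt_zero {k d r : ℕ} (hk : 0 < k) {u : ℝ → ℝ} (hu : u ∈ Spl k d r)
    (n : WithTop ℕ∞) : ContDiffAt ℝ n u 0 := by
  obtain ⟨P, hP⟩ := Spl.eventuallyEq_zero hk hu
  exact (ContDiff.contDiffAt (by simpa using P.contDiff_aeval (𝕜 := ℝ) n)).congr_of_eventuallyEq hP

theorem Spl.contDiffAt_one {k d r : ℕ} (hk : 0 < k) {u : ℝ → ℝ} (hu : u ∈ Spl k d r)
    (n : WithTop ℕ∞) : ContDiffAt ℝ n u 1 := by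
  obtain ⟨P, hP⟩ := Spl.eventuallyEq_one hk hu
  exact (ContDiff.contDiffAt (by simpa using P.contDiff_aeval (𝕜 := ℝ) n)).congr_of_eventuallyEq hP

/-! ### Interpolation by univariate splines -/

/-- The derivatives of order less than `q` at the end points of `[0, 1]` and the values at the points
of `N`. -/
def splDof (q : ℕ) (N : Set ℝ) : (Fin q × Fin 2) ⊕ N → (ℝ → ℝ) → ℝ
  | .inl me, u => deriv^[(me.1 : ℕ)] u ((me.2 : ℕ) : ℝ)
  | .inr x, u => u x

theorem splDof_add {q : ℕ} {N : Set ℝ} (j : (Fin q × Fin 2) ⊕ N) {r : ℕ} (hq : q ≤ r + 1)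
    {u v : ℝ → ℝ} (hu : ContDiff ℝ r u) (hv : ContDiff ℝ r v) :
    splDof q N j (u + v) = splDof q N j u + splDof q N j v := by
  rcases j with ⟨m, e⟩ | x
  · have hm : ((m : ℕ) : WithTop ℕ∞) ≤ r := by exact_mod_cast (by omega : (m : ℕ) ≤ r)
    simp only [splDof, ← iteratedDeriv_eq_iterate]
    exact iteratedDeriv_add (hu.of_le hm).contDiffAt (hv.of_le hm).contDiffAt
  · rfl

theorem splDof_smul {q : ℕ} {N : Set ℝ} (j : (Fin q × Fin 2) ⊕ N) {r : ℕ} (hq : q ≤ r + 1)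
    {u : ℝ → ℝ} (hu : ContDiff ℝ r u) (c : ℝ) :
    splDof q N j (c • u) = c * splDof q N j u := by
  rcases j with ⟨m, e⟩ | x
  · have hm : ((m : ℕ) : WithTop ℕ∞) ≤ r := by exact_mod_cast (by omega : (m : ℕ) ≤ r)
    simp only [splDof, ← iteratedDeriv_eq_iterate]
    rw [iteratedDeriv_const_smul (hu.of_le hm).contDiffAt c, smul_eq_mul]
  · rfl

/-- A family of splines that is dual to the interpolation conditions. -/
structure IsSplDual (q : ℕ) (N : Set ℝ) [Fintype N] (W : Submodule ℝ (ℝ → ℝ))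
    (b : (Fin q × Fin 2) ⊕ N → ℝ → ℝ) : Prop where
  mem : ∀ j, b j ∈ W
  dof : ∀ c : (Fin q × Fin 2) ⊕ N → ℝ, ∀ j, splDof q N j (fun s => ∑ i, c i * b i s) = c j
  repr : ∀ u ∈ W, u = fun s => ∑ j, splDof q N j u * b j s

theorem IsSplDual.sum_mem {q : ℕ} {N : Set ℝ} [Fintype N] {W : Submodule ℝ (ℝ → ℝ)}
    {b : (Fin q × Fin 2) ⊕ N → ℝ → ℝ} (h : IsSplDual q N W b) (c : (Fin q × Fin 2) ⊕ N → ℝ) :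
    (fun s => ∑ i, c i * b i s) ∈ W := by
  have : (fun s => ∑ i, c i * b i s) = ∑ i, c i • b i := by
    ext s
    simp
  rw [this]
  exact W.sum_mem fun i _ => W.smul_mem _ (h.mem i)

/-- Equality of dimensions makes the injective map from coefficients to data an isomorphism; the
dual family consists of the preimages of the unit vectors. The condition `q ≤ r + 1` ensures that
the derivatives in question are linear on the space. -/
theorem exists_isSplDual {q : ℕ} {N : Set ℝ} [Fintype N] {k d r : ℕ} (hq : q ≤ r + 1)
    (hcard : 2 * q + Fintype.card N = d + 1 + (k - 1) * (d - r))
    (hinj : ∀ x : SplCoef k d r, (∀ j, splDof q N j (splEval k d r x) = 0) → x = 0) :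
    ∃ b, IsSplDual q N (Spl k d r) b := by
  classical
  have hcd : ∀ x, ContDiff ℝ r (splEval k d r x) := fun x => Spl.contDiff ⟨x, rfl⟩
  let L : SplCoef k d r →ₗ[ℝ] ((Fin q × Fin 2) ⊕ N → ℝ) :=
    { toFun := fun x j => splDof q N j (splEval k d r x)
      map_add' := fun x y => by
        ext j
        rw [map_add]
        exact splDof_add j hq (hcd x) (hcd y)
      map_smul' := fun c x => by
        ext j
        rw [map_smul]
        exact splDof_smul j hq (hcd x) c }
  have hL : Function.Injective L :=
    (injective_iff_map_eq_zero L).2 fun x hx => hinj x fun j => congrFun hx j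
  have hdim : Module.finrank ℝ (SplCoef k d r) =
      Module.finrank ℝ ((Fin q × Fin 2) ⊕ N → ℝ) := by
    simp only [SplCoef, Module.finrank_prod, Module.finrank_pi, Module.finrank_pi_fintype,
      Fintype.card_fin, Fintype.card_sum, Fintype.card_prod, Finset.sum_const, Finset.card_univ,
      smul_eq_mul]
    omega
  let e := LinearEquiv.ofInjectiveOfFinrankEq L hL hdim
  have he : ∀ x, e x = L x := fun x => rfl
  have hsum : ∀ c : (Fin q × Fin 2) ⊕ N → ℝ,
      (fun s => ∑ i, c i * splEval k d r (e.symm (Pi.single i 1)) s) =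
        splEval k d r (e.symm c) := by
    intro c
    have h1 : c = ∑ i, c i • (Pi.single i (1 : ℝ) : (Fin q × Fin 2) ⊕ N → ℝ) := by
      ext j
      simp [Finset.sum_apply, Pi.single_apply]
    conv_rhs => rw [h1]
    ext s
    simp only [map_sum, map_smul, Finset.sum_apply, Pi.smul_apply, smul_eq_mul]
  refine ⟨fun j => splEval k d r (e.symm (Pi.single j 1)), fun j => ⟨_, rfl⟩, fun c j => ?_, ?_⟩
  · rw [hsum c]
    have : L (e.symm c) j = c j := by rw [← he, e.apply_symm_apply]
    exact this
  · rintro _ ⟨x, rfl⟩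
    rw [hsum]
    have : (fun j => splDof q N j (splEval k d r x)) = e x := rfl
    rw [this, e.symm_apply_apply]

/-! ### Unisolvence of the univariate interpolation conditions -/

theorem splPoly_iterate_derivative_eval {k d r : ℕ} (x : SplCoef k d r) (a m : ℕ) (t : ℝ) :
    (derivative^[m] (splPoly x a)).eval t =
      ∑ i, x.1 i * (((i : ℕ).descFactorial m : ℝ) * t ^ ((i : ℕ) - m)) +
      ∑ j : Fin (k - 1), if (j : ℕ) < a then ∑ i, x.2 j i *
        (((r + 1 + (i : ℕ)).descFactorial m : ℝ) * (t - ((j : ℝ) + 1) / k) ^ (r + 1 + (i : ℕ) - m))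
        else 0 := by
  rw [splPoly, iterate_map_add, iterate_derivative_sum, iterate_derivative_sum, eval_add,
    eval_finsetSum, eval_finsetSum]
  congr 1
  · refine Finset.sum_congr rfl fun i _ => ?_
    rw [iterate_derivative_C_mul, iterate_derivative_X_pow_eq_smul]
    simp [mul_left_comm]
  · refine Finset.sum_congr rfl fun j _ => ?_
    split_ifs
    · rw [iterate_derivative_sum, eval_finsetSum]
      refine Finset.sum_congr rfl fun i _ => ?_
      rw [iterate_derivative_C_mul, iterate_derivative_X_sub_pow]
      simp
    · simp

theorem splEval_eventuallyEq_zero {k d r : ℕ} (hk : 0 < k) (x : SplCoef k d r) :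
    splEval k d r x =ᶠ[𝓝 0] fun s => (splPoly x 0).eval s := by
  have hk' : (0 : ℝ) < k := by exact_mod_cast hk
  filter_upwards [Iio_mem_nhds (show (0 : ℝ) < 1 / k by positivity)] with s hs
  refine splEval_eq_splPoly x hk ⟨fun h => absurd h (lt_irrefl 0), fun _ => ?_⟩
  simpa using (mem_Iio.1 hs).le

theorem splEval_eventuallyEq_one {k d r : ℕ} (hk : 0 < k) (x : SplCoef k d r) :
    splEval k d r x =ᶠ[𝓝 1] fun s => (splPoly x (k - 1)).eval s := by
  have hk' : (0 : ℝ) < k := by exact_mod_cast hk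
  have h1 : ((k - 1 : ℕ) : ℝ) / k < 1 := by
    rw [div_lt_one hk']
    exact_mod_cast (by omega : k - 1 < k)
  filter_upwards [Ioi_mem_nhds h1] with s hs
  exact splEval_eq_splPoly x (by omega) ⟨fun _ => (mem_Ioi.1 hs).le, fun h => by omega⟩

theorem iterate_deriv_splEval_zero {k d r : ℕ} (hk : 0 < k) (x : SplCoef k d r) (m : ℕ) :
    deriv^[m] (splEval k d r x) 0 = (derivative^[m] (splPoly x 0)).eval 0 := by
  have h := (splEval_eventuallyEq_zero hk x).iteratedDeriv_eq m
  rw [iteratedDeriv_eq_iterate, iteratedDeriv_eq_iterate, iterate_deriv_eval] at h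
  exact h

theorem iterate_deriv_splEval_one {k d r : ℕ} (hk : 0 < k) (x : SplCoef k d r) (m : ℕ) :
    deriv^[m] (splEval k d r x) 1 = (derivative^[m] (splPoly x (k - 1))).eval 1 := by
  have h := (splEval_eventuallyEq_one hk x).iteratedDeriv_eq m
  rw [iteratedDeriv_eq_iterate, iteratedDeriv_eq_iterate, iterate_deriv_eval] at h
  exact h

/-- A polynomial with two `q`-fold zeros at the end points and further zeros in between vanishes if
its degree is less than their total number. -/
theorem eq_zero_of_roots {q : ℕ} {N : Set ℝ} [Fintype N] (hN : N ⊆ Ioo 0 1) {P : ℝ[X]}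
    (hdeg : P.natDegree < 2 * q + Fintype.card N)
    (h0 : ∀ m < q, (derivative^[m] P).eval 0 = 0) (h1 : ∀ m < q, (derivative^[m] P).eval 1 = 0)
    (hx : ∀ x ∈ N, P.eval x = 0) : P = 0 := by
  classical
  by_contra hP
  have hend : ∀ e : ℝ, (∀ m < q, (derivative^[m] P).eval e = 0) → q ≤ P.rootMultiplicity e := by
    intro e he
    rcases q with _ | q
    · exact Nat.zero_le _
    · exact (lt_rootMultiplicity_iff_isRoot_iterate_derivative hP).2
        fun m hm => he m (Nat.lt_succ_of_le hm)
  have hnode : ∀ x ∈ N, 1 ≤ P.rootMultiplicity x := fun x hxN =>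
    (rootMultiplicity_pos hP).2 (hx x hxN)
  have hn0 : (0 : ℝ) ∉ insert (1 : ℝ) N.toFinset := by
    simp only [Finset.mem_insert, mem_toFinset, not_or]
    exact ⟨zero_ne_one, fun h => lt_irrefl _ (hN h).1⟩
  have hn1 : (1 : ℝ) ∉ N.toFinset := by
    simp only [mem_toFinset]
    exact fun h => lt_irrefl _ (hN h).2
  have hsum : q + (q + Fintype.card N) ≤
      ∑ x ∈ insert 0 (insert 1 N.toFinset), P.rootMultiplicity x := by
    rw [Finset.sum_insert hn0, Finset.sum_insert hn1]
    refine add_le_add (hend 0 h0) (add_le_add (hend 1 h1) ?_)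
    rw [← toFinset_card, Finset.card_eq_sum_ones]
    exact Finset.sum_le_sum fun x hxN => hnode x (mem_toFinset.1 hxN)
  have hle : ∑ x ∈ insert 0 (insert 1 N.toFinset), P.rootMultiplicity x ≤ P.natDegree := by
    refine le_trans ?_ (card_roots' P)
    simp_rw [← count_roots]
    rw [← Multiset.sum_count_eq_card (s := insert 0 (insert 1 N.toFinset) ∪ P.roots.toFinset)
      fun x hxP => Finset.mem_union_right _ (Multiset.mem_toFinset.2 hxP)]
    exact Finset.sum_le_sum_of_subset Finset.subset_union_left
  omega

theorem splCoef_one_ext {d r : ℕ} {x : SplCoef 1 d r} (h : splPoly x 0 = 0) : x = 0 := by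
  have h1 : ∀ i : Fin (d + 1), x.1 i = 0 := by
    intro i
    have h2 : (splPoly x 0).coeff i = x.1 i := by
      simp only [splPoly, Nat.not_lt_zero, if_false, Finset.sum_const_zero, add_zero,
        finsetSum_coeff, coeff_C_mul, coeff_X_pow]
      rw [Finset.sum_eq_single i]
      · simp
      · intro j _ hj
        rw [if_neg (fun h => hj (Fin.ext h.symm)), mul_zero]
      · simp
    rw [← h2, h, coeff_zero]
  ext i
  · exact h1 i
  · exact absurd i.2 (by simp)

/-- Without interior knots this is Hermite interpolation: a polynomial of degree at most `d` with `d
+ 1` zeros, counted with multiplicity, vanishes. -/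
theorem exists_isSplDual_one {q : ℕ} {N : Set ℝ} [Fintype N] (hN : N ⊆ Ioo 0 1) {d r : ℕ}
    (hq : q ≤ r + 1) (hcard : 2 * q + Fintype.card N = d + 1) :
    ∃ b, IsSplDual q N (Spl 1 d r) b := by
  refine exists_isSplDual hq (by simpa using hcard) fun x hx => splCoef_one_ext ?_
  have hall : ∀ s, splEval 1 d r x s = (splPoly x 0).eval s := fun s =>
    splEval_eq_splPoly x one_pos ⟨fun h => absurd h (lt_irrefl 0), fun h => absurd h (by simp)⟩
  refine eq_zero_of_roots hN (q := q) ?_ (fun m hm => ?_) (fun m hm => ?_) fun s hs => ?_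
  · have := splPoly_natDegree x 0
    omega
  · rw [← iterate_deriv_splEval_zero one_pos]
    simpa [splDof] using hx (.inl (⟨m, hm⟩, 0))
  · refine (iterate_deriv_splEval_one one_pos x m).symm.trans ?_
    simpa [splDof] using hx (.inl (⟨m, hm⟩, 1))
  · rw [← hall]
    exact hx (.inr ⟨s, hs⟩)

/-- The conditions as explicit linear forms, for the systems of the macro-elements. At `0` no
truncated power contributes. Where the exponent `i - m` is truncated to zero because `i < m`, the
descending factorial vanishes. -/
theorem splDof_inl_zero {q : ℕ} {N : Set ℝ} {k d r : ℕ} (hk : 0 < k) (x : SplCoef k d r)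
    (m : Fin q) : splDof q N (.inl (m, 0)) (splEval k d r x) =
      ∑ i, x.1 i * (((i : ℕ).descFactorial m : ℝ) * 0 ^ ((i : ℕ) - (m : ℕ))) := by
  have h := iterate_deriv_splEval_zero hk x m
  rw [splPoly_iterate_derivative_eval] at h
  simp only [Nat.not_lt_zero, if_false, Finset.sum_const_zero, add_zero] at h
  simpa [splDof] using h

theorem splDof_inl_one {q : ℕ} {N : Set ℝ} {k d r : ℕ} (hk : 0 < k) (x : SplCoef k d r)
    (m : Fin q) : splDof q N (.inl (m, 1)) (splEval k d r x) =
      ∑ i, x.1 i * (((i : ℕ).descFactorial m : ℝ) * 1 ^ ((i : ℕ) - (m : ℕ))) +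
      ∑ j : Fin (k - 1), ∑ i, x.2 j i *
        (((r + 1 + (i : ℕ)).descFactorial m : ℝ) *
          (1 - ((j : ℝ) + 1) / k) ^ (r + 1 + (i : ℕ) - (m : ℕ))) := by
  have h := iterate_deriv_splEval_one hk x m
  rw [splPoly_iterate_derivative_eval] at h
  simp only [Fin.is_lt, if_true] at h
  simpa [splDof] using h

/-! ### Number and location of the nodes -/

theorem image_div_finite_ncard {N : Set ℝ} {c : ℝ} (hc : c ≠ 0) {a b : ℕ}
    (h : N = {s | ∃ j : ℕ, a ≤ j ∧ j ≤ b ∧ s = (j : ℝ) / c}) :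
    N.Finite ∧ N.ncard = b + 1 - a := by
  have h1 : N = (fun j : ℕ => (j : ℝ) / c) '' (Finset.Icc a b : Set ℕ) := by
    rw [h]
    ext s
    simp only [mem_ofPred_eq, Finset.coe_Icc, mem_image, mem_Icc]
    exact ⟨fun ⟨j, h1, h2, h3⟩ => ⟨j, ⟨h1, h2⟩, h3.symm⟩, fun ⟨j, ⟨h1, h2⟩, h3⟩ => ⟨j, h1, h2, h3.symm⟩⟩
  rw [h1]
  refine ⟨(Finset.finite_toSet _).image _, ?_⟩
  rw [ncard_image_of_injective, ncard_coe_finset, Nat.card_Icc]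
  intro i j hij
  have := (div_left_inj' hc).1 hij
  exact_mod_cast this

theorem edgeValueNodes_finite_ncard {p : ℕ} (hp : 3 ≤ p) :
    (edgeValueNodes p).Finite ∧ (edgeValueNodes p).ncard = p - 5 := by
  have h := image_div_finite_ncard (N := edgeValueNodes p) (c := p) (a := 3) (b := p - 3)
    (by exact_mod_cast (by omega)) (by
      ext s
      exact exists_congr fun j => ⟨fun ⟨h1, h2, h3⟩ => ⟨h1, by omega, h3⟩,
        fun ⟨h1, h2, h3⟩ => ⟨h1, by omega, h3⟩⟩)
  exact ⟨h.1, h.2.trans (by omega)⟩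

theorem edgeNormalNodes_finite_ncard {p : ℕ} (hp : 5 ≤ p) :
    (edgeNormalNodes p).Finite ∧ (edgeNormalNodes p).ncard = p - 4 := by
  have hp' : (5 : ℝ) ≤ p := by exact_mod_cast hp
  have h := image_div_finite_ncard (N := edgeNormalNodes p) (c := (p : ℝ) - 1) (a := 2) (b := p - 3)
    (by linarith) (by
      rw [edgeNormalNodes, if_neg (by omega)]
      ext s
      exact exists_congr fun j => ⟨fun ⟨h1, h2, h3⟩ => ⟨h1, by omega, h3⟩,
        fun ⟨h1, h2, h3⟩ => ⟨h1, by omega, h3⟩⟩)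
  exact ⟨h.1, h.2.trans (by omega)⟩

theorem edgeNormalNodes_of_le {p : ℕ} (hp : p ≤ 4) : edgeNormalNodes p = {1 / 2} := by
  rw [edgeNormalNodes, if_pos hp]

theorem faceNodes_finite_ncard {p : ℕ} (hp : 5 ≤ p) :
    (faceNodes p).Finite ∧ (faceNodes p).ncard = p - 3 := by
  have h := image_div_finite_ncard (N := faceNodes p) (c := p) (a := 2) (b := p - 2)
    (by exact_mod_cast (by omega)) (by
      rw [faceNodes, if_neg (by omega), if_neg (by omega)]
      ext s
      exact exists_congr fun j => ⟨fun ⟨h1, h2, h3⟩ => ⟨h1, by omega, h3⟩,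
        fun ⟨h1, h2, h3⟩ => ⟨h1, by omega, h3⟩⟩)
  exact ⟨h.1, h.2.trans (by omega)⟩

theorem faceNodes_three : faceNodes 3 = {2 / 9, 4 / 9, 5 / 9, 7 / 9} := by simp [faceNodes]

theorem faceNodes_four : faceNodes 4 = {1 / 4, 2 / 4, 3 / 4} := by simp [faceNodes]

theorem faceNodes_finite {p : ℕ} (hp : 3 ≤ p) : (faceNodes p).Finite := by
  rcases Nat.lt_or_ge p 5 with h | h
  · obtain rfl | rfl : p = 3 ∨ p = 4 := by omega
    · rw [faceNodes_three]; exact toFinite _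
    · rw [faceNodes_four]; exact toFinite _
  · exact (faceNodes_finite_ncard h).1

theorem edgeNormalNodes_finite (p : ℕ) : (edgeNormalNodes p).Finite := by
  rcases Nat.lt_or_ge p 5 with h | h
  · rw [edgeNormalNodes_of_le (by omega)]; exact toFinite _
  · exact (edgeNormalNodes_finite_ncard h).1

theorem edgeValueNodes_subset (p : ℕ) : edgeValueNodes p ⊆ Ioo 0 1 := by
  rintro s ⟨j, h1, h2, rfl⟩
  exact div_nat_mem_Ioo (by omega) (by omega)

theorem edgeNormalNodes_subset (p : ℕ) : edgeNormalNodes p ⊆ Ioo 0 1 := by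
  rcases Nat.lt_or_ge p 5 with h | h
  · rw [edgeNormalNodes_of_le (by omega)]
    norm_num
  · rw [edgeNormalNodes, if_neg (by omega)]
    rintro s ⟨j, h1, h2, rfl⟩
    have := div_nat_mem_Ioo (m := j) (k := p - 1) (by omega) (by omega)
    rwa [Nat.cast_sub (by omega), Nat.cast_one] at this

theorem faceNodes_subset {p : ℕ} (hp : 3 ≤ p) : faceNodes p ⊆ Ioo 0 1 := by
  rcases Nat.lt_or_ge p 5 with h | h
  · obtain rfl | rfl : p = 3 ∨ p = 4 := by omega
    · rw [faceNodes_three]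
      rintro s (rfl | rfl | rfl | rfl) <;> norm_num
    · rw [faceNodes_four]
      rintro s (rfl | rfl | rfl) <;> norm_num
  · rw [faceNodes, if_neg (by omega), if_neg (by omega)]
    rintro s ⟨j, h1, h2, rfl⟩
    exact div_nat_mem_Ioo (by omega) (by omega)

theorem card_eq_ncard (N : Set ℝ) [Fintype N] : Fintype.card N = N.ncard := by
  rw [← Nat.card_eq_fintype_card, Nat.card_coe_set_eq]

theorem numSub_of_le {p : ℕ} (hp : 5 ≤ p) : numSub p = 1 := by
  simp only [numSub]; omega

/-! ### The linear systems of the macro-elements for degrees three and four -/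

theorem exists_edge_dual_three [Fintype (edgeValueNodes 3)] :
    ∃ b, IsSplDual 3 (edgeValueNodes 3) (Spl 3 3 2) b := by
  refine exists_isSplDual (by norm_num) ?_ fun x hx => ?_
  · rw [card_eq_ncard, (edgeValueNodes_finite_ncard (by norm_num)).2]
  · have h0 := fun m : Fin 3 => (splDof_inl_zero (N := edgeValueNodes 3) (k := 3)
      (by norm_num) x m).symm.trans (hx (.inl (m, 0)))
    have h1 := fun m : Fin 3 => (splDof_inl_one (N := edgeValueNodes 3) (k := 3)
      (by norm_num) x m).symm.trans (hx (.inl (m, 1)))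
    change ∀ m, ∑ i : Fin 4, _ = _ at h0
    change ∀ m, ∑ i : Fin 4, _ + ∑ j : Fin 2, ∑ i : Fin 1, _ = _ at h1
    have h00 := h0 0
    have h01 := h0 1
    have h02 := h0 2
    have h10 := h1 0
    have h11 := h1 1
    have h12 := h1 2
    -- Six homogeneous equations for six unknowns: four monomials and one truncated cube at each of
    -- the knots `1/3` and `2/3`. Each unknown is a linear consequence of them.
    simp [Fin.sum_univ_succ, Nat.descFactorial] at h00 h01 h02 h10 h11 h12
    clear h0 h1 hx
    refine Prod.ext (funext fun i : Fin 4 => ?_)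
      (funext fun j : Fin 2 => funext fun i : Fin 1 => ?_)
    · fin_cases i <;> simp <;> linarith
    · fin_cases j <;> fin_cases i <;> simp <;> linarith

theorem exists_edge_dual_four [Fintype (edgeValueNodes 4)] :
    ∃ b, IsSplDual 3 (edgeValueNodes 4) (Spl 2 4 3) b := by
  refine exists_isSplDual (by norm_num) ?_ fun x hx => ?_
  · rw [card_eq_ncard, (edgeValueNodes_finite_ncard (by norm_num)).2]
  · have h0 := fun m : Fin 3 => (splDof_inl_zero (N := edgeValueNodes 4) (k := 2)
      (by norm_num) x m).symm.trans (hx (.inl (m, 0)))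
    have h1 := fun m : Fin 3 => (splDof_inl_one (N := edgeValueNodes 4) (k := 2)
      (by norm_num) x m).symm.trans (hx (.inl (m, 1)))
    change ∀ m, ∑ i : Fin 5, _ = _ at h0
    change ∀ m, ∑ i : Fin 5, _ + ∑ j : Fin 1, ∑ i : Fin 1, _ = _ at h1
    have h00 := h0 0
    have h01 := h0 1
    have h02 := h0 2
    have h10 := h1 0
    have h11 := h1 1
    have h12 := h1 2
    simp [Fin.sum_univ_succ, Nat.descFactorial] at h00 h01 h02 h10 h11 h12
    clear h0 h1 hx
    refine Prod.ext (funext fun i : Fin 5 => ?_)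
      (funext fun j : Fin 1 => funext fun i : Fin 1 => ?_)
    · fin_cases i <;> simp <;> linarith
    · fin_cases j <;> fin_cases i <;> simp <;> linarith

theorem exists_normal_dual_three [Fintype (edgeNormalNodes 3)] :
    ∃ b, IsSplDual 2 (edgeNormalNodes 3) (Spl 3 2 1) b := by
  refine exists_isSplDual (by norm_num) ?_ fun x hx => ?_
  · rw [card_eq_ncard, edgeNormalNodes_of_le (by norm_num), ncard_singleton]
  · have h0 := fun m : Fin 2 => (splDof_inl_zero (N := edgeNormalNodes 3) (k := 3)
      (by norm_num) x m).symm.trans (hx (.inl (m, 0)))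
    have h1 := fun m : Fin 2 => (splDof_inl_one (N := edgeNormalNodes 3) (k := 3)
      (by norm_num) x m).symm.trans (hx (.inl (m, 1)))
    change ∀ m, ∑ i : Fin 3, _ = _ at h0
    change ∀ m, ∑ i : Fin 3, _ + ∑ j : Fin 2, ∑ i : Fin 1, _ = _ at h1
    have h00 := h0 0
    have h01 := h0 1
    have h10 := h1 0
    have h11 := h1 1
    have h2 : ∀ s ∈ edgeNormalNodes 3, splEval 3 2 1 x s = 0 :=
      fun s hs => hx (.inr ⟨s, hs⟩)
    simp only [splEval_apply] at h2
    change ∀ s ∈ edgeNormalNodes 3, ∑ i : Fin 3, _ + ∑ j : Fin 2, ∑ i : Fin 1, _ = _ at h2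
    have h20 := h2 (1 / 2) (by simp [edgeNormalNodes])
    simp [Fin.sum_univ_succ, Nat.descFactorial] at h00 h01 h10 h11
    -- Unfolding the maximum discards the truncated power at the knot `2/3`, which lies to the right
    -- of the midpoint.
    norm_num [Fin.sum_univ_two, Fin.sum_univ_three, Fin.sum_univ_four, Fin.sum_univ_five, max_def] at h20
    clear h0 h1 h2 hx
    refine Prod.ext (funext fun i : Fin 3 => ?_)
      (funext fun j : Fin 2 => funext fun i : Fin 1 => ?_)
    · fin_cases i <;> simp <;> linarith
    · fin_cases j <;> fin_cases i <;> simp <;> linarith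

theorem exists_normal_dual_four [Fintype (edgeNormalNodes 4)] :
    ∃ b, IsSplDual 2 (edgeNormalNodes 4) (Spl 2 3 2) b := by
  refine exists_isSplDual (by norm_num) ?_ fun x hx => ?_
  · rw [card_eq_ncard, edgeNormalNodes_of_le (by norm_num), ncard_singleton]
  · have h0 := fun m : Fin 2 => (splDof_inl_zero (N := edgeNormalNodes 4) (k := 2)
      (by norm_num) x m).symm.trans (hx (.inl (m, 0)))
    have h1 := fun m : Fin 2 => (splDof_inl_one (N := edgeNormalNodes 4) (k := 2)
      (by norm_num) x m).symm.trans (hx (.inl (m, 1)))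
    change ∀ m, ∑ i : Fin 4, _ = _ at h0
    change ∀ m, ∑ i : Fin 4, _ + ∑ j : Fin 1, ∑ i : Fin 1, _ = _ at h1
    have h00 := h0 0
    have h01 := h0 1
    have h10 := h1 0
    have h11 := h1 1
    have h2 : ∀ s ∈ edgeNormalNodes 4, splEval 2 3 2 x s = 0 :=
      fun s hs => hx (.inr ⟨s, hs⟩)
    simp only [splEval_apply] at h2
    change ∀ s ∈ edgeNormalNodes 4, ∑ i : Fin 4, _ + ∑ j : Fin 1, ∑ i : Fin 1, _ = _ at h2
    have h20 := h2 (1 / 2) (by simp [edgeNormalNodes])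
    simp [Fin.sum_univ_succ, Nat.descFactorial] at h00 h01 h10 h11
    norm_num [Fin.sum_univ_two, Fin.sum_univ_three, Fin.sum_univ_four, Fin.sum_univ_five, max_def] at h20
    clear h0 h1 h2 hx
    refine Prod.ext (funext fun i : Fin 4 => ?_)
      (funext fun j : Fin 1 => funext fun i : Fin 1 => ?_)
    · fin_cases i <;> simp <;> linarith
    · fin_cases j <;> fin_cases i <;> simp <;> linarith

/-- The four nodes are distributed over the three intervals as one, two, one. Together with the four
end conditions they balance four monomials and a truncated square and cube at each of the two knots.
-/
theorem exists_face_dual_three [Fintype (faceNodes 3)] :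
    ∃ b, IsSplDual 2 (faceNodes 3) (Spl 3 3 1) b := by
  refine exists_isSplDual (by norm_num) ?_ fun x hx => ?_
  · rw [card_eq_ncard, faceNodes_three, ncard_eq_toFinset_card']; norm_num
  · have h0 := fun m : Fin 2 => (splDof_inl_zero (N := faceNodes 3) (k := 3)
      (by norm_num) x m).symm.trans (hx (.inl (m, 0)))
    have h1 := fun m : Fin 2 => (splDof_inl_one (N := faceNodes 3) (k := 3)
      (by norm_num) x m).symm.trans (hx (.inl (m, 1)))
    change ∀ m, ∑ i : Fin 4, _ = _ at h0
    change ∀ m, ∑ i : Fin 4, _ + ∑ j : Fin 2, ∑ i : Fin 2, _ = _ at h1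
    have h00 := h0 0
    have h01 := h0 1
    have h10 := h1 0
    have h11 := h1 1
    have h2 : ∀ s ∈ faceNodes 3, splEval 3 3 1 x s = 0 :=
      fun s hs => hx (.inr ⟨s, hs⟩)
    simp only [splEval_apply] at h2
    change ∀ s ∈ faceNodes 3, ∑ i : Fin 4, _ + ∑ j : Fin 2, ∑ i : Fin 2, _ = _ at h2
    have h20 := h2 (2 / 9) (by simp [faceNodes])
    have h21 := h2 (4 / 9) (by simp [faceNodes])
    have h22 := h2 (5 / 9) (by simp [faceNodes])
    have h23 := h2 (7 / 9) (by simp [faceNodes])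
    simp [Fin.sum_univ_succ, Nat.descFactorial] at h00 h01 h10 h11
    norm_num [Fin.sum_univ_two, Fin.sum_univ_three, Fin.sum_univ_four, Fin.sum_univ_five, max_def] at h20 h21 h22 h23
    clear h0 h1 h2 hx
    refine Prod.ext (funext fun i : Fin 4 => ?_)
      (funext fun j : Fin 2 => funext fun i : Fin 2 => ?_)
    · fin_cases i <;> simp <;> linarith
    · fin_cases j <;> fin_cases i <;> simp <;> linarith

theorem exists_face_dual_four [Fintype (faceNodes 4)] :
    ∃ b, IsSplDual 2 (faceNodes 4) (Spl 2 4 2) b := by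
  refine exists_isSplDual (by norm_num) ?_ fun x hx => ?_
  · rw [card_eq_ncard, faceNodes_four, ncard_eq_toFinset_card']; norm_num
  · have h0 := fun m : Fin 2 => (splDof_inl_zero (N := faceNodes 4) (k := 2)
      (by norm_num) x m).symm.trans (hx (.inl (m, 0)))
    have h1 := fun m : Fin 2 => (splDof_inl_one (N := faceNodes 4) (k := 2)
      (by norm_num) x m).symm.trans (hx (.inl (m, 1)))
    change ∀ m, ∑ i : Fin 5, _ = _ at h0
    change ∀ m, ∑ i : Fin 5, _ + ∑ j : Fin 1, ∑ i : Fin 2, _ = _ at h1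
    have h00 := h0 0
    have h01 := h0 1
    have h10 := h1 0
    have h11 := h1 1
    have h2 : ∀ s ∈ faceNodes 4, splEval 2 4 2 x s = 0 :=
      fun s hs => hx (.inr ⟨s, hs⟩)
    simp only [splEval_apply] at h2
    change ∀ s ∈ faceNodes 4, ∑ i : Fin 5, _ + ∑ j : Fin 1, ∑ i : Fin 2, _ = _ at h2
    have h20 := h2 (1 / 4) (by simp [faceNodes])
    have h21 := h2 (2 / 4) (by simp [faceNodes])
    have h22 := h2 (3 / 4) (by simp [faceNodes])
    simp [Fin.sum_univ_succ, Nat.descFactorial] at h00 h01 h10 h11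
    norm_num [Fin.sum_univ_two, Fin.sum_univ_three, Fin.sum_univ_four, Fin.sum_univ_five, max_def] at h20 h21 h22
    clear h0 h1 h2 hx
    refine Prod.ext (funext fun i : Fin 5 => ?_)
      (funext fun j : Fin 1 => funext fun i : Fin 2 => ?_)
    · fin_cases i <;> simp <;> linarith
    · fin_cases j <;> fin_cases i <;> simp <;> linarith

/-- The space of the pull-backs in one variable. -/
abbrev FaceSpl (p : ℕ) : Submodule ℝ (ℝ → ℝ) := Spl (numSub p) p (p - 2)

/-- The space of the traces on an edge. -/
abbrev EdgeSpl (p : ℕ) : Submodule ℝ (ℝ → ℝ) := Spl (numSub p) p (p - 1)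

/-- The space of the normal derivatives on an edge. -/
abbrev NormalSpl (p : ℕ) : Submodule ℝ (ℝ → ℝ) := Spl (numSub p) (p - 1) (p - 2)

/-- Dimension count: `6 + (p - 5) = p + 1` for `p ≥ 5`; six conditions against `4 + 2` coefficients
for `p = 3` and `5 + 1` for `p = 4`. -/
theorem exists_edge_dual {p : ℕ} (hp : 3 ≤ p) [Fintype (edgeValueNodes p)] :
    ∃ b, IsSplDual 3 (edgeValueNodes p) (EdgeSpl p) b := by
  rcases Nat.lt_or_ge p 5 with h | h
  · obtain rfl | rfl : p = 3 ∨ p = 4 := by omega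
    · exact exists_edge_dual_three
    · exact exists_edge_dual_four
  · rw [EdgeSpl, numSub_of_le h]
    refine exists_isSplDual_one (edgeValueNodes_subset p) (by omega) ?_
    rw [card_eq_ncard, (edgeValueNodes_finite_ncard hp).2]
    omega

/-- Dimension count: `4 + (p - 4) = p` for `p ≥ 5`; five conditions against `3 + 2` coefficients for
`p = 3` and `4 + 1` for `p = 4`. -/
theorem exists_normal_dual {p : ℕ} (hp : 3 ≤ p) [Fintype (edgeNormalNodes p)] :
    ∃ b, IsSplDual 2 (edgeNormalNodes p) (NormalSpl p) b := by
  rcases Nat.lt_or_ge p 5 with h | h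
  · obtain rfl | rfl : p = 3 ∨ p = 4 := by omega
    · exact exists_normal_dual_three
    · exact exists_normal_dual_four
  · rw [NormalSpl, numSub_of_le h]
    refine exists_isSplDual_one (edgeNormalNodes_subset p) (by omega) ?_
    rw [card_eq_ncard, (edgeNormalNodes_finite_ncard h).2]
    omega

/-- Dimension count: `4 + (p - 3) = p + 1` for `p ≥ 5`; `4 + 4` conditions against `4 + 2 · 2`
coefficients for `p = 3`, and `4 + 3` against `5 + 2` for `p = 4`. -/
theorem exists_face_dual {p : ℕ} (hp : 3 ≤ p) [Fintype (faceNodes p)] :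
    ∃ b, IsSplDual 2 (faceNodes p) (FaceSpl p) b := by
  rcases Nat.lt_or_ge p 5 with h | h
  · obtain rfl | rfl : p = 3 ∨ p = 4 := by omega
    · exact exists_face_dual_three
    · exact exists_face_dual_four
  · rw [FaceSpl, numSub_of_le h]
    refine exists_isSplDual_one (faceNodes_subset hp) (by omega) ?_
    rw [card_eq_ncard, (faceNodes_finite_ncard h).2]
    omega

/-! ### Tensor products of splines -/

/-- Smoothness is needed at the knots only, all of which are interior; the end points are reached
because the first and the last polynomial are attained on closed intervals. -/
theorem exists_spl_eqOn_Icc {k d r : ℕ} {v : ℝ → ℝ} (hk : 0 < k)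
    (hp : IsPiecewise k d (Icc 0 1) v) (hv : 1 < k → ContDiffOn ℝ r v (Ioo 0 1)) :
    ∃ u ∈ Spl k d r, EqOn v u (Icc 0 1) := by
  have hk' : (0 : ℝ) < k := by exact_mod_cast hk
  obtain ⟨u, hu, huv⟩ := exists_spl_eqOn hk isOpen_Ioo (fun m h0 h1 => div_nat_mem_Ioo h0 h1)
    (fun a => by
      obtain ⟨P, h1, h2⟩ := hp a
      exact ⟨P, h1, fun s hs => h2 s (Ioo_subset_Icc_self hs)⟩) hv
  refine ⟨u, hu, fun s hs => ?_⟩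
  obtain ⟨a, ha, has⟩ := exists_mem_linePiece hk s
  obtain ⟨P, -, hP⟩ := hp ⟨a, ha⟩
  obtain ⟨R, -, hR⟩ := Spl.isPiecewise hu univ ⟨a, ha⟩
  have hPR : P = R := by
    refine eq_of_infinite_eval_eq P R (Set.Infinite.mono ?_ (Ioo_infinite
      (show (a : ℝ) / k < ((a : ℝ) + 1) / k by gcongr; linarith)))
    intro x hx
    have hxp : x ∈ linePiece k a := ⟨fun _ => hx.1.le, fun _ => hx.2.le⟩
    have hx0 : x ∈ Ioo (0 : ℝ) 1 := by
      refine ⟨lt_of_le_of_lt (by positivity) hx.1, hx.2.trans_le ?_⟩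
      rw [div_le_one hk']
      exact_mod_cast ha
    rw [mem_ofPred_eq, ← hP x (Ioo_subset_Icc_self hx0) hxp, ← hR x (mem_univ _) hxp, huv hx0]
  rw [hP s hs has, hR s (mem_univ _) has, hPR]

theorem IsPiecewise.tendsto_zero {k d : ℕ} {v : ℝ → ℝ} (hk : 0 < k)
    (hp : IsPiecewise k d (Icc 0 1) v) : Tendsto v (𝓝[>] 0) (𝓝 (v 0)) := by
  have hk' : (0 : ℝ) < k := by exact_mod_cast hk
  obtain ⟨P, -, hP⟩ := hp ⟨0, hk⟩
  have h : ∀ s ∈ Icc (0 : ℝ) 1, s ≤ 1 / k → v s = P.eval s := fun s hs hsk =>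
    hP s hs ⟨fun h => absurd h (lt_irrefl 0), fun _ => by simpa using hsk⟩
  rw [h 0 (by simp) (by positivity)]
  refine Tendsto.congr' ?_ ((P.continuous.tendsto 0).mono_left nhdsWithin_le_nhds)
  filter_upwards [Ioo_mem_nhdsGT (show (0 : ℝ) < 1 / k by positivity),
    Ioo_mem_nhdsGT (show (0 : ℝ) < 1 by norm_num)] with s h1 h2
  exact (h s (Ioo_subset_Icc_self h2) h1.2.le).symm

theorem IsPiecewise.tendsto_one {k d : ℕ} {v : ℝ → ℝ} (hk : 0 < k)
    (hp : IsPiecewise k d (Icc 0 1) v) : Tendsto v (𝓝[<] 1) (𝓝 (v 1)) := by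
  have hk' : (0 : ℝ) < k := by exact_mod_cast hk
  obtain ⟨P, -, hP⟩ := hp ⟨k - 1, by omega⟩
  have h1 : ((k - 1 : ℕ) : ℝ) / k < 1 := by
    rw [div_lt_one hk']
    exact_mod_cast (by omega : k - 1 < k)
  have h : ∀ s ∈ Icc (0 : ℝ) 1, ((k - 1 : ℕ) : ℝ) / k ≤ s → v s = P.eval s := fun s hs hsk =>
    hP s hs ⟨fun _ => hsk, fun h => by simp only at h; omega⟩
  rw [h 1 (by simp) h1.le]
  refine Tendsto.congr' ?_ ((P.continuous.tendsto 1).mono_left nhdsWithin_le_nhds)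
  filter_upwards [Ioo_mem_nhdsLT h1, Ioo_mem_nhdsLT (show (0 : ℝ) < 1 by norm_num)] with s h1 h2
  exact (h s (Ioo_subset_Icc_self h2) h1.1.le).symm

/-- On a space of functions that are determined by their values on `[0, 1]`, the interpolation
conditions are finite linear combinations of point evaluations. -/
theorem IsSplDual.exists_weights {q : ℕ} {N : Set ℝ} [Fintype N] {W : Submodule ℝ (ℝ → ℝ)}
    {b : (Fin q × Fin 2) ⊕ N → ℝ → ℝ} (h : IsSplDual q N W b)
    (hW : ∀ u ∈ W, EqOn u 0 (Icc 0 1) → u = 0) :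
    ∃ w : (Fin q × Fin 2) ⊕ N → (Icc (0 : ℝ) 1 →₀ ℝ),
      ∀ j, ∀ u ∈ W, splDof q N j u = (w j).sum fun x a => a * u x := by
  let e : Icc (0 : ℝ) 1 → Module.Dual ℝ ((Fin q × Fin 2) ⊕ N → ℝ) := fun x =>
    { toFun := fun c => ∑ i, c i * b i x
      map_add' := fun c c' => by simp [add_mul, Finset.sum_add_distrib]
      map_smul' := fun a c => by
        simp only [Pi.smul_apply, smul_eq_mul, mul_assoc, Finset.mul_sum, RingHom.id_apply] }
  -- A coefficient vector that is annihilated by all point evaluations represents a function that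
  -- vanishes on `[0, 1]`; this function is zero by `hW`, hence so are its interpolation data, which
  -- are the coefficients. By duality, the evaluations span.
  have hspan : Submodule.span ℝ (range e) = ⊤ := by
    have h1 : (Submodule.span ℝ (range e)).dualCoannihilator = ⊥ := by
      rw [eq_bot_iff]
      intro c hc
      rw [Submodule.mem_dualCoannihilator] at hc
      have h2 : (fun s => ∑ i, c i * b i s) = 0 := by
        refine hW _ (h.sum_mem c) fun x hx => ?_
        exact hc (e ⟨x, hx⟩) (Submodule.subset_span ⟨_, rfl⟩)
      rw [Submodule.mem_bot]
      ext j
      rw [← h.dof c j, h2]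
      rcases j with ⟨m, e⟩ | x
      · have h3 : ∀ m : ℕ, deriv^[m] (0 : ℝ → ℝ) = 0 := by
          intro m
          induction m with
          | zero => rfl
          | succ m ih =>
            rw [Function.iterate_succ_apply']
            rw [ih]
            ext x
            simp
        simp [splDof, h3]
      · rfl
    rw [← Subspace.dualCoannihilator_dualAnnihilator_eq (W := Submodule.span ℝ (range e)), h1,
      Submodule.dualAnnihilator_bot]
  have hw : ∀ j, ∃ w : Icc (0 : ℝ) 1 →₀ ℝ, (w.sum fun x a => a • e x) = LinearMap.proj j := by
    intro j
    have : (LinearMap.proj j : Module.Dual ℝ ((Fin q × Fin 2) ⊕ N → ℝ)) ∈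
        Submodule.span ℝ (range e) := by rw [hspan]; trivial
    exact Finsupp.mem_span_range_iff_exists_finsupp.1 this
  choose w hw using hw
  refine ⟨w, fun j u hu => ?_⟩
  have h1 := congrArg (fun φ : Module.Dual ℝ ((Fin q × Fin 2) ⊕ N → ℝ) =>
    φ fun j => splDof q N j u) (hw j)
  simp only [LinearMap.proj_apply] at h1
  rw [← h1, Finsupp.sum, LinearMap.sum_apply, Finsupp.sum]
  refine Finset.sum_congr rfl fun x _ => ?_
  rw [LinearMap.smul_apply, smul_eq_mul]
  congr 1
  exact (congrFun (h.repr u hu) x).symm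

/-- A function that is a spline in each variable separately is a tensor product. With `t` fixed,
expand in `s`; the coefficients are finite combinations of the values `g x t`, and every slice `g x`
can be expanded in `t` in the same way. That the functionals are combinations of point evaluations
avoids differentiating `g`. -/
theorem IsSplDual.exists_tensor {q : ℕ} {N : Set ℝ} [Fintype N] {k d r : ℕ} (hk : 0 < k)
    {b : (Fin q × Fin 2) ⊕ N → ℝ → ℝ} (h : IsSplDual q N (Spl k d r) b) {g : ℝ → ℝ → ℝ}
    (hs : ∀ t ∈ Icc (0 : ℝ) 1, IsPiecewise k d (Icc 0 1) fun s => g s t)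
    (ht : ∀ s ∈ Icc (0 : ℝ) 1, IsPiecewise k d (Icc 0 1) fun t => g s t)
    (hsr : 1 < k → ∀ t ∈ Ioo (0 : ℝ) 1, ContDiffOn ℝ r (fun s => g s t) (Ioo 0 1))
    (htr : 1 < k → ∀ s ∈ Ioo (0 : ℝ) 1, ContDiffOn ℝ r (fun t => g s t) (Ioo 0 1)) :
    ∃ c : (Fin q × Fin 2) ⊕ N → (Fin q × Fin 2) ⊕ N → ℝ, ∀ s ∈ Icc (0 : ℝ) 1,
      ∀ t ∈ Icc (0 : ℝ) 1, g s t = ∑ i, ∑ j, c i j * (b i s * b j t) := by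
  obtain ⟨w, hw⟩ := h.exists_weights fun u hu h0 =>
    Spl.eq_of_eqOn hk hu (Submodule.zero_mem (Spl k d r)) (h0.mono Ioo_subset_Icc_self)
  have key : ∀ g : ℝ → ℝ → ℝ, (∀ t ∈ Icc (0 : ℝ) 1, IsPiecewise k d (Icc 0 1) fun s => g s t) →
      (∀ s ∈ Icc (0 : ℝ) 1, IsPiecewise k d (Icc 0 1) fun t => g s t) →
      (1 < k → ∀ t ∈ Ioo (0 : ℝ) 1, ContDiffOn ℝ r (fun s => g s t) (Ioo 0 1)) →
      ∀ s ∈ Icc (0 : ℝ) 1, ∀ t ∈ Icc (0 : ℝ) 1,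
        g s t = ∑ i, ((w i).sum fun x a => a * g x t) * b i s := by
    intro g hs ht hsr
    have hin : ∀ t ∈ Ioo (0 : ℝ) 1, ∀ s ∈ Icc (0 : ℝ) 1,
        g s t = ∑ i, ((w i).sum fun x a => a * g x t) * b i s := by
      intro t ht s hs'
      obtain ⟨u, hu, hgu⟩ := exists_spl_eqOn_Icc hk (hs t (Ioo_subset_Icc_self ht))
        (fun hk1 => hsr hk1 t ht)
      have h1 : g s t = u s := hgu hs'
      rw [h1]
      conv_lhs => rw [h.repr u hu]
      refine Finset.sum_congr rfl fun i _ => ?_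
      rw [hw i u hu]
      congr 1
      exact Finsupp.sum_congr fun x _ => by rw [← hgu x.2]
    -- The smoothness of the slices is known for interior parameters only, since `f` is smooth in
    -- the open quadrilateral; the identity extends to the boundary lines by one-sided continuity in
    -- `t`.
    have hlim : ∀ s ∈ Icc (0 : ℝ) 1, ∀ (t₀ : ℝ) (l : Filter ℝ), l.NeBot →
        (∀ᶠ t in l, t ∈ Ioo (0 : ℝ) 1) →
        (∀ s ∈ Icc (0 : ℝ) 1, Tendsto (fun t => g s t) l (𝓝 (g s t₀))) →
        g s t₀ = ∑ i, ((w i).sum fun x a => a * g x t₀) * b i s := by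
      intro s hs' t₀ l _ hl hg
      have h1 : Tendsto (fun t => ∑ i, ((w i).sum fun x a => a * g x t) * b i s) l
          (𝓝 (∑ i, ((w i).sum fun x a => a * g x t₀) * b i s)) := by
        refine tendsto_finsetSum _ fun i _ => Tendsto.mul_const _ ?_
        exact tendsto_finsetSum _ fun x _ => (hg x x.2).const_mul _
      refine tendsto_nhds_unique (hg s hs') (h1.congr' ?_)
      filter_upwards [hl] with t ht
      exact (hin t ht s hs').symm
    intro s hs' t ht'
    rcases eq_or_lt_of_le ht'.1 with h0 | h0
    · subst h0
      refine hlim s hs' 0 (𝓝[>] 0) inferInstance (Ioo_mem_nhdsGT one_pos) fun s hs' => ?_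
      exact (ht s hs').tendsto_zero hk
    · rcases eq_or_lt_of_le ht'.2 with h1 | h1
      · subst h1
        refine hlim s hs' 1 (𝓝[<] 1) inferInstance (Ioo_mem_nhdsLT one_pos) fun s hs' => ?_
        exact (ht s hs').tendsto_one hk
      · exact hin t ⟨h0, h1⟩ s hs'
  refine ⟨fun i j => (w i).sum fun x a => a * ((w j).sum fun y a' => a' * g x y),
    fun s hs' t ht' => ?_⟩
  rw [key g hs ht hsr s hs' t ht']
  refine Finset.sum_congr rfl fun i _ => ?_
  have h1 : ∀ x : Icc (0 : ℝ) 1, g x t = ∑ j, ((w j).sum fun y a => a * g x y) * b j t :=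
    fun x => key (fun t s => g s t) ht hs htr t ht' x x.2
  simp only [Finsupp.sum] at h1 ⊢
  simp_rw [h1]
  simp only [Finset.mul_sum, Finset.sum_mul]
  rw [Finset.sum_comm]
  refine Finset.sum_congr rfl fun j _ => Finset.sum_congr rfl fun x _ =>
    Finset.sum_congr rfl fun y _ => by ring

/-! ### Bounded Lipschitz functions -/

/-- The function is bounded by `M` and Lipschitz with constant `M` on the set `A`. -/
def BddLip {α : Type*} [PseudoMetricSpace α] (A : Set α) (M : ℝ) (f : α → ℝ) : Prop :=
  0 ≤ M ∧ ∀ x ∈ A, |f x| ≤ M ∧ ∀ y ∈ A, |f x - f y| ≤ M * dist x y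

section BddLip

variable {α : Type*} [PseudoMetricSpace α] {A : Set α} {M M' : ℝ} {f g : α → ℝ}

theorem BddLip.mono (h : BddLip A M f) (hM : M ≤ M') : BddLip A M' f :=
  ⟨h.1.trans hM, fun x hx => ⟨((h.2 x hx).1).trans hM, fun y hy =>
    ((h.2 x hx).2 y hy).trans (mul_le_mul_of_nonneg_right hM dist_nonneg)⟩⟩

theorem BddLip.congr (h : BddLip A M f) (hfg : EqOn g f A) : BddLip A M g :=
  ⟨h.1, fun x hx => ⟨by rw [hfg hx]; exact (h.2 x hx).1, fun y hy => by
    rw [hfg hx, hfg hy]; exact (h.2 x hx).2 y hy⟩⟩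

theorem BddLip.const (c : ℝ) : BddLip A |c| fun _ : α => c :=
  ⟨abs_nonneg c, fun x _ => ⟨le_rfl, fun y _ => by
    rw [sub_self, abs_zero]; exact mul_nonneg (abs_nonneg c) dist_nonneg⟩⟩

theorem BddLip.add (hf : BddLip A M f) (hg : BddLip A M' g) :
    BddLip A (M + M') fun x => f x + g x := by
  refine ⟨add_nonneg hf.1 hg.1, fun x hx => ⟨(abs_add_le _ _).trans
    (add_le_add (hf.2 x hx).1 (hg.2 x hx).1), fun y hy => ?_⟩⟩
  calc |f x + g x - (f y + g y)| = |(f x - f y) + (g x - g y)| := by ring_nf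
    _ ≤ |f x - f y| + |g x - g y| := abs_add_le _ _
    _ ≤ M * dist x y + M' * dist x y := add_le_add ((hf.2 x hx).2 y hy) ((hg.2 x hx).2 y hy)
    _ = (M + M') * dist x y := by ring

/-- The product rule for differences causes the factor `2`; the supremum alone would not need it. -/
theorem BddLip.mul (hf : BddLip A M f) (hg : BddLip A M' g) :
    BddLip A (2 * M * M') fun x => f x * g x := by
  have hM := hf.1
  have hM' := hg.1
  refine ⟨by positivity, fun x hx => ⟨?_, fun y hy => ?_⟩⟩
  · rw [abs_mul]
    nlinarith [mul_le_mul (hf.2 x hx).1 (hg.2 x hx).1 (abs_nonneg _) hM, mul_nonneg hM hM']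
  · calc |f x * g x - f y * g y| = |f x * (g x - g y) + (f x - f y) * g y| := by ring_nf
      _ ≤ |f x * (g x - g y)| + |(f x - f y) * g y| := abs_add_le _ _
      _ = |f x| * |g x - g y| + |f x - f y| * |g y| := by rw [abs_mul, abs_mul]
      _ ≤ M * (M' * dist x y) + (M * dist x y) * M' :=
        add_le_add (mul_le_mul (hf.2 x hx).1 ((hg.2 x hx).2 y hy) (abs_nonneg _) hM)
          (mul_le_mul ((hf.2 x hx).2 y hy) (hg.2 y hy).1 (abs_nonneg _)
            (mul_nonneg hM dist_nonneg))
      _ = 2 * M * M' * dist x y := by ring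

theorem BddLip.sum {ι : Type*} (s : Finset ι) {M : ι → ℝ} {f : ι → α → ℝ}
    (h : ∀ i ∈ s, BddLip A (M i) (f i)) : BddLip A (∑ i ∈ s, M i) fun x => ∑ i ∈ s, f i x := by
  classical
  induction s using Finset.induction_on with
  | empty => simpa using BddLip.const (A := A) (0 : ℝ)
  | insert i s hi ih =>
    simp only [Finset.sum_insert hi]
    exact (h i (Finset.mem_insert_self _ _)).add
      (ih fun j hj => h j (Finset.mem_insert_of_mem hj))

/-- The first summand of the constant bounds the values, the second one the difference quotients, by
`1/a - 1/b = (b - a)/(ab)`. -/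
theorem BddLip.inv {δ : ℝ} (hδ : 0 < δ) (hf : BddLip A M f) (h : ∀ x ∈ A, δ ≤ f x) :
    BddLip A (δ⁻¹ + M * (δ⁻¹ * δ⁻¹)) fun x => (f x)⁻¹ := by
  have hM := hf.1
  have hi : ∀ x ∈ A, |(f x)⁻¹| ≤ δ⁻¹ := fun x hx => by
    rw [abs_of_pos (inv_pos.2 (hδ.trans_le (h x hx)))]
    exact inv_anti₀ hδ (h x hx)
  refine ⟨by positivity, fun x hx => ⟨(hi x hx).trans (by
    have : 0 ≤ M * (δ⁻¹ * δ⁻¹) := by positivity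
    linarith), fun y hy => ?_⟩⟩
  have hx0 := (hδ.trans_le (h x hx)).ne'
  have hy0 := (hδ.trans_le (h y hy)).ne'
  have hd : 0 ≤ dist x y := dist_nonneg
  calc |(f x)⁻¹ - (f y)⁻¹| = |f x - f y| * (|(f x)⁻¹| * |(f y)⁻¹|) := by
        rw [← abs_mul, ← abs_mul, abs_sub_comm]
        congr 1
        field_simp
    _ ≤ (M * dist x y) * (δ⁻¹ * δ⁻¹) :=
        mul_le_mul ((hf.2 x hx).2 y hy) (mul_le_mul (hi x hx) (hi y hy) (abs_nonneg _)
          (by positivity)) (by positivity) (by positivity)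
    _ ≤ (δ⁻¹ + M * (δ⁻¹ * δ⁻¹)) * dist x y := by
        have : 0 ≤ δ⁻¹ * dist x y := by positivity
        nlinarith

theorem BddLip.comp {β : Type*} [PseudoMetricSpace β] {B : Set β} {φ : β → α} {L : ℝ}
    (hf : BddLip A M f) (hφ : MapsTo φ B A) (hL : 0 ≤ L)
    (hφL : ∀ x ∈ B, ∀ y ∈ B, dist (φ x) (φ y) ≤ L * dist x y) :
    BddLip B (M + M * L) fun x => f (φ x) := by
  have hM := hf.1
  have hML := mul_nonneg hM hL
  refine ⟨by positivity, fun x hx => ⟨((hf.2 _ (hφ hx)).1).trans (by linarith), fun y hy => ?_⟩⟩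
  refine ((hf.2 _ (hφ hx)).2 _ (hφ hy)).trans ?_
  have h1 := mul_le_mul_of_nonneg_left (hφL x hx y hy) hM
  have h2 : 0 ≤ M * dist x y := mul_nonneg hM dist_nonneg
  linarith

end BddLip

theorem Spl.bddLip {k d r : ℕ} {u : ℝ → ℝ} (hu : u ∈ Spl k d r) :
    ∃ M, BddLip (Icc 0 1) M u := by
  obtain ⟨x, rfl⟩ := hu
  have hpow : ∀ (v : ℝ → ℝ) (n : ℕ), (∃ M, BddLip (Icc (0 : ℝ) 1) M v) →
      ∃ M, BddLip (Icc (0 : ℝ) 1) M fun s => v s ^ n := by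
    rintro v n ⟨M, hM⟩
    induction n with
    | zero => simpa using ⟨_, BddLip.const (A := Icc (0 : ℝ) 1) (1 : ℝ)⟩
    | succ n ih =>
      obtain ⟨M', hM'⟩ := ih
      simp only [pow_succ]
      exact ⟨_, hM'.mul hM⟩
  have hid : BddLip (Icc (0 : ℝ) 1) 1 fun s : ℝ => s :=
    ⟨zero_le_one, fun s hs => ⟨by rw [abs_of_nonneg hs.1]; exact hs.2, fun t _ => by
      rw [one_mul, Real.dist_eq]⟩⟩
  have hpos : ∀ a : ℝ, BddLip (Icc (0 : ℝ) 1) (1 + |a|) fun s : ℝ => max (s - a) 0 := by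
    intro a
    refine ⟨by positivity, fun s hs => ⟨?_, fun t _ => ?_⟩⟩
    · rw [abs_of_nonneg (le_max_right _ _)]
      exact max_le (by have := neg_abs_le a; have := hs.2; linarith) (by positivity)
    · refine (abs_max_sub_max_le_abs _ _ _).trans ?_
      rw [Real.dist_eq, sub_sub_sub_cancel_right]
      have := mul_nonneg (abs_nonneg a) (abs_nonneg (s - t))
      linarith
  choose M₁ hM₁ using fun n => hpow _ n ⟨_, hid⟩
  choose M₂ hM₂ using fun a n => hpow _ n ⟨_, hpos a⟩
  have h1 := (BddLip.sum (A := Icc (0 : ℝ) 1) Finset.univ fun (i : Fin (d + 1)) _ =>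
    (BddLip.const (x.1 i)).mul (hM₁ i)).add (BddLip.sum Finset.univ fun (m : Fin (k - 1)) _ =>
      BddLip.sum Finset.univ fun (i : Fin (d - r)) _ =>
        (BddLip.const (x.2 m i)).mul (hM₂ (((m : ℝ) + 1) / k) (r + 1 + i)))
  exact ⟨_, h1⟩

/-! ### Geometry of quadrilaterals -/

theorem det2_apply (u w : Plane) : det2 u w = u 0 * w 1 - u 1 * w 0 := rfl

theorem norm_sq_plane (u : Plane) : ‖u‖ ^ 2 = u 0 ^ 2 + u 1 ^ 2 := by
  rw [EuclideanSpace.norm_sq_eq]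
  simp

theorem inner_plane (u w : Plane) : inner ℝ u w = u 0 * w 0 + u 1 * w 1 := by
  rw [PiLp.inner_apply]
  simp [mul_comm]

theorem abs_det2_le (u w : Plane) : |det2 u w| ≤ ‖u‖ * ‖w‖ := by
  refine abs_le_of_sq_le_sq ?_ (by positivity)
  rw [mul_pow, norm_sq_plane, norm_sq_plane, det2_apply]
  -- Lagrange's identity: the squares of the determinant and of the inner product add up to the
  -- product of the squared norms.
  nlinarith [sq_nonneg (u 0 * w 0 + u 1 * w 1)]

theorem abs_apply_le_norm (u : Plane) (a : Fin 2) : |u a| ≤ ‖u‖ := by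
  simpa using PiLp.norm_apply_le u a

theorem plane_ext {u w : Plane} (h0 : u 0 = w 0) (h1 : u 1 = w 1) : u = w := by
  ext a
  fin_cases a
  · exact h0
  · exact h1

/-- Cramer's rule. -/
theorem det2_smul_eq (u w z : Plane) : det2 u w • z = det2 z w • u + det2 u z • w := by
  refine plane_ext ?_ ?_ <;>
    simp only [det2_apply, PiLp.add_apply, PiLp.smul_apply, smul_eq_mul] <;> ring

namespace ConvexQuad

variable (Q : ConvexQuad)

/-- The derivative of the parametrization in the first parameter. -/
def sVec (t : ℝ) : Plane := (1 - t) • (Q.vertex 1 - Q.vertex 0) + t • (Q.vertex 2 - Q.vertex 3)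

/-- The derivative of the parametrization in the second parameter. -/
def tVec (s : ℝ) : Plane := (1 - s) • (Q.vertex 3 - Q.vertex 0) + s • (Q.vertex 2 - Q.vertex 1)

/-- The Jacobian determinant of the parametrization. -/
def jac (s t : ℝ) : ℝ := det2 (Q.sVec t) (Q.tVec s)

/-- The determinant of the two edge vectors that meet in a vertex. -/
def corner (i : Fin 4) : ℝ := det2 (Q.vertex i - Q.vertex (i - 1)) (Q.vertex (i + 1) - Q.vertex i)

theorem corner_pos (i : Fin 4) : 0 < Q.corner i := Q.convex i

theorem fin4_arith : ((0 : Fin 4) - 1 = 3) ∧ ((1 : Fin 4) - 1 = 0) ∧ ((2 : Fin 4) - 1 = 1) ∧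
    ((3 : Fin 4) - 1 = 2) ∧ ((0 : Fin 4) + 1 = 1) ∧ ((1 : Fin 4) + 1 = 2) ∧
    ((2 : Fin 4) + 1 = 3) ∧ ((3 : Fin 4) + 1 = 0) := by decide

/-- The two tangent vectors contain the same mixed difference `e`, as `t • e` and as `s • e`, so the
product term `det2 e e` drops out and the Jacobian is affine. Hence it is the bilinear interpolant
of its corner values, and convexity makes it positive on the square. -/
theorem jac_eq (s t : ℝ) : Q.jac s t = (1 - s) * (1 - t) * Q.corner 0 + s * (1 - t) * Q.corner 1 +
    s * t * Q.corner 2 + (1 - s) * t * Q.corner 3 := by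
  obtain ⟨h0, h1, h2, h3, h4, h5, h6, h7⟩ := fin4_arith
  simp only [jac, corner, sVec, tVec, det2_apply, h0, h1, h2, h3, h4, h5, h6, h7, PiLp.add_apply,
    PiLp.sub_apply, PiLp.smul_apply, smul_eq_mul]
  ring

theorem le_jac {δ : ℝ} (hδ : ∀ i, δ ≤ Q.corner i) {s t : ℝ} (hs : s ∈ Icc (0 : ℝ) 1)
    (ht : t ∈ Icc (0 : ℝ) 1) : δ ≤ Q.jac s t := by
  rw [jac_eq]
  have h1 : 0 ≤ 1 - s := sub_nonneg.2 hs.2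
  have h2 : 0 ≤ 1 - t := sub_nonneg.2 ht.2
  have := mul_le_mul_of_nonneg_left (hδ 0) (mul_nonneg h1 h2)
  have := mul_le_mul_of_nonneg_left (hδ 1) (mul_nonneg hs.1 h2)
  have := mul_le_mul_of_nonneg_left (hδ 2) (mul_nonneg hs.1 ht.1)
  have := mul_le_mul_of_nonneg_left (hδ 3) (mul_nonneg h1 ht.1)
  linarith

theorem jac_pos {s t : ℝ} (hs : s ∈ Icc (0 : ℝ) 1) (ht : t ∈ Icc (0 : ℝ) 1) : 0 < Q.jac s t := by
  obtain ⟨i, hi⟩ := Finite.exists_min Q.corner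
  exact (Q.corner_pos i).trans_le (Q.le_jac hi hs ht)

/-- The parameter square. -/
def square : Set (ℝ × ℝ) := Icc 0 1 ×ˢ Icc 0 1

/-- The parametrization as a function on `ℝ × ℝ`. -/
def toPlane (ξ : ℝ × ℝ) : Plane := Q.param ξ.1 ξ.2

theorem toPlane_apply (ξ : ℝ × ℝ) (i : Fin 2) : Q.toPlane ξ i =
    (1 - ξ.1) * (1 - ξ.2) * Q.vertex 0 i + ξ.1 * (1 - ξ.2) * Q.vertex 1 i +
      ξ.1 * ξ.2 * Q.vertex 2 i + (1 - ξ.1) * ξ.2 * Q.vertex 3 i := rfl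

/-- The signed distance from an edge, up to a factor. -/
def side (i : Fin 4) (x : Plane) : ℝ := det2 (Q.edge i) (x - Q.vertex i)

/-- Each edge form is the distance of the parameter from the corresponding side times a positive
factor, so half-planes in the plane correspond to half-planes for the parameters. -/
theorem side_toPlane (ξ : ℝ × ℝ) : Q.side 0 (Q.toPlane ξ) = ξ.2 * Q.jac ξ.1 0 ∧
    Q.side 1 (Q.toPlane ξ) = (1 - ξ.1) * Q.jac 1 ξ.2 ∧
    Q.side 2 (Q.toPlane ξ) = (1 - ξ.2) * Q.jac ξ.1 1 ∧
    Q.side 3 (Q.toPlane ξ) = ξ.1 * Q.jac 0 ξ.2 := by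
  obtain ⟨h0, h1, h2, h3, h4, h5, h6, h7⟩ := fin4_arith
  refine ⟨?_, ?_, ?_, ?_⟩ <;>
  · simp only [side, edge, jac, sVec, tVec, det2_apply, h4, h5, h6, h7, PiLp.add_apply,
      PiLp.sub_apply, PiLp.smul_apply, smul_eq_mul, toPlane_apply]
    ring

theorem side_vertex_nonneg (i j : Fin 4) : 0 ≤ Q.side i (Q.vertex j) := by
  obtain ⟨h0, h1, h2, h3, h4, h5, h6, h7⟩ := fin4_arith
  have h := fun i => (Q.corner_pos i).le
  have c0 := h 0
  have c1 := h 1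
  have c2 := h 2
  have c3 := h 3
  simp only [corner, det2_apply, h0, h1, h2, h3, h4, h5, h6, h7, PiLp.sub_apply] at c0 c1 c2 c3
  fin_cases i <;> fin_cases j <;>
    simp only [side, edge, det2_apply, Fin.zero_eta, Fin.mk_one, Fin.reduceFinMk, h4, h5, h6, h7,
      PiLp.sub_apply] <;> linarith

theorem side_nonneg {x : Plane} (hx : x ∈ Q.closed) (i : Fin 4) : 0 ≤ Q.side i x := by
  have h : Q.closed ⊆ {x | 0 ≤ Q.side i x} := by
    refine convexHull_min ?_ ?_
    · rintro _ ⟨j, rfl⟩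
      exact Q.side_vertex_nonneg i j
    · intro x hx y hy a b ha hb hab
      have : Q.side i (a • x + b • y) = a * Q.side i x + b * Q.side i y := by
        simp only [side, det2_apply, PiLp.add_apply, PiLp.sub_apply, PiLp.smul_apply, smul_eq_mul]
        linear_combination (Q.edge i 0 * Q.vertex i 1 - Q.edge i 1 * Q.vertex i 0) * (hab)
      rw [mem_ofPred_eq, this]
      exact add_nonneg (mul_nonneg ha hx) (mul_nonneg hb hy)
  exact h hx

/-- The images of the lines of constant `s` sweep over the quadrilateral. The determinant that tells
on which side of such a line `x` lies changes its sign between `s = 0` and `s = 1`, by the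
conditions on sides `3` and `1`. At a zero `s`, Cramer's rule yields the second parameter, and sides
`0` and `2` confine it to `[0, 1]`. -/
theorem exists_toPlane_eq {x : Plane} (hx : ∀ i, 0 ≤ Q.side i x) : ∃ ξ ∈ square, Q.toPlane ξ = x := by
  obtain ⟨h0, h1, h2, h3, h4, h5, h6, h7⟩ := fin4_arith
  set a := Q.vertex 1 - Q.vertex 0 with ha
  have hq : Continuous fun s => det2 (x - Q.vertex 0 - s • a) (Q.tVec s) := by
    simp only [det2_apply, tVec, PiLp.add_apply, PiLp.sub_apply, PiLp.smul_apply, smul_eq_mul]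
    fun_prop
  have hq0 : 0 ≤ det2 (x - Q.vertex 0 - (0 : ℝ) • a) (Q.tVec 0) := by
    have := hx 3
    simp only [side, edge, det2_apply, h7, tVec, PiLp.add_apply, PiLp.sub_apply, PiLp.smul_apply,
      smul_eq_mul] at this ⊢
    linarith
  have hq1 : det2 (x - Q.vertex 0 - (1 : ℝ) • a) (Q.tVec 1) ≤ 0 := by
    have := hx 1
    simp only [side, edge, det2_apply, h5, tVec, PiLp.add_apply, PiLp.sub_apply, PiLp.smul_apply,
      smul_eq_mul, ha] at this ⊢
    linarith
  obtain ⟨s, hs, hs0⟩ := intermediate_value_Icc' (zero_le_one (α := ℝ)) hq.continuousOn ⟨hq1, hq0⟩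
  have hj := Q.jac_pos hs (t := 0) (by simp)
  have hj1 := Q.jac_pos hs (t := 1) (by simp)
  have hsv : Q.sVec 0 = a := by simp [sVec, ha]
  rw [jac, hsv] at hj
  set τ := det2 a (x - Q.vertex 0) / det2 a (Q.tVec s) with hτ
  have hpar : Q.toPlane (s, τ) = x := by
    have h8 : x - Q.vertex 0 - s • a = τ • Q.tVec s := by
      have h9 := det2_smul_eq a (Q.tVec s) (x - Q.vertex 0 - s • a)
      simp only at hs0
      rw [hs0, zero_smul, zero_add] at h9
      have h10 : det2 a (x - Q.vertex 0 - s • a) = τ * det2 a (Q.tVec s) := by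
        rw [hτ, div_mul_cancel₀ _ hj.ne']
        simp only [det2_apply, PiLp.sub_apply, PiLp.smul_apply, smul_eq_mul]
        ring
      rw [h10, mul_comm, mul_smul] at h9
      exact smul_right_injective _ hj.ne' h9
    have h11 : Q.toPlane (s, τ) = Q.vertex 0 + s • a + τ • Q.tVec s := by
      refine plane_ext ?_ ?_ <;>
      · simp only [toPlane_apply, tVec, ha, PiLp.add_apply, PiLp.sub_apply, PiLp.smul_apply,
          smul_eq_mul]
        ring
    rw [h11, ← h8]
    abel
  refine ⟨(s, τ), ⟨hs, ?_, ?_⟩, hpar⟩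
  · refine div_nonneg ?_ hj.le
    exact hx 0
  · have h12 := hx 2
    rw [← hpar, (Q.side_toPlane _).2.2.1] at h12
    have := nonneg_of_mul_nonneg_left h12 hj1
    simp only at this ⊢
    linarith

theorem toPlane_mem_closed {ξ : ℝ × ℝ} (hξ : ξ ∈ square) : Q.toPlane ξ ∈ Q.closed := by
  obtain ⟨⟨h1, h2⟩, h3, h4⟩ := hξ
  have h := (convex_convexHull ℝ (range Q.vertex)).sum_mem (t := Finset.univ)
    (w := ![(1 - ξ.1) * (1 - ξ.2), ξ.1 * (1 - ξ.2), ξ.1 * ξ.2, (1 - ξ.1) * ξ.2]) (z := Q.vertex)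
    (fun i _ => by
      fin_cases i
      · exact mul_nonneg (by linarith) (by linarith)
      · exact mul_nonneg h1 (by linarith)
      · exact mul_nonneg h1 h3
      · exact mul_nonneg (by linarith) h3)
    (by simp [Fin.sum_univ_four]; ring) (fun i _ => subset_convexHull _ _ ⟨i, rfl⟩)
  rw [Fin.sum_univ_four] at h
  exact h

theorem exists_of_mem_closed {x : Plane} (hx : x ∈ Q.closed) : ∃ ξ ∈ square, Q.toPlane ξ = x :=
  Q.exists_toPlane_eq (Q.side_nonneg hx)

theorem continuous_side (i : Fin 4) : Continuous (Q.side i) := by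
  unfold side
  simp only [det2_apply, PiLp.sub_apply]
  fun_prop

theorem toPlane_mem_inner {ξ : ℝ × ℝ} (h1 : ξ.1 ∈ Ioo (0 : ℝ) 1) (h2 : ξ.2 ∈ Ioo (0 : ℝ) 1) :
    Q.toPlane ξ ∈ Q.inner := by
  have hopen : IsOpen {x | ∀ i, 0 < Q.side i x} := by
    simp only [ofPred_forall]
    exact isOpen_iInter_of_finite fun i => isOpen_lt continuous_const (Q.continuous_side i)
  refine interior_maximal (fun x hx => ?_) hopen ?_
  · obtain ⟨ξ, hξ, rfl⟩ := Q.exists_toPlane_eq fun i => (hx i).le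
    exact Q.toPlane_mem_closed hξ
  · obtain ⟨h3, h4, h5, h6⟩ := Q.side_toPlane ξ
    have i1 := Ioo_subset_Icc_self h1
    have i2 := Ioo_subset_Icc_self h2
    have z0 : (0 : ℝ) ∈ Icc (0 : ℝ) 1 := by simp
    have z1 : (1 : ℝ) ∈ Icc (0 : ℝ) 1 := by simp
    intro i
    fin_cases i
    · exact h3 ▸ mul_pos h2.1 (Q.jac_pos i1 z0)
    · exact h4 ▸ mul_pos (sub_pos.2 h1.2) (Q.jac_pos z1 i2)
    · exact h5 ▸ mul_pos (sub_pos.2 h2.2) (Q.jac_pos i1 z1)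
    · exact h6 ▸ mul_pos h1.1 (Q.jac_pos z0 i2)

theorem inner_subset_closed : Q.inner ⊆ Q.closed := interior_subset

theorem inner_nonempty : Q.inner.Nonempty :=
  ⟨_, Q.toPlane_mem_inner (ξ := (1 / 2, 1 / 2)) (by norm_num) (by norm_num)⟩

theorem uniqueDiffOn_closed : UniqueDiffOn ℝ Q.closed :=
  uniqueDiffOn_convex (convex_convexHull ℝ _) Q.inner_nonempty

/-! ### An explicit smooth inverse of the bilinear parametrization -/

/-- The square root of the discriminant of the inverse of the parametrization. -/
def invJac (x : Plane) : ℝ :=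
  √((Q.jac 0 0 + det2 (x - Q.vertex 0) (Q.tVec 1 - Q.tVec 0)) ^ 2 +
    4 * det2 (Q.tVec 1 - Q.tVec 0) (Q.tVec 0) * det2 (Q.sVec 0) (x - Q.vertex 0))

/-- The inverse of the parametrization. -/
def toSquare (x : Plane) : ℝ × ℝ :=
  (2 * det2 (x - Q.vertex 0) (Q.tVec 0) /
      (Q.jac 0 0 + Q.invJac x - det2 (x - Q.vertex 0) (Q.tVec 1 - Q.tVec 0)),
    2 * det2 (Q.sVec 0) (x - Q.vertex 0) /
      (Q.jac 0 0 + Q.invJac x + det2 (x - Q.vertex 0) (Q.tVec 1 - Q.tVec 0)))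

/-- A neighbourhood of the parameter square on which the parametrization is invertible. -/
def regular : Set (ℝ × ℝ) := {ξ | 0 < Q.jac ξ.1 ξ.2 ∧ 0 < Q.jac 0 ξ.2 ∧ 0 < Q.jac ξ.1 0}

theorem square_subset_regular : square ⊆ Q.regular := fun _ hξ =>
  ⟨Q.jac_pos hξ.1 hξ.2, Q.jac_pos (by simp) hξ.2, Q.jac_pos hξ.1 (by simp)⟩

theorem isOpen_regular : IsOpen Q.regular := by
  have h : Continuous fun ξ : ℝ × ℝ => Q.jac ξ.1 ξ.2 := by
    simp only [jac_eq]
    fun_prop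
  have h1 : Continuous fun ξ : ℝ × ℝ => Q.jac 0 ξ.2 := by
    simp only [jac_eq]
    fun_prop
  have h2 : Continuous fun ξ : ℝ × ℝ => Q.jac ξ.1 0 := by
    simp only [jac_eq]
    fun_prop
  exact (isOpen_lt continuous_const h).inter
    ((isOpen_lt continuous_const h1).inter (isOpen_lt continuous_const h2))

/-- The second parameter of a point solves a quadratic equation whose discriminant is the square of
the Jacobian. Its root is therefore smooth wherever the Jacobian does not vanish. -/
theorem disc_toPlane (ξ : ℝ × ℝ) :
    (Q.jac 0 0 + det2 (Q.toPlane ξ - Q.vertex 0) (Q.tVec 1 - Q.tVec 0)) ^ 2 +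
      4 * det2 (Q.tVec 1 - Q.tVec 0) (Q.tVec 0) * det2 (Q.sVec 0) (Q.toPlane ξ - Q.vertex 0) =
    Q.jac ξ.1 ξ.2 ^ 2 := by
  simp only [jac, sVec, tVec, det2_apply, PiLp.add_apply, PiLp.sub_apply, PiLp.smul_apply,
    smul_eq_mul, toPlane_apply]
  ring

theorem invJac_toPlane {ξ : ℝ × ℝ} (hξ : ξ ∈ Q.regular) :
    Q.invJac (Q.toPlane ξ) = Q.jac ξ.1 ξ.2 := by
  rw [invJac, disc_toPlane, Real.sqrt_sq hξ.1.le]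

/-- The roots are used in the form with the square root in the denominator. These denominators stay
positive even if the quadratic equation degenerates to a linear one, as for parallelograms. -/
theorem denom_toPlane (ξ : ℝ × ℝ) :
    Q.jac 0 0 + Q.jac ξ.1 ξ.2 - det2 (Q.toPlane ξ - Q.vertex 0) (Q.tVec 1 - Q.tVec 0) =
      2 * Q.jac 0 ξ.2 ∧
    Q.jac 0 0 + Q.jac ξ.1 ξ.2 + det2 (Q.toPlane ξ - Q.vertex 0) (Q.tVec 1 - Q.tVec 0) =
      2 * Q.jac ξ.1 0 := by
  constructor <;>
  · simp only [jac, sVec, tVec, det2_apply, PiLp.add_apply, PiLp.sub_apply, PiLp.smul_apply,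
      smul_eq_mul, toPlane_apply]
    ring

theorem toSquare_toPlane {ξ : ℝ × ℝ} (hξ : ξ ∈ Q.regular) : Q.toSquare (Q.toPlane ξ) = ξ := by
  obtain ⟨h1, h2⟩ := Q.denom_toPlane ξ
  rw [toSquare, Q.invJac_toPlane hξ, h1, h2]
  have h3 := hξ.2.1.ne'
  have h4 := hξ.2.2.ne'
  have h5 : det2 (Q.toPlane ξ - Q.vertex 0) (Q.tVec 0) = ξ.1 * Q.jac 0 ξ.2 := by
    simp only [jac, sVec, tVec, det2_apply, PiLp.add_apply, PiLp.sub_apply, PiLp.smul_apply,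
      smul_eq_mul, toPlane_apply]
    ring
  have h6 : det2 (Q.sVec 0) (Q.toPlane ξ - Q.vertex 0) = ξ.2 * Q.jac ξ.1 0 := by
    simp only [jac, sVec, tVec, det2_apply, PiLp.add_apply, PiLp.sub_apply, PiLp.smul_apply,
      smul_eq_mul, toPlane_apply]
    ring
  rw [h5, h6]
  ext
  · field_simp
  · field_simp

/-- The inverse is smooth in a full neighbourhood of each point of the closed quadrilateral; so
derivatives within the closed set can be computed as ordinary derivatives of an extension. -/
theorem contDiffAt_toSquare {ξ : ℝ × ℝ} (hξ : ξ ∈ Q.regular) (n : WithTop ℕ∞) :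
    ContDiffAt ℝ n Q.toSquare (Q.toPlane ξ) := by
  have hlin : ∀ u w : Plane, ContDiffAt ℝ n (fun x : Plane => det2 (x - u) w) (Q.toPlane ξ) ∧
      ContDiffAt ℝ n (fun x : Plane => det2 w (x - u)) (Q.toPlane ξ) := by
    intro u w
    simp only [det2_apply, PiLp.sub_apply]
    constructor <;> fun_prop
  have hJ : ContDiffAt ℝ n Q.invJac (Q.toPlane ξ) := by
    refine ContDiffAt.sqrt ?_ ?_
    · exact ((contDiffAt_const.add (hlin _ _).1).pow 2).add (contDiffAt_const.mul (hlin _ _).2)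
    · rw [disc_toPlane]
      exact (pow_pos hξ.1 2).ne'
  obtain ⟨h1, h2⟩ := Q.denom_toPlane ξ
  refine ContDiffAt.prodMk ?_ ?_
  · refine (contDiffAt_const.mul (hlin _ _).1).div ((contDiffAt_const.add hJ).sub (hlin _ _).1) ?_
    rw [Q.invJac_toPlane hξ, h1]
    exact (mul_pos two_pos hξ.2.1).ne'
  · refine (contDiffAt_const.mul (hlin _ _).2).div ((contDiffAt_const.add hJ).add (hlin _ _).1) ?_
    rw [Q.invJac_toPlane hξ, h2]
    exact (mul_pos two_pos hξ.2.2).ne'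

theorem toSquare_mem {x : Plane} (hx : x ∈ Q.closed) : Q.toSquare x ∈ square := by
  obtain ⟨ξ, hξ, rfl⟩ := Q.exists_of_mem_closed hx
  rwa [Q.toSquare_toPlane (Q.square_subset_regular hξ)]

theorem toPlane_toSquare {x : Plane} (hx : x ∈ Q.closed) : Q.toPlane (Q.toSquare x) = x := by
  obtain ⟨ξ, hξ, rfl⟩ := Q.exists_of_mem_closed hx
  rw [Q.toSquare_toPlane (Q.square_subset_regular hξ)]

/-- Bounds for the shape of a quadrilateral. -/
structure ShapeBounds (h ℓ δ : ℝ) : Prop where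
  edge_le : ∀ i, ‖Q.edge i‖ ≤ h
  le_edge : ∀ i, ℓ ≤ ‖Q.edge i‖
  le_corner : ∀ i, δ ≤ Q.corner i

theorem norm_convex_comb_le {h : ℝ} {u w : Plane} (hu : ‖u‖ ≤ h) (hw : ‖w‖ ≤ h) {s : ℝ}
    (hs : s ∈ Icc (0 : ℝ) 1) : ‖(1 - s) • u + s • w‖ ≤ h := by
  refine (norm_add_le _ _).trans ?_
  rw [norm_smul, norm_smul, Real.norm_of_nonneg hs.1, Real.norm_of_nonneg (sub_nonneg.2 hs.2)]
  have := mul_le_mul_of_nonneg_left hu (sub_nonneg.2 hs.2)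
  have := mul_le_mul_of_nonneg_left hw hs.1
  linarith

variable {Q}

theorem ShapeBounds.norm_sVec_le {h ℓ δ : ℝ} (hQ : Q.ShapeBounds h ℓ δ) {t : ℝ}
    (ht : t ∈ Icc (0 : ℝ) 1) : ‖Q.sVec t‖ ≤ h := by
  refine norm_convex_comb_le (hQ.edge_le 0) ?_ ht
  rw [norm_sub_rev]
  exact hQ.edge_le 2

theorem ShapeBounds.norm_tVec_le {h ℓ δ : ℝ} (hQ : Q.ShapeBounds h ℓ δ) {s : ℝ}
    (hs : s ∈ Icc (0 : ℝ) 1) : ‖Q.tVec s‖ ≤ h := by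
  refine norm_convex_comb_le ?_ (hQ.edge_le 1) hs
  rw [norm_sub_rev]
  exact hQ.edge_le 3

/-- For a bilinear map the difference of two values is exactly the combination of the tangent
vectors at the midpoint with the differences of the parameters as coefficients. A determinant with
one tangent vector isolates one difference, multiplied by the Jacobian at the midpoint, which is at
least `δ`. -/
theorem ShapeBounds.dist_toSquare_le {h ℓ δ : ℝ} (hQ : Q.ShapeBounds h ℓ δ) (hδ : 0 < δ)
    {x y : Plane} (hx : x ∈ Q.closed) (hy : y ∈ Q.closed) :
    dist (Q.toSquare x) (Q.toSquare y) ≤ h / δ * dist x y := by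
  obtain ⟨ξ, hξ, rfl⟩ := Q.exists_of_mem_closed hx
  obtain ⟨η, hη, rfl⟩ := Q.exists_of_mem_closed hy
  rw [Q.toSquare_toPlane (Q.square_subset_regular hξ),
    Q.toSquare_toPlane (Q.square_subset_regular hη), dist_eq_norm (Q.toPlane ξ)]
  have hs : (ξ.1 + η.1) / 2 ∈ Icc (0 : ℝ) 1 := by
    have := hξ.1.1; have := hξ.1.2; have := hη.1.1; have := hη.1.2
    constructor <;> linarith
  have ht : (ξ.2 + η.2) / 2 ∈ Icc (0 : ℝ) 1 := by
    have := hξ.2.1; have := hξ.2.2; have := hη.2.1; have := hη.2.2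
    constructor <;> linarith
  have hJ := Q.le_jac hQ.le_corner hs ht
  have h1 : det2 (Q.toPlane ξ - Q.toPlane η) (Q.tVec ((ξ.1 + η.1) / 2)) =
      (ξ.1 - η.1) * Q.jac ((ξ.1 + η.1) / 2) ((ξ.2 + η.2) / 2) := by
    simp only [jac, sVec, tVec, det2_apply, PiLp.add_apply, PiLp.sub_apply, PiLp.smul_apply,
      smul_eq_mul, toPlane_apply]
    ring
  have h2 : det2 (Q.sVec ((ξ.2 + η.2) / 2)) (Q.toPlane ξ - Q.toPlane η) =
      (ξ.2 - η.2) * Q.jac ((ξ.1 + η.1) / 2) ((ξ.2 + η.2) / 2) := by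
    simp only [jac, sVec, tVec, det2_apply, PiLp.add_apply, PiLp.sub_apply, PiLp.smul_apply,
      smul_eq_mul, toPlane_apply]
    ring
  have key : ∀ d : ℝ, |d * Q.jac ((ξ.1 + η.1) / 2) ((ξ.2 + η.2) / 2)| ≤
      h * ‖Q.toPlane ξ - Q.toPlane η‖ → |d| ≤ h / δ * ‖Q.toPlane ξ - Q.toPlane η‖ := by
    intro d hd
    rw [abs_mul, abs_of_pos (hδ.trans_le hJ)] at hd
    rw [div_mul_eq_mul_div, le_div_iff₀ hδ]
    exact (mul_le_mul_of_nonneg_left hJ (abs_nonneg d)).trans hd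
  rw [Prod.dist_eq, Real.dist_eq, Real.dist_eq]
  refine max_le (key _ ?_) (key _ ?_)
  · rw [← h1]
    refine (abs_det2_le _ _).trans ?_
    rw [mul_comm]
    exact mul_le_mul_of_nonneg_right (hQ.norm_tVec_le hs) (norm_nonneg _)
  · rw [← h2]
    refine (abs_det2_le _ _).trans ?_
    exact mul_le_mul_of_nonneg_right (hQ.norm_sVec_le ht) (norm_nonneg _)

end ConvexQuad

/-! ### Shape bounds in terms of the longest edge and the smallest angle -/

theorem sin_angle_mul_norm_mul_norm_eq (p q r : Plane) :
    Real.sin (EuclideanGeometry.angle p q r) * (‖p - q‖ * ‖r - q‖) = |det2 (p - q) (r - q)| := by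
  rw [EuclideanGeometry.angle, vsub_eq_sub, vsub_eq_sub,
    InnerProductGeometry.sin_angle_mul_norm_mul_norm, ← Real.sqrt_sq_eq_abs]
  congr 1
  simp only [inner_plane, det2_apply]
  ring

theorem sin_le_sin_of_le_of_le {ρ θ : ℝ} (h0 : 0 ≤ ρ) (h1 : ρ ≤ θ) (h2 : θ ≤ Real.pi - ρ) :
    Real.sin ρ ≤ Real.sin θ := by
  have hpi := Real.pi_pos
  rcases le_total θ (Real.pi / 2) with h | h
  · exact Real.sin_le_sin_of_le_of_le_pi_div_two (by linarith) h h1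
  · rw [← Real.sin_pi_sub θ]
    exact Real.sin_le_sin_of_le_of_le_pi_div_two (by linarith) (by linarith) (by linarith)

namespace ConvexQuad

variable (Q : ConvexQuad)

theorem corner_succ (i : Fin 4) : Q.corner (i + 1) = det2 (Q.edge i) (Q.edge (i + 1)) := by
  rw [corner, edge, edge, add_sub_cancel_right]

theorem minAngle_le (i : Fin 4) :
    Q.minAngle ≤ EuclideanGeometry.angle (Q.vertex i) (Q.vertex (i + 1)) (Q.vertex (i + 2)) ∧
    Q.minAngle ≤ EuclideanGeometry.angle (Q.vertex (i + 1)) (Q.vertex (i + 2)) (Q.vertex i) ∧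
    Q.minAngle ≤ EuclideanGeometry.angle (Q.vertex (i + 2)) (Q.vertex i) (Q.vertex (i + 1)) := by
  have h : Q.minAngle ≤ _ := ciInf_le (Finite.bddBelow_range _) i
  exact ⟨h.trans (min_le_left _ _), h.trans ((min_le_right _ _).trans (min_le_left _ _)),
    h.trans ((min_le_right _ _).trans (min_le_right _ _))⟩

/-- All three products are twice the area of the triangle `v_i v_{i+1} v_{i+2}`. -/
theorem sin_angles (i : Fin 4) :
    Real.sin (EuclideanGeometry.angle (Q.vertex i) (Q.vertex (i + 1)) (Q.vertex (i + 2))) *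
      (‖Q.edge i‖ * ‖Q.edge (i + 1)‖) = Q.corner (i + 1) ∧
    Real.sin (EuclideanGeometry.angle (Q.vertex (i + 1)) (Q.vertex (i + 2)) (Q.vertex i)) *
      (‖Q.edge (i + 1)‖ * ‖Q.vertex (i + 2) - Q.vertex i‖) = Q.corner (i + 1) ∧
    Real.sin (EuclideanGeometry.angle (Q.vertex (i + 2)) (Q.vertex i) (Q.vertex (i + 1))) *
      (‖Q.edge i‖ * ‖Q.vertex (i + 2) - Q.vertex i‖) = Q.corner (i + 1) := by
  have hc := Q.corner_pos (i + 1)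
  have he : Q.edge (i + 1) = Q.vertex (i + 2) - Q.vertex (i + 1) := by
    rw [edge, add_assoc]
    rfl
  have h1 := sin_angle_mul_norm_mul_norm_eq (Q.vertex i) (Q.vertex (i + 1)) (Q.vertex (i + 2))
  have h2 := sin_angle_mul_norm_mul_norm_eq (Q.vertex (i + 1)) (Q.vertex (i + 2)) (Q.vertex i)
  have h3 := sin_angle_mul_norm_mul_norm_eq (Q.vertex (i + 2)) (Q.vertex i) (Q.vertex (i + 1))
  have e1 : |det2 (Q.vertex i - Q.vertex (i + 1)) (Q.vertex (i + 2) - Q.vertex (i + 1))| =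
      Q.corner (i + 1) := by
    rw [← abs_of_pos hc, ← abs_neg, corner_succ, he, edge]
    congr 1
    simp only [det2_apply, PiLp.sub_apply]
    ring
  have e2 : |det2 (Q.vertex (i + 1) - Q.vertex (i + 2)) (Q.vertex i - Q.vertex (i + 2))| =
      Q.corner (i + 1) := by
    rw [← abs_of_pos hc, ← abs_neg, corner_succ, he, edge]
    congr 1
    simp only [det2_apply, PiLp.sub_apply]
    ring
  have e3 : |det2 (Q.vertex (i + 2) - Q.vertex i) (Q.vertex (i + 1) - Q.vertex i)| =
      Q.corner (i + 1) := by
    rw [← abs_of_pos hc, ← abs_neg, corner_succ, he, edge]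
    congr 1
    simp only [det2_apply, PiLp.sub_apply]
    ring
  refine ⟨?_, ?_, ?_⟩
  · rw [← e1, ← h1, he, edge, norm_sub_rev (Q.vertex i)]
  · rw [← e2, ← h2, he, norm_sub_rev (Q.vertex (i + 1)), norm_sub_rev (Q.vertex i)]
  · rw [← e3, ← h3, edge, mul_comm ‖Q.vertex (i + 1) - Q.vertex i‖]

theorem edge_ne_zero (i : Fin 4) : Q.edge i ≠ 0 := by
  intro h
  have hc := Q.corner_pos (i + 1)
  rw [corner_succ, h] at hc
  simp [det2_apply] at hc

theorem minAngle_pos : 0 < Q.minAngle := by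
  obtain ⟨i, hi⟩ := exists_eq_ciInf_of_finite (f := fun i : Fin 4 =>
    min (EuclideanGeometry.angle (Q.vertex i) (Q.vertex (i + 1)) (Q.vertex (i + 2)))
      (min (EuclideanGeometry.angle (Q.vertex (i + 1)) (Q.vertex (i + 2)) (Q.vertex i))
        (EuclideanGeometry.angle (Q.vertex (i + 2)) (Q.vertex i) (Q.vertex (i + 1)))))
  rw [minAngle, ← hi]
  have hc := Q.corner_pos (i + 1)
  obtain ⟨h1, h2, h3⟩ := Q.sin_angles i
  have key : ∀ (p q r : Plane) (x : ℝ), Real.sin (EuclideanGeometry.angle p q r) * x =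
      Q.corner (i + 1) → 0 < EuclideanGeometry.angle p q r := by
    intro p q r x hx
    refine (EuclideanGeometry.angle_nonneg p q r).lt_of_ne fun h => ?_
    rw [← h, Real.sin_zero, zero_mul] at hx
    exact hc.ne hx
  exact lt_min (key _ _ _ _ h1) (lt_min (key _ _ _ _ h2) (key _ _ _ _ h3))

/-- The angles of the triangle add up to `π`, and the others are at least `ρ_Q`. -/
theorem angle_le (i : Fin 4) :
    EuclideanGeometry.angle (Q.vertex i) (Q.vertex (i + 1)) (Q.vertex (i + 2)) ≤
      Real.pi - Q.minAngle ∧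
    EuclideanGeometry.angle (Q.vertex (i + 2)) (Q.vertex i) (Q.vertex (i + 1)) ≤
      Real.pi - Q.minAngle := by
  obtain ⟨h1, h2, h3⟩ := Q.minAngle_le i
  have h0 := Q.minAngle_pos
  have hs := EuclideanGeometry.angle_add_angle_add_angle_eq_pi (p₁ := Q.vertex i)
    (p₂ := Q.vertex (i + 1)) (Q.vertex (i + 2)) (fun h => Q.edge_ne_zero i (by rw [edge, h, sub_self]))
  constructor <;> linarith

theorem sin_minAngle_pos : 0 < Real.sin Q.minAngle := by
  have h1 := (Q.angle_le 0).1
  have h2 := (Q.minAngle_le 0).1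
  have := Real.pi_pos
  exact Real.sin_pos_of_pos_of_lt_pi Q.minAngle_pos (by linarith [Q.minAngle_pos])

/-- The law of sines in the triangle `v_i v_{i+1} v_{i+2}`, obtained by comparing two expressions
for its area. -/
theorem sin_mul_norm_edge_le (i : Fin 4) :
    Real.sin Q.minAngle * ‖Q.edge i‖ ≤ ‖Q.edge (i + 1)‖ := by
  obtain ⟨-, h2, h3⟩ := Q.sin_angles i
  have hd : 0 < ‖Q.vertex (i + 2) - Q.vertex i‖ := by
    refine (norm_nonneg _).lt_of_ne fun h => ?_
    rw [← h, mul_zero, mul_zero] at h2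
    exact (Q.corner_pos (i + 1)).ne h2
  have h4 := sin_le_sin_of_le_of_le Q.minAngle_pos.le (Q.minAngle_le i).2.2 (Q.angle_le i).2
  have h5 := Real.sin_le_one (EuclideanGeometry.angle (Q.vertex (i + 1)) (Q.vertex (i + 2)) (Q.vertex i))
  have h6 : Real.sin (EuclideanGeometry.angle (Q.vertex (i + 2)) (Q.vertex i) (Q.vertex (i + 1))) *
      ‖Q.edge i‖ = Real.sin (EuclideanGeometry.angle (Q.vertex (i + 1)) (Q.vertex (i + 2))
        (Q.vertex i)) * ‖Q.edge (i + 1)‖ := by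
    refine mul_right_cancel₀ hd.ne' ?_
    linarith
  calc _ ≤ _ := mul_le_mul_of_nonneg_right h4 (norm_nonneg _)
    _ = _ := h6
    _ ≤ 1 * ‖Q.edge (i + 1)‖ := mul_le_mul_of_nonneg_right h5 (norm_nonneg _)
    _ = _ := one_mul _

theorem norm_edge_le_size (i : Fin 4) : ‖Q.edge i‖ ≤ Q.size :=
  le_ciSup (f := fun i => ‖Q.edge i‖) (Finite.bddAbove_range _) i

theorem size_pos : 0 < Q.size := (norm_pos_iff.2 (Q.edge_ne_zero 0)).trans_le (Q.norm_edge_le_size 0)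

/-- Each edge is reached from a longest one in at most three steps around the quadrilateral, and
each step loses at most a factor `sin ρ_Q`. A corner determinant is the product of two edge lengths
and the sine of the enclosed angle. -/
theorem shapeBounds : Q.ShapeBounds Q.size (Q.size * Real.sin Q.minAngle ^ 3)
    (Real.sin Q.minAngle * (Q.size * Real.sin Q.minAngle ^ 3) ^ 2) := by
  have hs := Q.sin_minAngle_pos
  have hs1 := Real.sin_le_one Q.minAngle
  have hle : ∀ i, Q.size * Real.sin Q.minAngle ^ 3 ≤ ‖Q.edge i‖ := by
    obtain ⟨j, hj⟩ := exists_eq_ciSup_of_finite (f := fun i => ‖Q.edge i‖)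
    have hj' : ‖Q.edge j‖ = Q.size := hj
    have step : ∀ m : ℕ, Q.size * Real.sin Q.minAngle ^ m ≤ ‖Q.edge ((· + 1)^[m] j)‖ := by
      intro m
      induction m with
      | zero => simp [hj']
      | succ m ih =>
        have h1 := Q.sin_mul_norm_edge_le ((· + 1)^[m] j)
        have h2 := mul_le_mul_of_nonneg_left ih hs.le
        rw [Function.iterate_succ_apply', pow_succ]
        linarith
    have hcyc : ∀ j i : Fin 4, ∃ m : Fin 4, (· + 1)^[(m : ℕ)] j = i := by decide
    intro i
    obtain ⟨m, rfl⟩ := hcyc j i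
    exact (mul_le_mul_of_nonneg_left (pow_le_pow_of_le_one hs.le hs1 (by omega))
      Q.size_pos.le).trans (step m)
  refine ⟨Q.norm_edge_le_size, hle, fun i => ?_⟩
  have h1 := (Q.sin_angles (i - 1)).1
  have h2 := sin_le_sin_of_le_of_le Q.minAngle_pos.le (Q.minAngle_le (i - 1)).1 (Q.angle_le (i - 1)).1
  rw [sub_add_cancel] at h1
  have hp : 0 ≤ Q.size * Real.sin Q.minAngle ^ 3 := mul_nonneg Q.size_pos.le (pow_nonneg hs.le 3)
  rw [← h1, sq]
  rw [sub_add_cancel] at h2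
  exact mul_le_mul h2 (mul_le_mul (hle _) (hle _) hp (norm_nonneg _)) (mul_nonneg hp hp)
    (hs.le.trans h2)

end ConvexQuad

/-! ### Sobolev norms of functions with Lipschitz derivatives -/

theorem norm_unitVec (a : Fin 2) : ‖unitVec a‖ = 1 := by simp [unitVec]

theorem BddLip.lipschitzOnWith {U : Set Plane} {M : ℝ} {f : Plane → ℝ} (h : BddLip U M f) :
    LipschitzOnWith ⟨M, h.1⟩ f U :=
  LipschitzOnWith.of_dist_le_mul fun x hx y hy => by
    rw [Real.dist_eq]
    exact (h.2 x hx).2 y hy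

/-- Partial derivatives of test functions are test functions. -/
theorem testFunction_fderiv {U : Set Plane} {ψ : Plane → ℝ} (hψ : ContDiff ℝ ∞ ψ)
    (hc : HasCompactSupport ψ) (hU : tsupport ψ ⊆ U) (v : Plane) :
    ContDiff ℝ ∞ (fun x => fderiv ℝ ψ x v) ∧ HasCompactSupport (fun x => fderiv ℝ ψ x v) ∧
      tsupport (fun x => fderiv ℝ ψ x v) ⊆ U := by
  exact ⟨(hψ.fderiv_right (m := ∞) (by simp)).clm_apply contDiff_const, hc.fderiv_apply ℝ v,
    (tsupport_fderiv_apply_subset ℝ v).trans hU⟩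

/-- A bounded Lipschitz function has bounded weak derivatives. -/
theorem BddLip.exists_weakDeriv {U : Set Plane} (hU : IsOpen U) {M : ℝ} {f : Plane → ℝ}
    (hf : BddLip U M f) (v : Plane) (hv : ‖v‖ = 1) :
    ∃ G : Plane → ℝ, LocallyIntegrableOn G U ∧ (∀ x, |G x| ≤ M) ∧
      (∀ x ∈ U, ∀ y, HasLineDerivAt ℝ f y x v → G x = y) ∧
      ∀ ψ : Plane → ℝ, ContDiff ℝ ∞ ψ → HasCompactSupport ψ → tsupport ψ ⊆ U →
        ∫ x in U, f x * fderiv ℝ ψ x v = -∫ x in U, G x * ψ x := by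
  -- A Lipschitz extension to the plane has a line derivative almost everywhere, bounded by the
  -- Lipschitz constant, and satisfies integration by parts. On the open set `U` this derivative is
  -- that of `f` wherever the latter exists.
  obtain ⟨F, hF, hFf⟩ := hf.lipschitzOnWith.extend_real
  refine ⟨fun x => lineDeriv ℝ F x v, (hF.locallyIntegrable_lineDeriv v).locallyIntegrableOn U,
    fun x => ?_, fun x hx y hy => ?_, fun ψ hψ hc hs => ?_⟩
  · have := norm_lineDeriv_le_of_lipschitz ℝ hF (x₀ := x) (v := v)
    rwa [hv, mul_one, Real.norm_eq_abs] at this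
  · have : F =ᶠ[𝓝 x] f := by
      filter_upwards [hU.mem_nhds hx] with z hz
      exact (hFf hz).symm
    exact (hy.congr_of_eventuallyEq this).lineDeriv
  · obtain ⟨D, hD⟩ := ContDiff.lipschitzWith_of_hasCompactSupport hc hψ (by simp)
    have h1 := hF.integral_lineDeriv_mul_eq (μ := volume) hD hc v
    have hz : ∀ x, x ∉ U → ψ x = 0 := fun x hx => image_eq_zero_of_notMem_tsupport fun h => hx (hs h)
    have hz' : ∀ x, x ∉ U → fderiv ℝ ψ x v = 0 := fun x hx =>
      image_eq_zero_of_notMem_tsupport (f := fun x => fderiv ℝ ψ x v)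
        fun h => hx ((testFunction_fderiv hψ hc hs v).2.2 h)
    have h2 : ∫ x in U, f x * fderiv ℝ ψ x v = ∫ x in U, F x * fderiv ℝ ψ x v :=
      setIntegral_congr_fun hU.measurableSet fun x hx => by simp only [hFf hx]
    rw [h2, setIntegral_eq_integral_of_forall_compl_eq_zero (fun x hx => by rw [hz' x hx, mul_zero]),
      setIntegral_eq_integral_of_forall_compl_eq_zero (fun x hx => by rw [hz x hx, mul_zero]), h1,
      ← integral_neg]
    refine integral_congr_ae (Eventually.of_forall fun x => ?_)
    have h3 : lineDeriv ℝ ψ x (-v) = - fderiv ℝ ψ x v := by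
      rw [(hψ.differentiable (by simp) x).lineDeriv_eq_fderiv, map_neg]
    simp only [h3]
    ring

theorem BddLip.locallyIntegrableOn {U : Set Plane} (hU : IsOpen U) {M : ℝ} {f : Plane → ℝ}
    (hf : BddLip U M f) : LocallyIntegrableOn f U :=
  hf.lipschitzOnWith.continuousOn.locallyIntegrableOn hU.measurableSet

theorem eLpNorm_two_le {U : Set Plane} (hU : IsOpen U) {M V : ℝ} {f : Plane → ℝ}
    (hV : volume U ≤ ENNReal.ofReal V) (hf : ∀ x ∈ U, |f x| ≤ M) :
    eLpNorm f 2 (volume.restrict U) ≤ ENNReal.ofReal (√V * M) := by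
  have h1 : ∀ᵐ x ∂(volume.restrict U), ‖f x‖ ≤ M :=
    (ae_restrict_iff' hU.measurableSet).2 (Eventually.of_forall hf)
  refine (eLpNorm_le_of_ae_bound h1).trans ?_
  rw [ENNReal.ofReal_mul (Real.sqrt_nonneg V), Measure.restrict_apply_univ]
  gcongr
  rw [Real.sqrt_eq_rpow]
  refine (ENNReal.rpow_le_rpow hV (by positivity)).trans ?_
  rcases le_total 0 V with h | h
  · rw [ENNReal.ofReal_rpow_of_nonneg h (by positivity)]
    norm_num
  · rw [ENNReal.ofReal_of_nonpos h]
    norm_num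

/-- The classical first derivatives are weak derivatives, and being Lipschitz they have bounded weak
derivatives themselves. The norm is an infimum, so one admissible family suffices. -/
theorem sobolevNorm_le {U : Set Plane} (hU : IsOpen U) {M V : ℝ}
    (hV : volume U ≤ ENNReal.ofReal V) {f : Plane → ℝ} {f' : Fin 2 → Plane → ℝ}
    (hf : BddLip U M f) (hf' : ∀ a, BddLip U M (f' a))
    (hd : ∀ a, ∀ x ∈ U, HasLineDerivAt ℝ f (f' a x) x (unitVec a)) {k : ℕ} (hk : k ≤ 2) :
    sobolevNorm k U f ≤ ENNReal.ofReal (3 * (√V * M)) := by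
  obtain ⟨G00, hi00, hb00, -, hw00⟩ := (hf' 0).exists_weakDeriv hU (unitVec 0) (norm_unitVec 0)
  obtain ⟨G01, hi01, hb01, -, hw01⟩ := (hf' 0).exists_weakDeriv hU (unitVec 1) (norm_unitVec 1)
  obtain ⟨G11, hi11, hb11, -, hw11⟩ := (hf' 1).exists_weakDeriv hU (unitVec 1) (norm_unitVec 1)
  have hw : ∀ a, ∀ ψ : Plane → ℝ, ContDiff ℝ ∞ ψ → HasCompactSupport ψ → tsupport ψ ⊆ U →
      ∫ x in U, f x * fderiv ℝ ψ x (unitVec a) = -∫ x in U, f' a x * ψ x := by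
    intro a ψ h1 h2 h3
    obtain ⟨G, -, -, hG, hw⟩ := hf.exists_weakDeriv hU (unitVec a) (norm_unitVec a)
    rw [hw ψ h1 h2 h3]
    congr 1
    exact setIntegral_congr_fun hU.measurableSet fun x hx => by simp only [hG x hx _ (hd a x hx)]
  let g : ℕ × ℕ → Plane → ℝ := fun α =>
    if α = (0, 0) then f else if α = (1, 0) then f' 0 else if α = (0, 1) then f' 1 else
      if α = (2, 0) then G00 else if α = (1, 1) then G01 else G11
  have hα : ∀ α ∈ multiIndices k,
      α ∈ ({(0, 0), (1, 0), (0, 1), (2, 0), (1, 1), (0, 2)} : Finset (ℕ × ℕ)) := by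
    rintro ⟨a, b⟩ h
    simp only [multiIndices, Finset.mem_filter, Finset.mem_product, Finset.mem_range] at h
    obtain ⟨⟨h1, h2⟩, h3⟩ := h
    have h4 : a ≤ 2 := by omega
    have h5 : b ≤ 2 := by omega
    interval_cases a <;> interval_cases b <;> first | (exfalso; omega) | simp
  have hweak : ∀ α ∈ multiIndices k, IsWeakDeriv U α f (g α) := by
    intro α hαk
    have := hα α hαk
    simp only [Finset.mem_insert, Finset.mem_singleton] at this
    refine ⟨hf.locallyIntegrableOn hU, ?_, ?_⟩
    · rcases this with rfl | rfl | rfl | rfl | rfl | rfl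
      exacts [hf.locallyIntegrableOn hU, (hf' 0).locallyIntegrableOn hU,
        (hf' 1).locallyIntegrableOn hU, hi00, hi01, hi11]
    · intro ψ h1 h2 h3
      obtain ⟨p1, p2, p3⟩ := testFunction_fderiv h1 h2 h3 (unitVec 0)
      obtain ⟨q1, q2, q3⟩ := testFunction_fderiv h1 h2 h3 (unitVec 1)
      rcases this with rfl | rfl | rfl | rfl | rfl | rfl
      · simp [partialDeriv, g]
      · simpa [partialDeriv, g] using hw 0 ψ h1 h2 h3
      · simpa [partialDeriv, g] using hw 1 ψ h1 h2 h3
      · have e1 := hw 0 _ p1 p2 p3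
        have e2 := hw00 ψ h1 h2 h3
        rw [e2, neg_neg] at e1
        simpa [partialDeriv, g] using e1
      -- `partialDeriv (1, 1)` applies `∂_2` to the test function first, so that `∂_1` moves to `f`
      -- first; this is why `G01` is a derivative of `f' 0`.
      · have e1 := hw 0 _ q1 q2 q3
        have e2 := hw01 ψ h1 h2 h3
        rw [e2, neg_neg] at e1
        simpa [partialDeriv, g] using e1
      · have e1 := hw 1 _ q1 q2 q3
        have e2 := hw11 ψ h1 h2 h3
        rw [e2, neg_neg] at e1
        simpa [partialDeriv, g] using e1
  refine (iInf₂_le g hweak).trans ?_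
  have hterm : ∀ α ∈ multiIndices k,
      eLpNorm (g α) 2 (volume.restrict U) ^ 2 ≤ ENNReal.ofReal (√V * M) ^ 2 := by
    intro α hαk
    have := hα α hαk
    simp only [Finset.mem_insert, Finset.mem_singleton] at this
    refine pow_le_pow_left₀ zero_le (eLpNorm_two_le hU hV fun x hx => ?_) 2
    rcases this with rfl | rfl | rfl | rfl | rfl | rfl
    exacts [(hf.2 x hx).1, ((hf' 0).2 x hx).1, ((hf' 1).2 x hx).1, hb00 x, hb01 x, hb11 x]
  -- There are at most six multi-indices; `9` is taken because its square root is the factor `3`.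
  have hcard : (multiIndices k).card ≤ 9 := by
    refine (Finset.card_le_card hα).trans ?_
    decide
  have hsum : ∑ α ∈ multiIndices k, eLpNorm (g α) 2 (volume.restrict U) ^ 2 ≤
      ENNReal.ofReal (3 * (√V * M)) ^ 2 := by
    refine (Finset.sum_le_sum hterm).trans ?_
    rw [Finset.sum_const, nsmul_eq_mul, ENNReal.ofReal_mul (p := 3) (by norm_num), mul_pow]
    refine mul_le_mul' ?_ le_rfl
    have h3 : ENNReal.ofReal 3 ^ 2 = 9 := by
      rw [← ENNReal.ofReal_pow (by norm_num)]
      norm_num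
    rw [h3]
    exact_mod_cast hcard
  refine (ENNReal.rpow_le_rpow hsum (by norm_num)).trans ?_
  rw [← ENNReal.rpow_natCast, ← ENNReal.rpow_mul]
  norm_num

/-! ### Transfer between the quadrilateral and the parameter square -/

/-- The starting points of the sides of the parameter square. -/
def sideBase : Fin 4 → ℝ × ℝ := ![(0, 0), (1, 0), (1, 1), (0, 1)]

/-- The directions of the sides of the parameter square. -/
def sideDir : Fin 4 → ℝ × ℝ := ![(1, 0), (0, 1), (-1, 0), (0, -1)]

/-- The inward normals of the sides of the parameter square. -/
def sideNormal : Fin 4 → ℝ × ℝ := ![(0, 1), (-1, 0), (0, -1), (1, 0)]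

/-- The parametrizations of the sides of the parameter square. -/
def sidePt (i : Fin 4) (s : ℝ) : ℝ × ℝ := sideBase i + s • sideDir i

theorem sidePt_mem (i : Fin 4) {s : ℝ} (hs : s ∈ Icc (0 : ℝ) 1) :
    sidePt i s ∈ ConvexQuad.square := by
  obtain ⟨h0, h1⟩ := hs
  fin_cases i <;> simp [sidePt, sideBase, sideDir, ConvexQuad.square, h0, h1]

namespace ConvexQuad

variable (Q : ConvexQuad)

theorem toPlane_sidePt (i : Fin 4) (s : ℝ) : Q.toPlane (sidePt i s) = Q.edgeParam i s := by
  obtain ⟨h0, h1, h2, h3⟩ := Q.edgeParam_eq s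
  fin_cases i
  · simp [sidePt, sideBase, sideDir, toPlane, h0]
  · simp [sidePt, sideBase, sideDir, toPlane, h1]
  · simp [sidePt, sideBase, sideDir, toPlane, h2, sub_eq_add_neg]
  · simp [sidePt, sideBase, sideDir, toPlane, h3, sub_eq_add_neg]

/-- The vector field along an edge that is the image of the inward normal. -/
def inward (i : Fin 4) (s : ℝ) : Plane :=
  (1 - s) • (Q.vertex (i - 1) - Q.vertex i) + s • (Q.vertex (i + 2) - Q.vertex (i + 1))

/-- The derivative of the parametrization. -/
def dToPlane (ξ : ℝ × ℝ) : ℝ × ℝ →L[ℝ] Plane :=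
  (ContinuousLinearMap.fst ℝ ℝ ℝ).smulRight (Q.sVec ξ.2) +
    (ContinuousLinearMap.snd ℝ ℝ ℝ).smulRight (Q.tVec ξ.1)

theorem dToPlane_apply (ξ z : ℝ × ℝ) : Q.dToPlane ξ z = z.1 • Q.sVec ξ.2 + z.2 • Q.tVec ξ.1 := rfl

theorem hasFDerivAt_toPlane (ξ : ℝ × ℝ) : HasFDerivAt Q.toPlane (Q.dToPlane ξ) ξ := by
  have h1 : HasFDerivAt (fun ξ : ℝ × ℝ => ξ.1) (ContinuousLinearMap.fst ℝ ℝ ℝ) ξ := hasFDerivAt_fst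
  have h2 : HasFDerivAt (fun ξ : ℝ × ℝ => ξ.2) (ContinuousLinearMap.snd ℝ ℝ ℝ) ξ := hasFDerivAt_snd
  have h3 := h1.const_sub 1
  have h4 := h2.const_sub 1
  have h := ((((h3.mul h4).smul_const (Q.vertex 0)).add ((h1.mul h4).smul_const (Q.vertex 1))).add
    ((h1.mul h2).smul_const (Q.vertex 2))).add ((h3.mul h2).smul_const (Q.vertex 3))
  refine h.congr_fderiv ?_
  ext z <;>
  · simp [dToPlane, sVec, tVec]
    ring

theorem dToPlane_sideNormal (i : Fin 4) (s : ℝ) :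
    Q.dToPlane (sidePt i s) (sideNormal i) = Q.inward i s := by
  obtain ⟨h0, h1, h2, h3, h4, h5, h6, h7⟩ := fin4_arith
  have h8 : (2 : Fin 4) + 2 = 0 := by decide
  have h9 : (3 : Fin 4) + 2 = 1 := by decide
  have h10 : (1 : Fin 4) + 2 = 3 := by decide
  have h11 : (-1 : Fin 4) = 3 := by decide
  fin_cases i <;> ext a <;>
  · simp [dToPlane_apply, sidePt, sideBase, sideNormal, sideDir, sVec, tVec, inward, h2, h3, h5, h6, h7, h8,
      h9, h10, h11]
    try ring

theorem det2_edge_inward (i : Fin 4) (s : ℝ) :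
    det2 (Q.edge i) (Q.inward i s) = (1 - s) * Q.corner i + s * Q.corner (i + 1) := by
  have h1 : i + 1 + 1 = i + 2 := by rw [add_assoc]; rfl
  rw [corner, corner, add_sub_cancel_right, h1]
  simp only [det2_apply, edge, inward, PiLp.add_apply, PiLp.sub_apply, PiLp.smul_apply, smul_eq_mul]
  ring

theorem det2_edge_inward_pos (i : Fin 4) {s : ℝ} (hs : s ∈ Icc (0 : ℝ) 1) :
    0 < det2 (Q.edge i) (Q.inward i s) := by
  rw [det2_edge_inward]
  have h1 := Q.corner_pos i
  have h2 := Q.corner_pos (i + 1)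
  rcases eq_or_lt_of_le hs.1 with h | h
  · rw [← h]; simpa using h1
  · have := mul_pos h h2
    have := mul_nonneg (sub_nonneg.2 hs.2) h1.le
    linarith

/-- The component of the inward vector field in the direction of the normal. -/
def normalCoef (n : Fin 4 → Plane) (i : Fin 4) (s : ℝ) : ℝ :=
  (1 - s) * Inner.inner ℝ (Q.vertex (i - 1) - Q.vertex i) (n i) +
    s * Inner.inner ℝ (Q.vertex (i + 2) - Q.vertex (i + 1)) (n i)

/-- The component of the inward vector field in the direction of the edge. -/
def edgeCoef (i : Fin 4) (s : ℝ) : ℝ :=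
  (1 - s) * (Inner.inner ℝ (Q.vertex (i - 1) - Q.vertex i) (Q.edge i) / ‖Q.edge i‖ ^ 2) +
    s * (Inner.inner ℝ (Q.vertex (i + 2) - Q.vertex (i + 1)) (Q.edge i) / ‖Q.edge i‖ ^ 2)

variable {Q} {n : Fin 4 → Plane}

theorem eq_normal_add_edge (hn : Q.IsUnitNormal n) (i : Fin 4) (d : Plane) :
    d = Inner.inner ℝ d (n i) • n i + (Inner.inner ℝ d (Q.edge i) / ‖Q.edge i‖ ^ 2) • Q.edge i := by
  obtain ⟨h1, h2⟩ := hn i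
  have h3 : ‖Q.edge i‖ ^ 2 ≠ 0 := pow_ne_zero 2 (norm_ne_zero_iff.2 (Q.edge_ne_zero i))
  have h4 : n i 0 ^ 2 + n i 1 ^ 2 = 1 := by rw [← norm_sq_plane, h1, one_pow]
  rw [inner_plane] at h2
  -- The edge is a multiple of the normal turned by a right angle; the factor is called `τ` below.
  have h5 : Q.edge i 0 = (Q.edge i 1 * n i 0 - Q.edge i 0 * n i 1) * (- n i 1) := by
    linear_combination (- Q.edge i 0) * h4 + n i 0 * h2
  have h6 : Q.edge i 1 = (Q.edge i 1 * n i 0 - Q.edge i 0 * n i 1) * n i 0 := by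
    linear_combination (- Q.edge i 1) * h4 + n i 1 * h2
  have h7 : ‖Q.edge i‖ ^ 2 = (Q.edge i 1 * n i 0 - Q.edge i 0 * n i 1) ^ 2 := by
    rw [norm_sq_plane]
    generalize Q.edge i 1 * n i 0 - Q.edge i 0 * n i 1 = τ at h5 h6
    rw [h5, h6]
    linear_combination τ ^ 2 * h4
  rw [inner_plane, inner_plane, h7]
  rw [h7] at h3
  generalize Q.edge i 1 * n i 0 - Q.edge i 0 * n i 1 = τ at h3 h5 h6
  have h8 : τ ≠ 0 := fun h => h3 (by rw [h]; norm_num)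
  refine plane_ext ?_ ?_ <;>
    simp only [PiLp.add_apply, PiLp.smul_apply, smul_eq_mul, h5, h6] <;> field_simp
  · linear_combination (-d 0) * h4
  · linear_combination (-d 1) * h4

/-- The field is affine along the edge while the frame of normal and edge vector is constant, so
both coefficients are affine. This is why normal and tangential derivatives of degree `p - 1` fit a
transversal derivative of degree `p`. -/
theorem inward_eq (hn : Q.IsUnitNormal n) (i : Fin 4) (s : ℝ) :
    Q.inward i s = Q.normalCoef n i s • n i + Q.edgeCoef i s • Q.edge i := by
  conv_lhs => rw [inward, eq_normal_add_edge hn i (Q.vertex (i - 1) - Q.vertex i),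
    eq_normal_add_edge hn i (Q.vertex (i + 2) - Q.vertex (i + 1))]
  rw [normalCoef, edgeCoef]
  module

theorem normalCoef_ne_zero (hn : Q.IsUnitNormal n) (i : Fin 4) {s : ℝ} (hs : s ∈ Icc (0 : ℝ) 1) :
    Q.normalCoef n i s ≠ 0 := by
  intro h
  have h1 := Q.det2_edge_inward_pos i hs
  rw [inward_eq hn, h] at h1
  simp only [det2_apply, PiLp.add_apply, PiLp.smul_apply, smul_eq_mul] at h1
  ring_nf at h1
  exact lt_irrefl _ h1

theorem det2_edge_normal_ne_zero (hn : Q.IsUnitNormal n) (i : Fin 4) :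
    det2 (Q.edge i) (n i) ≠ 0 := by
  intro h
  have h1 := Q.det2_edge_inward_pos i (s := 0) (by simp)
  rw [inward_eq hn] at h1
  simp only [det2_apply, PiLp.add_apply, PiLp.smul_apply, smul_eq_mul] at h1 h
  have : Q.edge i 0 * (Q.normalCoef n i 0 * n i 1 + Q.edgeCoef i 0 * Q.edge i 1) -
      Q.edge i 1 * (Q.normalCoef n i 0 * n i 0 + Q.edgeCoef i 0 * Q.edge i 0) = 0 := by
    linear_combination Q.normalCoef n i 0 * h
  exact h1.ne' this

variable (Q) {g : ℝ × ℝ → ℝ} {ξ : ℝ × ℝ}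

theorem comp_toSquare_eventuallyEq (hξ : ξ ∈ Q.regular) :
    (fun η => g (Q.toSquare (Q.toPlane η))) =ᶠ[𝓝 ξ] g := by
  filter_upwards [Q.isOpen_regular.mem_nhds hξ] with η hη
  rw [Q.toSquare_toPlane hη]

theorem contDiffAt_comp_toSquare {m : WithTop ℕ∞} (hξ : ξ ∈ Q.regular) (hg : ContDiffAt ℝ m g ξ) :
    ContDiffAt ℝ m (fun x => g (Q.toSquare x)) (Q.toPlane ξ) := by
  refine ContDiffAt.comp (g := g) _ ?_ (Q.contDiffAt_toSquare hξ m)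
  rwa [Q.toSquare_toPlane hξ]

theorem differentiableAt_comp_toSquare (hξ : ξ ∈ Q.regular) (hg : DifferentiableAt ℝ g ξ) :
    DifferentiableAt ℝ (fun x => g (Q.toSquare x)) (Q.toPlane ξ) := by
  refine DifferentiableAt.comp (g := g) _ ?_
    ((Q.contDiffAt_toSquare hξ 1).differentiableAt (by simp))
  rwa [Q.toSquare_toPlane hξ]

theorem fderiv_eq_fderiv_comp_toSquare (hξ : ξ ∈ Q.regular) (hg : DifferentiableAt ℝ g ξ)
    (z : ℝ × ℝ) :
    fderiv ℝ g ξ z = fderiv ℝ (fun x => g (Q.toSquare x)) (Q.toPlane ξ) (Q.dToPlane ξ z) := by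
  have h1 := ((Q.differentiableAt_comp_toSquare hξ hg).hasFDerivAt.comp ξ
    (Q.hasFDerivAt_toPlane ξ)).congr_of_eventuallyEq (Q.comp_toSquare_eventuallyEq hξ).symm
  rw [h1.fderiv]
  rfl

/-- Cramer's rule for `w` in the frame of the two tangent vectors. All factors on the right are
functions of the parameters with known bounds and Lipschitz constants. -/
theorem fderiv_comp_toSquare (hξ : ξ ∈ Q.regular) (hg : DifferentiableAt ℝ g ξ) (w : Plane) :
    fderiv ℝ (fun x => g (Q.toSquare x)) (Q.toPlane ξ) w =
      (det2 w (Q.tVec ξ.1) * fderiv ℝ g ξ (1, 0) + det2 (Q.sVec ξ.2) w * fderiv ℝ g ξ (0, 1)) *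
        (Q.jac ξ.1 ξ.2)⁻¹ := by
  have h1 := congrArg (fderiv ℝ (fun x => g (Q.toSquare x)) (Q.toPlane ξ))
    (det2_smul_eq (Q.sVec ξ.2) (Q.tVec ξ.1) w)
  rw [map_smul, map_add, map_smul, map_smul] at h1
  have h2 := Q.fderiv_eq_fderiv_comp_toSquare hξ hg (1, 0)
  have h3 := Q.fderiv_eq_fderiv_comp_toSquare hξ hg (0, 1)
  simp only [dToPlane_apply, one_smul, zero_smul, add_zero, zero_add] at h2 h3
  rw [h2, h3, ← div_eq_mul_inv, eq_div_iff hξ.1.ne', mul_comm]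
  exact h1

theorem dirDeriv_eq {f f₁ : Plane → ℝ} (h : EqOn f f₁ Q.closed) {x : Plane} (hx : x ∈ Q.closed)
    (hd : DifferentiableAt ℝ f₁ x) (w : Plane) : Q.dirDeriv w f x = fderiv ℝ f₁ x w := by
  rw [dirDeriv, fderivWithin_congr h (h hx), hd.fderivWithin (Q.uniqueDiffOn_closed x hx)]

theorem edgeParam_mem_closed (i : Fin 4) {s : ℝ} (hs : s ∈ Icc (0 : ℝ) 1) :
    Q.edgeParam i s ∈ Q.closed := by
  rw [← toPlane_sidePt]
  exact Q.toPlane_mem_closed (sidePt_mem i hs)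

theorem hasDerivAt_edgeParam (i : Fin 4) (s : ℝ) : HasDerivAt (Q.edgeParam i) (Q.edge i) s := by
  have h1 : HasDerivAt (fun s : ℝ => s) 1 s := hasDerivAt_id s
  have h := ((h1.const_sub 1).smul_const (Q.vertex i)).add (h1.smul_const (Q.vertex (i + 1)))
  refine h.congr_deriv ?_
  rw [edge]
  module

end ConvexQuad

/-! ### Tensor product functions on the parameter square -/

section Tensor

variable {N : Set ℝ} [Fintype N] {b : (Fin 2 × Fin 2) ⊕ N → ℝ → ℝ}
  (c : (Fin 2 × Fin 2) ⊕ N → (Fin 2 × Fin 2) ⊕ N → ℝ)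

/-- The tensor product function with the given coefficients. -/
def tens (b : (Fin 2 × Fin 2) ⊕ N → ℝ → ℝ) (ξ : ℝ × ℝ) : ℝ :=
  ∑ i, ∑ j, c i j * (b i ξ.1 * b j ξ.2)

/-- The derivative of order `me.1` in the second parameter on the side where this parameter is
`me.2`. -/
def rowFun (b : (Fin 2 × Fin 2) ⊕ N → ℝ → ℝ) (me : Fin 2 × Fin 2) (s : ℝ) : ℝ :=
  ∑ i, c i (.inl me) * b i s

/-- The derivative of order `me.1` in the first parameter on the side where this parameter is
`me.2`. -/
def colFun (b : (Fin 2 × Fin 2) ⊕ N → ℝ → ℝ) (me : Fin 2 × Fin 2) (t : ℝ) : ℝ :=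
  ∑ j, c (.inl me) j * b j t

theorem tens_contDiffAt {m : WithTop ℕ∞} {ξ : ℝ × ℝ} (h1 : ∀ i, ContDiffAt ℝ m (b i) ξ.1)
    (h2 : ∀ i, ContDiffAt ℝ m (b i) ξ.2) : ContDiffAt ℝ m (tens c b) ξ := by
  refine ContDiffAt.sum fun i _ => ContDiffAt.sum fun j _ => contDiffAt_const.mul ?_
  exact ((h1 i).comp ξ contDiffAt_fst).mul ((h2 j).comp ξ contDiffAt_snd)

theorem tens_contDiff {m : WithTop ℕ∞} (h : ∀ i, ContDiff ℝ m (b i)) : ContDiff ℝ m (tens c b) :=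
  contDiff_iff_contDiffAt.2 fun _ =>
    tens_contDiffAt c (fun i => (h i).contDiffAt) fun i => (h i).contDiffAt

theorem tens_hasFDerivAt (h : ∀ i, Differentiable ℝ (b i)) (ξ : ℝ × ℝ) :
    HasFDerivAt (tens c b) (∑ i, ∑ j, c i j •
      (b i ξ.1 • (deriv (b j) ξ.2 • ContinuousLinearMap.snd ℝ ℝ ℝ) +
        b j ξ.2 • (deriv (b i) ξ.1 • ContinuousLinearMap.fst ℝ ℝ ℝ))) ξ := by
  refine HasFDerivAt.fun_sum fun i _ => HasFDerivAt.fun_sum fun j _ => HasFDerivAt.const_mul ?_ _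
  have h1 := (h i ξ.1).hasDerivAt.comp_hasFDerivAt ξ
    (hasFDerivAt_fst (𝕜 := ℝ) (E := ℝ) (F := ℝ) (p := ξ))
  have h2 := (h j ξ.2).hasDerivAt.comp_hasFDerivAt ξ
    (hasFDerivAt_snd (𝕜 := ℝ) (E := ℝ) (F := ℝ) (p := ξ))
  exact h1.mul h2

theorem tens_fderiv (h : ∀ i, Differentiable ℝ (b i)) (ξ z : ℝ × ℝ) :
    fderiv ℝ (tens c b) ξ z = z.1 * (∑ i, ∑ j, c i j * (deriv (b i) ξ.1 * b j ξ.2)) +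
      z.2 * (∑ i, ∑ j, c i j * (b i ξ.1 * deriv (b j) ξ.2)) := by
  rw [(tens_hasFDerivAt c h ξ).fderiv]
  simp only [sum_apply, smul_apply,
    add_apply, ContinuousLinearMap.coe_fst', ContinuousLinearMap.coe_snd',
    smul_eq_mul, Finset.mul_sum, ← Finset.sum_add_distrib]
  refine Finset.sum_congr rfl fun i _ => Finset.sum_congr rfl fun j _ => by ring

variable {W : Submodule ℝ (ℝ → ℝ)} (hb : IsSplDual 2 N W b)

include hb

theorem IsSplDual.splDof_eq [DecidableEq ((Fin 2 × Fin 2) ⊕ N)] (i j : (Fin 2 × Fin 2) ⊕ N) :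
    splDof 2 N j (b i) = if j = i then 1 else 0 := by
  have h1 := hb.dof (Pi.single i 1) j
  have h2 : (fun s => ∑ i', (Pi.single i (1 : ℝ) : (Fin 2 × Fin 2) ⊕ N → ℝ) i' * b i' s) = b i := by
    ext s
    rw [Finset.sum_eq_single i]
    · simp
    · intro j _ hj
      simp [Pi.single_eq_of_ne hj]
    · simp
  rw [h2] at h1
  rw [h1, Pi.single_apply]

/-- Applied in one variable, this turns boundary data of a tensor product function into a row or a
column of its coefficient matrix. -/
theorem IsSplDual.sum_mul_splDof (a : (Fin 2 × Fin 2) ⊕ N → ℝ) (j : (Fin 2 × Fin 2) ⊕ N) :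
    ∑ i, a i * splDof 2 N j (b i) = a j := by
  classical
  simp [hb.splDof_eq]

theorem rowFun_mem (me : Fin 2 × Fin 2) : rowFun c b me ∈ W := hb.sum_mem _

theorem colFun_mem (me : Fin 2 × Fin 2) : colFun c b me ∈ W := hb.sum_mem _

theorem splDof_rowFun (me : Fin 2 × Fin 2) (j) : splDof 2 N j (rowFun c b me) = c j (.inl me) :=
  hb.dof (fun i => c i (.inl me)) j

theorem splDof_colFun (me : Fin 2 × Fin 2) (j) : splDof 2 N j (colFun c b me) = c (.inl me) j :=
  hb.dof (fun i => c (.inl me) i) j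

theorem tens_row (e : Fin 2) (s : ℝ) : tens c b (s, ((e : ℕ) : ℝ)) = rowFun c b (0, e) s := by
  refine Finset.sum_congr rfl fun i _ => ?_
  rw [← hb.sum_mul_splDof (c i) (.inl (0, e)), Finset.sum_mul]
  exact Finset.sum_congr rfl fun j _ => by simp [splDof]; ring

theorem tens_col (e : Fin 2) (t : ℝ) : tens c b (((e : ℕ) : ℝ), t) = colFun c b (0, e) t := by
  rw [tens, Finset.sum_comm]
  refine Finset.sum_congr rfl fun j _ => ?_
  rw [← hb.sum_mul_splDof (fun i => c i j) (.inl (0, e)), Finset.sum_mul]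
  exact Finset.sum_congr rfl fun i _ => by simp [splDof]; ring

theorem tens_face (x y : N) : tens c b (x, y) = c (.inr x) (.inr y) := by
  rw [← hb.sum_mul_splDof (fun i => c i (.inr y)) (.inr x)]
  refine Finset.sum_congr rfl fun i _ => ?_
  rw [← hb.sum_mul_splDof (c i) (.inr y), Finset.sum_mul]
  exact Finset.sum_congr rfl fun j _ => by simp [splDof]; ring

variable (hd : ∀ i, Differentiable ℝ (b i))

include hd

theorem tens_fderiv_row (e : Fin 2) (s : ℝ) :
    fderiv ℝ (tens c b) (s, ((e : ℕ) : ℝ)) (0, 1) = rowFun c b (1, e) s := by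
  rw [tens_fderiv c hd, zero_mul, zero_add, one_mul]
  refine Finset.sum_congr rfl fun i _ => ?_
  rw [← hb.sum_mul_splDof (c i) (.inl (1, e)), Finset.sum_mul]
  exact Finset.sum_congr rfl fun j _ => by simp [splDof]; ring

theorem tens_fderiv_col (e : Fin 2) (t : ℝ) :
    fderiv ℝ (tens c b) (((e : ℕ) : ℝ), t) (1, 0) = colFun c b (1, e) t := by
  rw [tens_fderiv c hd, zero_mul, add_zero, one_mul, Finset.sum_comm]
  refine Finset.sum_congr rfl fun j _ => ?_
  rw [← hb.sum_mul_splDof (fun i => c i j) (.inl (1, e)), Finset.sum_mul]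
  exact Finset.sum_congr rfl fun i _ => by simp [splDof]; ring

omit hb hd

/-- The trace on a side of the parameter square. -/
def sideTrace (b : (Fin 2 × Fin 2) ⊕ N → ℝ → ℝ) (i : Fin 4) (s : ℝ) : ℝ := tens c b (sidePt i s)

/-- The inward normal derivative on a side of the parameter square. -/
def sideFlux (b : (Fin 2 × Fin 2) ⊕ N → ℝ → ℝ) (i : Fin 4) (s : ℝ) : ℝ :=
  fderiv ℝ (tens c b) (sidePt i s) (sideNormal i)

-- The boundary of the square is traversed counter-clockwise: sides `2` and `3` run against the
-- coordinate, hence the reflections.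
include hb in
theorem sideTrace_eq : sideTrace c b 0 = rowFun c b (0, 0) ∧ sideTrace c b 1 = colFun c b (0, 1) ∧
    (sideTrace c b 2 = fun s => rowFun c b (0, 1) (1 - s)) ∧
    (sideTrace c b 3 = fun s => colFun c b (0, 0) (1 - s)) := by
  refine ⟨funext fun s => ?_, funext fun s => ?_, funext fun s => ?_, funext fun s => ?_⟩
  · rw [← tens_row c hb 0]
    simp [sideTrace, sidePt, sideBase, sideDir]
  · rw [← tens_col c hb 1]
    simp [sideTrace, sidePt, sideBase, sideDir]
  · rw [← tens_row c hb 1]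
    simp [sideTrace, sidePt, sideBase, sideDir, sub_eq_add_neg]
  · rw [← tens_col c hb 0]
    simp [sideTrace, sidePt, sideBase, sideDir, sub_eq_add_neg]

include hb hd in
theorem sideFlux_eq : sideFlux c b 0 = rowFun c b (1, 0) ∧
    (sideFlux c b 1 = fun s => - colFun c b (1, 1) s) ∧
    (sideFlux c b 2 = fun s => - rowFun c b (1, 1) (1 - s)) ∧
    (sideFlux c b 3 = fun s => colFun c b (1, 0) (1 - s)) := by
  have hneg : ∀ ξ, fderiv ℝ (tens c b) ξ (-1, 0) = - fderiv ℝ (tens c b) ξ (1, 0) := fun ξ => by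
    rw [← map_neg]
    simp
  have hneg' : ∀ ξ, fderiv ℝ (tens c b) ξ (0, -1) = - fderiv ℝ (tens c b) ξ (0, 1) := fun ξ => by
    rw [← map_neg]
    simp
  refine ⟨funext fun s => ?_, funext fun s => ?_, funext fun s => ?_, funext fun s => ?_⟩
  · rw [← tens_fderiv_row c hb hd 0]
    simp [sideFlux, sidePt, sideBase, sideDir, sideNormal]
  · rw [← tens_fderiv_col c hb hd 1, ← hneg]
    simp [sideFlux, sidePt, sideBase, sideDir, sideNormal]
  · rw [← tens_fderiv_row c hb hd 1, ← hneg']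
    simp [sideFlux, sidePt, sideBase, sideDir, sideNormal, sub_eq_add_neg]
  · rw [← tens_fderiv_col c hb hd 0]
    simp [sideFlux, sidePt, sideBase, sideDir, sideNormal, sub_eq_add_neg]

end Tensor

/-! ### Bounds for the coefficients and gluing -/

/-- The function and its derivative are bounded by `K` on `[0, 1]`. -/
def C1Bdd (K : ℝ) (u : ℝ → ℝ) : Prop := ∀ s ∈ Icc (0 : ℝ) 1, |u s| ≤ K ∧ |deriv u s| ≤ K

theorem C1Bdd.comp_one_sub {K : ℝ} {u : ℝ → ℝ} (h : C1Bdd K u) : C1Bdd K fun s => u (1 - s) := by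
  intro s hs
  have hs' : 1 - s ∈ Icc (0 : ℝ) 1 := ⟨by linarith [hs.2], by linarith [hs.1]⟩
  rw [deriv_comp_const_sub, abs_neg]
  exact h _ hs'

theorem C1Bdd.neg {K : ℝ} {u : ℝ → ℝ} (h : C1Bdd K u) : C1Bdd K fun s => - u s := by
  intro s hs
  rw [deriv.fun_neg, abs_neg, abs_neg]
  exact h s hs

theorem C1Bdd.abs_splDof_le {N : Set ℝ} (hN : N ⊆ Ioo 0 1) {K : ℝ} {u : ℝ → ℝ} (h : C1Bdd K u)
    (j : (Fin 2 × Fin 2) ⊕ N) : |splDof 2 N j u| ≤ K := by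
  rcases j with ⟨m, e⟩ | x
  · have he : ((e : ℕ) : ℝ) ∈ Icc (0 : ℝ) 1 := by fin_cases e <;> simp
    fin_cases m
    · exact (h _ he).1
    · exact (h _ he).2
  · exact (h x (Ioo_subset_Icc_self (hN x.2))).1

section Coef

variable {N : Set ℝ} [Fintype N] {b : (Fin 2 × Fin 2) ⊕ N → ℝ → ℝ}
  {W : Submodule ℝ (ℝ → ℝ)} (hb : IsSplDual 2 N W b) (hd : ∀ i, Differentiable ℝ (b i))

include hb hd

/-- Every entry outside the face block is an interpolation datum of a row or column function, and
these are the side traces and fluxes up to reflection and sign. -/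
theorem abs_coef_le (c : (Fin 2 × Fin 2) ⊕ N → (Fin 2 × Fin 2) ⊕ N → ℝ) (hN : N ⊆ Ioo 0 1) {K : ℝ}
    (htrace : ∀ i, C1Bdd K (sideTrace c b i)) (hflux : ∀ i, C1Bdd K (sideFlux c b i))
    (hface : ∀ x y : N, |tens c b (x, y)| ≤ K) (i j) : |c i j| ≤ K := by
  obtain ⟨t0, t1, t2, t3⟩ := sideTrace_eq c hb
  obtain ⟨f0, f1, f2, f3⟩ := sideFlux_eq c hb hd
  have hrow : ∀ me, C1Bdd K (rowFun c b me) := by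
    rintro ⟨m, e⟩
    fin_cases m <;> fin_cases e
    · exact t0 ▸ htrace 0
    · have := (htrace 2).comp_one_sub
      simp only [t2, sub_sub_cancel] at this
      exact this
    · exact f0 ▸ hflux 0
    · have := (hflux 2).comp_one_sub.neg
      simp only [f2, sub_sub_cancel, neg_neg] at this
      exact this
  have hcol : ∀ me, C1Bdd K (colFun c b me) := by
    rintro ⟨m, e⟩
    fin_cases m <;> fin_cases e
    · have := (htrace 3).comp_one_sub
      simp only [t3, sub_sub_cancel] at this
      exact this
    · exact t1 ▸ htrace 1
    · have := (hflux 3).comp_one_sub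
      simp only [f3, sub_sub_cancel] at this
      exact this
    · have := (hflux 1).neg
      simp only [f1, neg_neg] at this
      exact this
  rcases j with me | y
  · rw [← splDof_rowFun c hb]
    exact (hrow me).abs_splDof_le hN i
  · rcases i with me | x
    · rw [← splDof_colFun c hb]
      exact (hcol me).abs_splDof_le hN _
    · rw [← tens_face c hb]
      exact hface x y

/-- Traces and normal derivatives that are compatible at the corners, and values at the face points,
are attained by a tensor product function. -/
theorem exists_coef (hW : ∀ u ∈ W, (fun s => u (1 - s)) ∈ W) {u D : Fin 4 → ℝ → ℝ}
    (hu : ∀ i, u i ∈ W) (hD : ∀ i, D i ∈ W) (F : N → N → ℝ)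
    (hc1 : ∀ i, u i 0 = u (i - 1) 1) (hc2 : ∀ i, D i 0 = - deriv (u (i - 1)) 1)
    (hc3 : ∀ i, deriv (u i) 0 = D (i - 1) 1) (hc4 : ∀ i, deriv (D i) 0 = - deriv (D (i - 1)) 1) :
    ∃ c, (∀ i, sideTrace c b i = u i) ∧ (∀ i, sideFlux c b i = D i) ∧
      ∀ x y : N, tens c b (x, y) = F x y := by
  obtain ⟨h0, h1, h2, h3, -⟩ := ConvexQuad.fin4_arith
  -- `R` and `K` are the row and column functions that the traces and fluxes require, with
  -- orientation and sign adjusted to the coordinates.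
  let R : Fin 2 × Fin 2 → ℝ → ℝ := fun me => ![![u 0, fun s => u 2 (1 - s)],
    ![D 0, fun s => - D 2 (1 - s)]] me.1 me.2
  let K : Fin 2 × Fin 2 → ℝ → ℝ := fun me => ![![fun s => u 3 (1 - s), u 1],
    ![fun s => D 3 (1 - s), fun s => - D 1 s]] me.1 me.2
  have hR : ∀ me, R me ∈ W := by
    rintro ⟨m, e⟩
    fin_cases m <;> fin_cases e
    exacts [hu 0, hW _ (hu 2), hD 0, W.neg_mem (hW _ (hD 2))]
  have hK : ∀ me, K me ∈ W := by
    rintro ⟨m, e⟩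
    fin_cases m <;> fin_cases e
    exacts [hW _ (hu 3), hu 1, hW _ (hD 3), W.neg_mem (hD 1)]
  -- The block of entries with two end-point indices is prescribed twice, by rows and by columns;
  -- the sixteen equalities are the compatibility conditions at the four corners.
  have hcompat : ∀ me me', splDof 2 N (.inl me') (R me) = splDof 2 N (.inl me) (K me') := by
    have a0 := hc1 0
    have a1 := hc1 1
    have a2 := hc1 2
    have a3 := hc1 3
    have b0 := hc2 0
    have b1 := hc2 1
    have b2 := hc2 2
    have b3 := hc2 3
    have c0 := hc3 0
    have c1 := hc3 1
    have c2 := hc3 2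
    have c3 := hc3 3
    have d0 := hc4 0
    have d1 := hc4 1
    have d2 := hc4 2
    have d3 := hc4 3
    simp only [h0, h1, h2, h3] at a0 a1 a2 a3 b0 b1 b2 b3 c0 c1 c2 c3 d0 d1 d2 d3
    rintro ⟨m, e⟩ ⟨m', e'⟩
    fin_cases m <;> fin_cases e <;> fin_cases m' <;> fin_cases e' <;>
      simp [splDof, R, K, deriv_comp_const_sub] <;> linarith
  let c : (Fin 2 × Fin 2) ⊕ N → (Fin 2 × Fin 2) ⊕ N → ℝ := fun i j =>
    match j, i with
    | .inl me, i => splDof 2 N i (R me)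
    | .inr y, .inl me => splDof 2 N (.inr y) (K me)
    | .inr y, .inr x => F x y
  have hrow : ∀ me, rowFun c b me = R me := fun me => (hb.repr _ (hR me)).symm
  have hcol : ∀ me, colFun c b me = K me := by
    intro me
    rw [hb.repr _ (hK me)]
    ext t
    refine Finset.sum_congr rfl fun j _ => ?_
    congr 1
    rcases j with me' | y
    · exact hcompat me' me
    · rfl
  obtain ⟨t0, t1, t2, t3⟩ := sideTrace_eq c hb
  obtain ⟨f0, f1, f2, f3⟩ := sideFlux_eq c hb hd
  refine ⟨c, fun i => ?_, fun i => ?_, fun x y => tens_face c hb x y⟩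
  · fin_cases i
    · exact t0.trans (hrow _)
    · exact t1.trans (hcol _)
    · refine t2.trans ?_
      simp [hrow, R]
    · refine t3.trans ?_
      simp [hcol, K]
  · fin_cases i
    · exact f0.trans (hrow _)
    · refine f1.trans ?_
      simp [hcol, K]
    · refine f2.trans ?_
      simp [hrow, R]
    · refine f3.trans ?_
      simp [hcol, K]

end Coef

/-! ### Degrees of freedom and edge data -/

theorem deriv_eq_of_eqOn_Icc {f g : ℝ → ℝ} {g' s : ℝ} (h : EqOn f g (Icc 0 1))
    (hs : s ∈ Icc (0 : ℝ) 1) (hf : DifferentiableAt ℝ f s) (hg : HasDerivAt g g' s) :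
    deriv f s = g' :=
  (uniqueDiffOn_Icc one_pos s hs).eq_deriv _ hf.hasDerivAt.hasDerivWithinAt
    (hg.hasDerivWithinAt.congr h (h hs))

/-- The index of the starting point and of the end point of an edge. -/
def endIndex (i : Fin 4) (e : Fin 2) : Fin 4 := ![i, i + 1] e

theorem ConvexQuad.edgeParam_end (Q : ConvexQuad) (i : Fin 4) (e : Fin 2) :
    Q.edgeParam i ((e : ℕ) : ℝ) = Q.vertex (endIndex i e) := by
  fin_cases e <;> simp [edgeParam, endIndex]

theorem ConvexQuad.vertex_mem_closed (Q : ConvexQuad) (i : Fin 4) : Q.vertex i ∈ Q.closed :=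
  subset_convexHull ℝ _ (mem_range_self i)

theorem end_mem_Icc (e : Fin 2) : ((e : ℕ) : ℝ) ∈ Icc (0 : ℝ) 1 := by fin_cases e <;> simp

theorem plane_eq_sum (w : Plane) : w = w 0 • unitVec 0 + w 1 • unitVec 1 := by
  refine plane_ext ?_ ?_ <;> simp [unitVec]

section Data

variable {p : ℕ}

/-- The gradient at a vertex that is prescribed by the degrees of freedom. -/
def gradForm (d : Dof p → ℝ) (i : Fin 4) (w : Plane) : ℝ :=
  w 0 * d (.grad i 0) + w 1 * d (.grad i 1)

/-- The Hessian at a vertex that is prescribed by the degrees of freedom. -/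
def hessForm (d : Dof p → ℝ) (i : Fin 4) (w z : Plane) : ℝ :=
  w 0 * z 0 * d (.hess i ⟨(0, 0), le_rfl⟩) +
    (w 0 * z 1 + w 1 * z 0) * d (.hess i ⟨(0, 1), zero_le_one⟩) +
    w 1 * z 1 * d (.hess i ⟨(1, 1), le_rfl⟩)

/-- The interpolation data for the trace on an edge. -/
def edgeData (Q : ConvexQuad) (d : Dof p → ℝ) (i : Fin 4) :
    (Fin 3 × Fin 2) ⊕ edgeValueNodes p → ℝ
  | .inl (m, e) => ![d (.value (endIndex i e)), gradForm d (endIndex i e) (Q.edge i),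
      hessForm d (endIndex i e) (Q.edge i) (Q.edge i)] m
  | .inr x => d (.edgeValue i x)

/-- The interpolation data for the normal derivative on an edge. -/
def normalData (Q : ConvexQuad) (n : Fin 4 → Plane) (d : Dof p → ℝ) (i : Fin 4) :
    (Fin 2 × Fin 2) ⊕ edgeNormalNodes p → ℝ
  | .inl (m, e) => ![gradForm d (endIndex i e) (n i),
      hessForm d (endIndex i e) (Q.edge i) (n i)] m
  | .inr x => d (.edgeNormal i x)

theorem gradForm_add (d : Dof p → ℝ) (i : Fin 4) (w z : Plane) :
    gradForm d i (w + z) = gradForm d i w + gradForm d i z := by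
  simp only [gradForm, PiLp.add_apply]
  ring

theorem gradForm_smul (d : Dof p → ℝ) (i : Fin 4) (a : ℝ) (w : Plane) :
    gradForm d i (a • w) = a * gradForm d i w := by
  simp only [gradForm, PiLp.smul_apply, smul_eq_mul]
  ring

theorem hessForm_add (d : Dof p → ℝ) (i : Fin 4) (x w z : Plane) :
    hessForm d i x (w + z) = hessForm d i x w + hessForm d i x z := by
  simp only [hessForm, PiLp.add_apply]
  ring

theorem hessForm_smul (d : Dof p → ℝ) (i : Fin 4) (a : ℝ) (x w : Plane) :
    hessForm d i x (a • w) = a * hessForm d i x w := by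
  simp only [hessForm, PiLp.smul_apply, smul_eq_mul]
  ring

theorem hessForm_comm (d : Dof p → ℝ) (i : Fin 4) (w z : Plane) :
    hessForm d i w z = hessForm d i z w := by
  simp only [hessForm]
  ring

theorem hessForm_add_left (d : Dof p → ℝ) (i : Fin 4) (w z x : Plane) :
    hessForm d i (w + z) x = hessForm d i w x + hessForm d i z x := by
  simp only [hessForm, PiLp.add_apply]
  ring

theorem hessForm_smul_left (d : Dof p → ℝ) (i : Fin 4) (a : ℝ) (w x : Plane) :
    hessForm d i (a • w) x = a * hessForm d i w x := by
  simp only [hessForm, PiLp.smul_apply, smul_eq_mul]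
  ring

theorem gradForm_unitVec (d : Dof p → ℝ) (i : Fin 4) (a : Fin 2) :
    gradForm d i (unitVec a) = d (.grad i a) := by
  fin_cases a <;> simp [gradForm, unitVec]

theorem hessForm_unitVec (d : Dof p → ℝ) (i : Fin 4) (ab : {ab : Fin 2 × Fin 2 // ab.1 ≤ ab.2}) :
    hessForm d i (unitVec ab.1.1) (unitVec ab.1.2) = d (.hess i ab) := by
  obtain ⟨⟨a, b⟩, hab⟩ := ab
  fin_cases a <;> fin_cases b
  · simp [hessForm, unitVec]
  · simp [hessForm, unitVec]
  · exact absurd hab (by decide)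
  · simp [hessForm, unitVec]

variable {Q : ConvexQuad} {n : Fin 4 → Plane}

theorem exists_eq_smul_add {u w : Plane} (h : det2 u w ≠ 0) (z : Plane) :
    ∃ x y : ℝ, z = x • u + y • w := by
  refine ⟨det2 z w / det2 u w, det2 u z / det2 u w, ?_⟩
  have h1 := congrArg (fun v => (det2 u w)⁻¹ • v) (det2_smul_eq u w z)
  simp only [smul_smul, inv_mul_cancel₀ h, one_smul, smul_add] at h1
  rw [div_eq_inv_mul, div_eq_inv_mul]
  exact h1

/-- The edge data and the values at the face points determine the degrees of freedom. -/
theorem dof_ext (hn : Q.IsUnitNormal n) {d d' : Dof p → ℝ}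
    (he : ∀ i, edgeData Q d i = edgeData Q d' i)
    (hn' : ∀ i, normalData Q n d i = normalData Q n d' i)
    (hf : ∀ x y, d (.face x y) = d' (.face x y)) : d = d' := by
  have hv : ∀ i, d (.value i) = d' (.value i) := fun i => congrFun (he i) (.inl (0, 0))
  have hg : ∀ i w, gradForm d i w = gradForm d' i w := by
    intro i w
    obtain ⟨x, y, rfl⟩ := exists_eq_smul_add (ConvexQuad.det2_edge_normal_ne_zero hn i) w
    have h1 : gradForm d i (Q.edge i) = gradForm d' i (Q.edge i) := congrFun (he i) (.inl (1, 0))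
    have h2 : gradForm d i (n i) = gradForm d' i (n i) := congrFun (hn' i) (.inl (0, 0))
    simp only [gradForm_add, gradForm_smul, h1, h2]
  have hh : ∀ i w z, hessForm d i w z = hessForm d' i w z := by
    intro i w z
    have h1 : hessForm d i (Q.edge i) (Q.edge i) = hessForm d' i (Q.edge i) (Q.edge i) :=
      congrFun (he i) (.inl (2, 0))
    have h2 : hessForm d i (Q.edge i) (n i) = hessForm d' i (Q.edge i) (n i) :=
      congrFun (hn' i) (.inl (1, 0))
    have h3 : hessForm d i (Q.edge (i - 1)) (Q.edge (i - 1)) =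
        hessForm d' i (Q.edge (i - 1)) (Q.edge (i - 1)) := by
      have := congrFun (he (i - 1)) (.inl (2, 1))
      simpa [edgeData, endIndex] using this
    -- The second normal derivative is no datum of edge `i`. It is recovered from the second
    -- tangential derivative along the other edge at the vertex, whose normal component `y` is
    -- nonzero because the two edges are not parallel.
    have h4 : hessForm d i (n i) (n i) = hessForm d' i (n i) (n i) := by
      have h5 := Q.corner_pos i
      have h6 : Q.corner i = det2 (Q.edge (i - 1)) (Q.edge i) := by
        rw [ConvexQuad.corner, ConvexQuad.edge, ConvexQuad.edge, sub_add_cancel]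
      rw [h6] at h5
      obtain ⟨x, y, hxy⟩ := exists_eq_smul_add (ConvexQuad.det2_edge_normal_ne_zero hn i)
        (Q.edge (i - 1))
      rw [hxy] at h3 h5
      have hy : y ≠ 0 := by
        rintro rfl
        simp only [det2_apply, PiLp.add_apply, PiLp.smul_apply, smul_eq_mul] at h5
        ring_nf at h5
        exact lt_irrefl _ h5
      simp only [hessForm_add, hessForm_smul, hessForm_add_left, hessForm_smul_left,
        hessForm_comm _ i (n i) (Q.edge i), h1, h2] at h3
      have h7 : y * (y * hessForm d i (n i) (n i)) = y * (y * hessForm d' i (n i) (n i)) := by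
        linarith
      exact mul_left_cancel₀ hy (mul_left_cancel₀ hy h7)
    obtain ⟨x, y, rfl⟩ := exists_eq_smul_add (ConvexQuad.det2_edge_normal_ne_zero hn i) w
    obtain ⟨x', y', rfl⟩ := exists_eq_smul_add (ConvexQuad.det2_edge_normal_ne_zero hn i) z
    simp only [hessForm_add, hessForm_smul, hessForm_add_left, hessForm_smul_left,
        hessForm_comm _ i (n i) (Q.edge i), h1, h2, h4]
  funext l
  cases l with
  | value i => exact hv i
  | grad i a => rw [← gradForm_unitVec d, hg, gradForm_unitVec]
  | hess i ab => rw [← hessForm_unitVec d, hh, hessForm_unitVec]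
  | edgeValue i s => exact congrFun (he i) (.inr s)
  | edgeNormal i s => exact congrFun (hn' i) (.inr s)
  | face s t => exact hf s t

end Data

/-- The function `φ` agrees with `f` on the closed quadrilateral, is differentiable there and of
class `C²` near the vertices. -/
structure SmoothExt (Q : ConvexQuad) (f φ : Plane → ℝ) : Prop where
  eqOn : EqOn f φ Q.closed
  differentiableAt : ∀ x ∈ Q.closed, DifferentiableAt ℝ φ x
  contDiffAt : ∀ i, ContDiffAt ℝ 2 φ (Q.vertex i)

namespace SmoothExt

variable {p : ℕ} {Q : ConvexQuad} {n : Fin 4 → Plane} {f φ : Plane → ℝ} (h : SmoothExt Q f φ)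

include h

theorem eqOn_dirDeriv (w : Plane) : EqOn (Q.dirDeriv w f) (fun x => fderiv ℝ φ x w) Q.closed :=
  fun x hx => Q.dirDeriv_eq h.eqOn hx (h.differentiableAt x hx) w

theorem differentiableAt_fderiv (i : Fin 4) : DifferentiableAt ℝ (fderiv ℝ φ) (Q.vertex i) :=
  ((h.contDiffAt i).fderiv_right (m := 1) (by norm_num)).differentiableAt (by simp)

theorem gradForm_eq (i : Fin 4) (w : Plane) :
    gradForm (p := p) (Dof.eval Q n f) i w = fderiv ℝ φ (Q.vertex i) w := by
  conv_rhs => rw [plane_eq_sum w, map_add, map_smul, map_smul]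
  have h1 := h.eqOn_dirDeriv (unitVec 0) (Q.vertex_mem_closed i)
  have h2 := h.eqOn_dirDeriv (unitVec 1) (Q.vertex_mem_closed i)
  simp only [gradForm, Dof.eval, h1, h2, smul_eq_mul]

theorem dirDeriv_dirDeriv_eq (i : Fin 4) (w z : Plane) :
    Q.dirDeriv w (Q.dirDeriv z f) (Q.vertex i) = fderiv ℝ (fderiv ℝ φ) (Q.vertex i) w z := by
  have h1 := (h.differentiableAt_fderiv i).hasFDerivAt.clm_apply
    (hasFDerivAt_const z (Q.vertex i))
  rw [Q.dirDeriv_eq (h.eqOn_dirDeriv z) (Q.vertex_mem_closed i) h1.differentiableAt, h1.fderiv]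
  simp

theorem hessForm_eq (i : Fin 4) (w z : Plane) :
    hessForm (p := p) (Dof.eval Q n f) i w z = fderiv ℝ (fderiv ℝ φ) (Q.vertex i) w z := by
  -- Only `∂_1 ∂_2` is a degree of freedom; `∂_2 ∂_1` is supplied by symmetry of the second
  -- derivative of a `C²` function.
  have hs : ∀ w z, fderiv ℝ (fderiv ℝ φ) (Q.vertex i) w z =
      fderiv ℝ (fderiv ℝ φ) (Q.vertex i) z w := fun w z =>
    ((h.contDiffAt i).isSymmSndFDerivAt (by simp)).eq w z
  conv_rhs => rw [plane_eq_sum w, plane_eq_sum z]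
  simp only [hessForm, Dof.eval, h.dirDeriv_dirDeriv_eq, map_add, map_smul,
    add_apply, smul_apply, smul_eq_mul,
    hs (unitVec 1) (unitVec 0)]
  ring

theorem hasDerivAt_edge (i : Fin 4) {s : ℝ} (hs : s ∈ Icc (0 : ℝ) 1) :
    HasDerivAt (fun s => φ (Q.edgeParam i s)) (fderiv ℝ φ (Q.edgeParam i s) (Q.edge i)) s :=
  (h.differentiableAt _ (Q.edgeParam_mem_closed i hs)).hasFDerivAt.comp_hasDerivAt s
    (Q.hasDerivAt_edgeParam i s)

theorem hasDerivAt_fderiv_edge (i : Fin 4) (e : Fin 2) (w : Plane) :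
    HasDerivAt (fun s => fderiv ℝ φ (Q.edgeParam i s) w)
      (hessForm (p := p) (Dof.eval Q n f) (endIndex i e) (Q.edge i) w) ((e : ℕ) : ℝ) := by
  have h1 := (h.differentiableAt_fderiv (endIndex i e)).hasFDerivAt
  rw [← Q.edgeParam_end i e] at h1
  have h2 := (h1.comp_hasDerivAt _ (Q.hasDerivAt_edgeParam i _)).clm_apply
    (hasDerivAt_const ((e : ℕ) : ℝ) w)
  refine h2.congr_deriv ?_
  rw [h.hessForm_eq]
  simp [Q.edgeParam_end i e]

/-- The edge is parametrized affinely, so by the chain rule the end derivatives of the trace are the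
gradient and the Hessian in the direction of the edge vector, without further terms. -/
theorem splDof_trace {i : Fin 4} {u : ℝ → ℝ}
    (hu : EqOn u (fun s => φ (Q.edgeParam i s)) (Icc 0 1)) (hd : Differentiable ℝ u)
    (hd' : ∀ e : Fin 2, DifferentiableAt ℝ (deriv u) ((e : ℕ) : ℝ)) (j) :
    splDof 3 (edgeValueNodes p) j u = edgeData Q (Dof.eval Q n f) i j := by
  have h1 : EqOn (deriv u) (fun s => fderiv ℝ φ (Q.edgeParam i s) (Q.edge i)) (Icc 0 1) :=
    fun s hs => deriv_eq_of_eqOn_Icc hu hs (hd s) (h.hasDerivAt_edge i hs)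
  rcases j with ⟨m, e⟩ | x
  · have h2 := hu (end_mem_Icc e)
    have h3 := h1 (end_mem_Icc e)
    have h4 := deriv_eq_of_eqOn_Icc h1 (end_mem_Icc e) (hd' e)
      (h.hasDerivAt_fderiv_edge (p := p) (n := n) i e (Q.edge i))
    simp only [Q.edgeParam_end] at h2 h3
    rw [← h.eqOn (Q.vertex_mem_closed _)] at h2
    rw [← h.gradForm_eq (p := p) (n := n)] at h3
    fin_cases m
    · exact h2
    · exact h3
    · exact h4
  · have hx := Ioo_subset_Icc_self (edgeValueNodes_subset p x.2)
    exact (hu hx).trans (h.eqOn (Q.edgeParam_mem_closed i hx)).symm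

theorem splDof_normal {i : Fin 4} {v : ℝ → ℝ}
    (hv : EqOn v (fun s => fderiv ℝ φ (Q.edgeParam i s) (n i)) (Icc 0 1))
    (hd : Differentiable ℝ v) (j) :
    splDof 2 (edgeNormalNodes p) j v = normalData Q n (Dof.eval Q n f) i j := by
  rcases j with ⟨m, e⟩ | x
  · have h3 := hv (end_mem_Icc e)
    have h4 := deriv_eq_of_eqOn_Icc hv (end_mem_Icc e) (hd _)
      (h.hasDerivAt_fderiv_edge (p := p) (n := n) i e (n i))
    simp only [Q.edgeParam_end] at h3
    rw [← h.gradForm_eq (p := p) (n := n)] at h3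
    fin_cases m
    · exact h3
    · exact h4
  · have hx := Ioo_subset_Icc_self (edgeNormalNodes_subset p x.2)
    exact (hv hx).trans (h.eqOn_dirDeriv (n i) (Q.edgeParam_mem_closed i hx)).symm

end SmoothExt

/-! ### Functions in the local space as tensor product splines -/

theorem numSub_pos (p : ℕ) : 0 < numSub p := by
  rw [numSub]
  omega

theorem le_four_of_one_lt_numSub {p : ℕ} (h : 1 < numSub p) : p ≤ 4 := by
  rw [numSub] at h
  omega

theorem mem_subInterval {k : ℕ} {a : Fin k} {s : ℝ} (hs : s ∈ Icc (0 : ℝ) 1)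
    (ha : s ∈ linePiece k a) : s ∈ subInterval k a := by
  have hk : (0 : ℝ) < k := by exact_mod_cast (Nat.zero_le _).trans_lt a.2
  constructor
  · rcases Nat.eq_zero_or_pos (a : ℕ) with h | h
    · rw [h, Nat.cast_zero, zero_div]
      exact hs.1
    · exact ha.1 h
  · rcases Nat.lt_or_ge ((a : ℕ) + 1) k with h | h
    · exact ha.2 h
    · refine hs.2.trans ((one_le_div hk).2 ?_)
      exact_mod_cast h

theorem subInterval_subset_linePiece {k : ℕ} (a : Fin k) : subInterval k a ⊆ linePiece k a :=
  fun _ hs => ⟨fun _ => hs.1, fun _ => hs.2⟩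

theorem subInterval_subset_Icc {k : ℕ} (a : Fin k) : subInterval k a ⊆ Icc 0 1 := by
  intro s hs
  have hk : (0 : ℝ) < k := by exact_mod_cast (Nat.zero_le _).trans_lt a.2
  refine ⟨le_trans (by positivity) hs.1, hs.2.trans ((div_le_one hk).2 ?_)⟩
  exact_mod_cast a.2

theorem exists_polynomial_of_sum {p : ℕ} (c : Fin (p + 1) → ℝ) :
    ∃ P : ℝ[X], P.natDegree ≤ p ∧ ∀ s, P.eval s = ∑ i, c i * s ^ (i : ℕ) := by
  refine ⟨∑ i, C (c i) * X ^ (i : ℕ), ?_, fun s => by simp [eval_finsetSum]⟩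
  exact natDegree_sum_le_of_forall_le _ _ fun i _ =>
    (natDegree_C_mul_X_pow_le _ _).trans (Nat.lt_succ_iff.1 i.2)

theorem eval_eq_sum_fin {p : ℕ} {P : ℝ[X]} (h : P.natDegree ≤ p) (s : ℝ) :
    P.eval s = ∑ m : Fin (p + 1), P.coeff m * s ^ (m : ℕ) := by
  rw [eval_eq_sum_range' (Nat.lt_succ_of_le h), Finset.sum_range]

theorem MemSpace.isPiecewise {p : ℕ} {Q : ConvexQuad} {n : Fin 4 → Plane} {f : Plane → ℝ}
    (hf : MemSpace p Q n f) :
    (∀ t ∈ Icc (0 : ℝ) 1, IsPiecewise (numSub p) p (Icc 0 1) fun s => f (Q.param s t)) ∧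
      ∀ s ∈ Icc (0 : ℝ) 1, IsPiecewise (numSub p) p (Icc 0 1) fun t => f (Q.param s t) := by
  constructor
  · intro t ht a
    obtain ⟨b, hb, htb⟩ := exists_mem_linePiece (numSub_pos p) t
    obtain ⟨c, hc⟩ := hf.poly a ⟨b, hb⟩
    obtain ⟨P, hP, hPe⟩ := exists_polynomial_of_sum fun i => ∑ j, c i j * t ^ (j : ℕ)
    refine ⟨P, hP, fun s hs hsa => ?_⟩
    refine (hc s (mem_subInterval hs hsa) t (mem_subInterval ht htb)).trans ?_
    rw [hPe]
    simp only [Finset.sum_mul]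
    exact Finset.sum_congr rfl fun i _ => Finset.sum_congr rfl fun j _ => by ring
  · intro s hs b
    obtain ⟨a, ha, hsa⟩ := exists_mem_linePiece (numSub_pos p) s
    obtain ⟨c, hc⟩ := hf.poly ⟨a, ha⟩ b
    obtain ⟨P, hP, hPe⟩ := exists_polynomial_of_sum fun j => ∑ i, c i j * s ^ (i : ℕ)
    refine ⟨P, hP, fun t ht htb => ?_⟩
    refine (hc s (mem_subInterval hs hsa) t (mem_subInterval ht htb)).trans ?_
    rw [hPe, Finset.sum_comm]
    simp only [Finset.sum_mul]

theorem edgeSpl_deriv_mem {p : ℕ} (hp : 3 ≤ p) {u : ℝ → ℝ} (hu : u ∈ EdgeSpl p) :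
    deriv u ∈ NormalSpl p := by
  obtain ⟨q, rfl⟩ : ∃ q, p = q + 3 := ⟨p - 3, by omega⟩
  exact Spl.deriv_mem (numSub_pos _) hu

theorem normalSpl_affine_mul {p : ℕ} (hp : 3 ≤ p) {v : ℝ → ℝ} (hv : v ∈ NormalSpl p) (x y : ℝ) :
    (fun s => ((1 - s) * x + s * y) * v s) ∈ FaceSpl p := by
  obtain ⟨q, rfl⟩ : ∃ q, p = q + 3 := ⟨p - 3, by omega⟩
  exact Spl.affine_mul (numSub_pos _) hv x y

section Lift

variable {p : ℕ} (hp : 3 ≤ p) [Fintype (faceNodes p)]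
  {b : (Fin 2 × Fin 2) ⊕ faceNodes p → ℝ → ℝ} (hb : IsSplDual 2 (faceNodes p) (FaceSpl p) b)
  (Q : ConvexQuad) (c : (Fin 2 × Fin 2) ⊕ faceNodes p → (Fin 2 × Fin 2) ⊕ faceNodes p → ℝ)

/-- The tensor product function as a function on the quadrilateral. -/
def lift (b : (Fin 2 × Fin 2) ⊕ faceNodes p → ℝ → ℝ) (x : Plane) : ℝ := tens c b (Q.toSquare x)

theorem lift_toPlane {ξ : ℝ × ℝ} (hξ : ξ ∈ ConvexQuad.square) :
    lift Q c b (Q.toPlane ξ) = tens c b ξ := by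
  rw [lift, Q.toSquare_toPlane (Q.square_subset_regular hξ)]

theorem lift_edgeParam (i : Fin 4) {s : ℝ} (hs : s ∈ Icc (0 : ℝ) 1) :
    lift Q c b (Q.edgeParam i s) = sideTrace c b i s := by
  rw [← Q.toPlane_sidePt, lift_toPlane Q c (sidePt_mem i hs), sideTrace]

include hb

theorem basis_contDiff (i) : ContDiff ℝ (p - 2 : ℕ) (b i) := Spl.contDiff (hb.mem i)

theorem sideTrace_mem_faceSpl (i : Fin 4) : sideTrace c b i ∈ FaceSpl p := by
  obtain ⟨t0, t1, t2, t3⟩ := sideTrace_eq c hb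
  fin_cases i
  · exact t0 ▸ rowFun_mem c hb _
  · exact t1 ▸ colFun_mem c hb _
  · exact t2 ▸ Spl.comp_one_sub (numSub_pos p) (rowFun_mem c hb _)
  · exact t3 ▸ Spl.comp_one_sub (numSub_pos p) (colFun_mem c hb _)

include hp

theorem basis_differentiable (i) : Differentiable ℝ (b i) :=
  (basis_contDiff hb i).differentiable (by
    have : p - 2 ≠ 0 := by omega
    exact_mod_cast this)

theorem sideFlux_mem_faceSpl (i : Fin 4) : sideFlux c b i ∈ FaceSpl p := by
  obtain ⟨t0, t1, t2, t3⟩ := sideFlux_eq c hb (basis_differentiable hp hb)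
  fin_cases i
  · exact t0 ▸ rowFun_mem c hb _
  · exact t1 ▸ (FaceSpl p).neg_mem (colFun_mem c hb _)
  · exact t2 ▸ (FaceSpl p).neg_mem (Spl.comp_one_sub (numSub_pos p) (rowFun_mem c hb _))
  · exact t3 ▸ Spl.comp_one_sub (numSub_pos p) (colFun_mem c hb _)

/-- At a vertex both parameters are `0` or `1`, where splines have no knots; this yields `C²`
regularity there even for `p = 3`. -/
theorem smoothExt_lift {f : Plane → ℝ} (hf : EqOn f (lift Q c b) Q.closed) :
    SmoothExt Q f (lift Q c b) where
  eqOn := hf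
  differentiableAt x hx := by
    obtain ⟨ξ, hξ, rfl⟩ := Q.exists_of_mem_closed hx
    exact Q.differentiableAt_comp_toSquare (Q.square_subset_regular hξ)
      (tens_hasFDerivAt c (basis_differentiable hp hb) ξ).differentiableAt
  contDiffAt i := by
    have h0 : (0 : ℝ) ∈ Icc (0 : ℝ) 1 := by simp
    have h1 : Q.vertex i = Q.toPlane (sidePt i 0) := by simp [Q.toPlane_sidePt, ConvexQuad.edgeParam]
    rw [h1]
    refine Q.contDiffAt_comp_toSquare (Q.square_subset_regular (sidePt_mem i h0))
      (tens_contDiffAt c (fun j => ?_) fun j => ?_)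
    · fin_cases i <;> simp only [sidePt, zero_smul, add_zero]
      exacts [Spl.contDiffAt_zero (numSub_pos p) (hb.mem j) _,
        Spl.contDiffAt_one (numSub_pos p) (hb.mem j) _,
        Spl.contDiffAt_one (numSub_pos p) (hb.mem j) _,
        Spl.contDiffAt_zero (numSub_pos p) (hb.mem j) _]
    · fin_cases i <;> simp only [sidePt, zero_smul, add_zero]
      exacts [Spl.contDiffAt_zero (numSub_pos p) (hb.mem j) _,
        Spl.contDiffAt_zero (numSub_pos p) (hb.mem j) _,
        Spl.contDiffAt_one (numSub_pos p) (hb.mem j) _,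
        Spl.contDiffAt_one (numSub_pos p) (hb.mem j) _]

theorem sideTrace_differentiable (i : Fin 4) : Differentiable ℝ (sideTrace c b i) :=
  (Spl.contDiff (sideTrace_mem_faceSpl hb c i)).differentiable (by
    have : p - 2 ≠ 0 := by omega
    exact_mod_cast this)

theorem fderiv_lift_edge (i : Fin 4) {s : ℝ} (hs : s ∈ Icc (0 : ℝ) 1) :
    fderiv ℝ (lift Q c b) (Q.edgeParam i s) (Q.edge i) = deriv (sideTrace c b i) s :=
  (deriv_eq_of_eqOn_Icc (fun _ hs => (lift_edgeParam Q c i hs).symm) hs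
    (sideTrace_differentiable hp hb c i s)
    ((smoothExt_lift hp hb Q c fun _ _ => rfl).hasDerivAt_edge i hs)).symm

theorem fderiv_lift_inward (i : Fin 4) {s : ℝ} (hs : s ∈ Icc (0 : ℝ) 1) :
    fderiv ℝ (lift Q c b) (Q.edgeParam i s) (Q.inward i s) = sideFlux c b i s := by
  rw [sideFlux, Q.fderiv_eq_fderiv_comp_toSquare (Q.square_subset_regular (sidePt_mem i hs))
    (tens_hasFDerivAt c (basis_differentiable hp hb) _).differentiableAt, Q.dToPlane_sideNormal,
    Q.toPlane_sidePt]
  rfl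

variable {Q c} {n : Fin 4 → Plane} (hn : Q.IsUnitNormal n)

include hn

theorem sideFlux_eq_normal_add_edge (i : Fin 4) {s : ℝ} (hs : s ∈ Icc (0 : ℝ) 1) :
    sideFlux c b i s = Q.normalCoef n i s * fderiv ℝ (lift Q c b) (Q.edgeParam i s) (n i) +
      Q.edgeCoef i s * deriv (sideTrace c b i) s := by
  rw [← fderiv_lift_inward hp hb Q c i hs, ConvexQuad.inward_eq hn, map_add, map_smul, map_smul,
    fderiv_lift_edge hp hb Q c i hs, smul_eq_mul, smul_eq_mul]

theorem eqOn_fderiv_normal {i : Fin 4} {v : ℝ → ℝ}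
    (hv : ∀ s ∈ Icc (0 : ℝ) 1, sideFlux c b i s =
      Q.normalCoef n i s * v s + Q.edgeCoef i s * deriv (sideTrace c b i) s) :
    EqOn v (fun s => fderiv ℝ (lift Q c b) (Q.edgeParam i s) (n i)) (Icc 0 1) := by
  intro s hs
  have h1 := (hv s hs).symm.trans (sideFlux_eq_normal_add_edge hp hb hn i hs)
  exact mul_left_cancel₀ (ConvexQuad.normalCoef_ne_zero hn i hs) (add_right_cancel h1)

omit hn
variable {f : Plane → ℝ} (hf : MemSpace p Q n f)

include hf

-- The parametrization is polynomial and maps the open square into the open quadrilateral, so the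
-- slices inherit the smoothness of `f`; it is needed only if there are interior knots.
omit hp in
theorem MemSpace.exists_lift : ∃ c, EqOn f (lift Q c b) Q.closed := by
  have hin : ∀ s ∈ Ioo (0 : ℝ) 1, ∀ t ∈ Ioo (0 : ℝ) 1, Q.param s t ∈ Q.inner := fun s hs t ht =>
    Q.toPlane_mem_inner (ξ := (s, t)) hs ht
  obtain ⟨c, hc⟩ := hb.exists_tensor (numSub_pos p) (g := fun s t => f (Q.param s t))
    hf.isPiecewise.1 hf.isPiecewise.2
    (fun h t ht => by
      have h1 : ContDiffOn ℝ (p - 2 : ℕ) f Q.inner := hf.smooth (le_four_of_one_lt_numSub h)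
      refine h1.comp (ContDiff.contDiffOn ?_) fun s hs => hin s hs t ht
      unfold ConvexQuad.param
      fun_prop)
    (fun h s hs => by
      have h1 : ContDiffOn ℝ (p - 2 : ℕ) f Q.inner := hf.smooth (le_four_of_one_lt_numSub h)
      refine h1.comp (ContDiff.contDiffOn ?_) fun t ht => hin s hs t ht
      unfold ConvexQuad.param
      fun_prop)
  refine ⟨c, fun x hx => ?_⟩
  obtain ⟨ξ, hξ, rfl⟩ := Q.exists_of_mem_closed hx
  rw [lift_toPlane Q c hξ]
  exact hc _ hξ.1 _ hξ.2

variable (hfc : EqOn f (lift Q c b) Q.closed)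

include hfc

-- The trace of a tensor product function is only of class `C^{p-2}` in general; the additional
-- order is the `trace` condition of the space.
omit hp in
theorem MemSpace.sideTrace_mem (i : Fin 4) : sideTrace c b i ∈ EdgeSpl p := by
  have h0 := sideTrace_mem_faceSpl hb c i
  obtain ⟨u, hu, h⟩ := exists_spl_eqOn_Icc (r := p - 1) (numSub_pos p)
    (Spl.isPiecewise h0 (Icc 0 1)) fun h => by
      have h1 : ContDiffOn ℝ (p - 1 : ℕ) (fun s => f (Q.edgeParam i s)) (Ioo 0 1) :=
        hf.trace (le_four_of_one_lt_numSub h) i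
      refine h1.congr fun s hs => ?_
      have hs' := Ioo_subset_Icc_self hs
      rw [hfc (Q.edgeParam_mem_closed i hs'), lift_edgeParam Q c i hs']
  rwa [Spl.eq_of_eqOn (numSub_pos p) h0 hu (h.mono Ioo_subset_Icc_self)]

include hn

/-- The space prescribes that the normal derivative is piecewise polynomial of degree `p - 1`, but
not that it is smooth at the knots. Smoothness follows by solving the affine relation for it: flux
and tangential derivative are of class `C^{p-2}`, and the coefficient of the normal derivative has
no zero. -/
theorem MemSpace.exists_normal (i : Fin 4) : ∃ v ∈ NormalSpl p, ∀ s, sideFlux c b i s =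
      Q.normalCoef n i s * v s + Q.edgeCoef i s * deriv (sideTrace c b i) s := by
  have hD := sideFlux_mem_faceSpl hp hb c i
  have hu := edgeSpl_deriv_mem hp (hf.sideTrace_mem hb hfc i)
  have hs := smoothExt_lift hp hb Q c hfc
  obtain ⟨v, hv, h⟩ := exists_spl_eqOn (d := p - 1) (r := p - 2) (Z := Ioo 0 1)
    (u := fun s => Q.dirDeriv (n i) f (Q.edgeParam i s)) (numSub_pos p) isOpen_Ioo
    (fun m h0 h1 => div_nat_mem_Ioo h0 h1)
    (fun a => by
      obtain ⟨P, hP, h⟩ := hf.normal i a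
      exact ⟨P, hP, fun s hs hsa =>
        h s ⟨mem_subInterval (Ioo_subset_Icc_self hs) hsa, hs⟩⟩)
    (fun _ => by
      have h1 : ContDiffOn ℝ (p - 2 : ℕ) (fun s => (sideFlux c b i s -
          Q.edgeCoef i s * deriv (sideTrace c b i) s) / Q.normalCoef n i s) (Ioo 0 1) := by
        refine ContDiffOn.div ?_ ?_ fun s hs =>
          ConvexQuad.normalCoef_ne_zero hn i (Ioo_subset_Icc_self hs)
        · refine ((Spl.contDiff hD).sub (ContDiff.mul ?_ (Spl.contDiff hu))).contDiffOn
          unfold ConvexQuad.edgeCoef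
          fun_prop
        · refine ContDiff.contDiffOn ?_
          unfold ConvexQuad.normalCoef
          fun_prop
      refine h1.congr fun s hs' => ?_
      have hs1 := Ioo_subset_Icc_self hs'
      rw [hs.eqOn_dirDeriv (n i) (Q.edgeParam_mem_closed i hs1),
        sideFlux_eq_normal_add_edge hp hb hn i hs1, add_sub_cancel_right,
        mul_div_cancel_left₀ _ (ConvexQuad.normalCoef_ne_zero hn i hs1)])
  -- Both sides are splines in `FaceSpl`, so agreement on `(0, 1)` extends to the whole line.
  refine ⟨v, hv, fun s => congrFun (Spl.eq_of_eqOn (numSub_pos p) hD ((FaceSpl p).add_mem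
    (normalSpl_affine_mul hp hv _ _) (normalSpl_affine_mul hp hu _ _)) fun s hs' => ?_) s⟩
  have hs1 := Ioo_subset_Icc_self hs'
  rw [sideFlux_eq_normal_add_edge hp hb hn i hs1]
  have h2 := h hs'
  simp only [hs.eqOn_dirDeriv (n i) (Q.edgeParam_mem_closed i hs1)] at h2
  rw [h2]
  rfl

end Lift

/-! ### Existence of functions with given degrees of freedom -/

namespace ConvexQuad

variable (Q : ConvexQuad)

theorem inward_zero (i : Fin 4) : Q.inward i 0 = - Q.edge (i - 1) := by
  simp [inward, edge]

theorem inward_pred_one (i : Fin 4) : Q.inward (i - 1) 1 = Q.edge i := by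
  have h : i - 1 + 2 = i + 1 := by fin_cases i <;> decide
  simp [inward, edge, h]

/-- Up to sign, both differences are the alternating sum of the vertices, that is, the mixed
derivative of the parametrization. -/
theorem inward_one_sub_zero (i : Fin 4) : Q.inward i 1 - Q.inward i 0 =
    - (Q.inward (i - 1) 1 - Q.inward (i - 1) 0) := by
  have h : i - 1 + 2 = i + 1 := by fin_cases i <;> decide
  have h' : i - 1 - 1 = i + 2 := by fin_cases i <;> decide
  simp only [inward, sub_self, zero_smul, zero_add, one_smul, sub_zero, add_zero, h, h',
    sub_add_cancel]
  abel

theorem hasDerivAt_normalCoef (n : Fin 4 → Plane) (i : Fin 4) (s : ℝ) :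
    HasDerivAt (Q.normalCoef n i) (Q.normalCoef n i 1 - Q.normalCoef n i 0) s := by
  have h1 := ((hasDerivAt_id s).const_sub 1).mul_const
    (Inner.inner ℝ (Q.vertex (i - 1) - Q.vertex i) (n i))
  refine (h1.add ((hasDerivAt_id s).mul_const _)).congr_deriv ?_
  simp only [normalCoef]
  ring

theorem hasDerivAt_edgeCoef (i : Fin 4) (s : ℝ) :
    HasDerivAt (Q.edgeCoef i) (Q.edgeCoef i 1 - Q.edgeCoef i 0) s := by
  have h1 := ((hasDerivAt_id s).const_sub 1).mul_const
    (Inner.inner ℝ (Q.vertex (i - 1) - Q.vertex i) (Q.edge i) / ‖Q.edge i‖ ^ 2)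
  refine (h1.add ((hasDerivAt_id s).mul_const _)).congr_deriv ?_
  simp only [edgeCoef]
  ring

end ConvexQuad

section

variable {p : ℕ} {Q : ConvexQuad} {n : Fin 4 → Plane} {d : Dof p → ℝ} {i : Fin 4} {u v : ℝ → ℝ}

theorem normalSpl_differentiable (hp : 3 ≤ p) (hv : v ∈ NormalSpl p) : Differentiable ℝ v :=
  (Spl.contDiff hv).differentiable (by
    have : p - 2 ≠ 0 := by omega
    exact_mod_cast this)

theorem edgeSpl_differentiable (hp : 3 ≤ p) (hu : u ∈ EdgeSpl p) : Differentiable ℝ u :=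
  (Spl.contDiff hu).differentiable (by
    have : p - 1 ≠ 0 := by omega
    exact_mod_cast this)

/-- The values and derivatives at the end points of the inward derivative that belongs to a trace and
a normal derivative with given data. -/
theorem flux_end (hp : 3 ≤ p) (hn : Q.IsUnitNormal n) (hu : u ∈ EdgeSpl p) (hv : v ∈ NormalSpl p)
    (hud : ∀ j, splDof 3 (edgeValueNodes p) j u = edgeData Q d i j)
    (hvd : ∀ j, splDof 2 (edgeNormalNodes p) j v = normalData Q n d i j) (e : Fin 2) :
    Q.normalCoef n i ((e : ℕ) : ℝ) * v ((e : ℕ) : ℝ) +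
        Q.edgeCoef i ((e : ℕ) : ℝ) * deriv u ((e : ℕ) : ℝ) =
      gradForm d (endIndex i e) (Q.inward i ((e : ℕ) : ℝ)) ∧
    deriv (fun s => Q.normalCoef n i s * v s + Q.edgeCoef i s * deriv u s) ((e : ℕ) : ℝ) =
      gradForm d (endIndex i e) (Q.inward i 1 - Q.inward i 0) +
        hessForm d (endIndex i e) (Q.edge i) (Q.inward i ((e : ℕ) : ℝ)) := by
  have h1 : deriv u ((e : ℕ) : ℝ) = gradForm d (endIndex i e) (Q.edge i) := hud (.inl (1, e))
  have h2 : deriv (deriv u) ((e : ℕ) : ℝ) = hessForm d (endIndex i e) (Q.edge i) (Q.edge i) :=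
    hud (.inl (2, e))
  have h3 : v ((e : ℕ) : ℝ) = gradForm d (endIndex i e) (n i) := hvd (.inl (0, e))
  have h4 : deriv v ((e : ℕ) : ℝ) = hessForm d (endIndex i e) (Q.edge i) (n i) :=
    hvd (.inl (1, e))
  have h5 := (normalSpl_differentiable hp hv ((e : ℕ) : ℝ)).hasDerivAt
  have h6 := (normalSpl_differentiable hp (edgeSpl_deriv_mem hp hu) ((e : ℕ) : ℝ)).hasDerivAt
  have h7 := (((Q.hasDerivAt_normalCoef n i _).mul h5).add ((Q.hasDerivAt_edgeCoef i _).mul h6)).deriv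
  refine ⟨?_, h7.trans ?_⟩
  · rw [h1, h3, ConvexQuad.inward_eq hn, gradForm_add, gradForm_smul, gradForm_smul]
  · have h8 : Q.inward i 1 - Q.inward i 0 = (Q.normalCoef n i 1 - Q.normalCoef n i 0) • n i +
        (Q.edgeCoef i 1 - Q.edgeCoef i 0) • Q.edge i := by
      rw [ConvexQuad.inward_eq hn, ConvexQuad.inward_eq hn]
      module
    rw [h1, h2, h3, h4, h8, ConvexQuad.inward_eq hn, gradForm_add, gradForm_smul, gradForm_smul,
      hessForm_add, hessForm_smul, hessForm_smul]
    ring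

end

theorem gradForm_neg {p : ℕ} (d : Dof p → ℝ) (i : Fin 4) (w : Plane) :
    gradForm d i (-w) = - gradForm d i w := by
  rw [← neg_one_smul ℝ, gradForm_smul, neg_one_mul]

theorem hessForm_neg {p : ℕ} (d : Dof p → ℝ) (i : Fin 4) (w z : Plane) :
    hessForm d i w (-z) = - hessForm d i w z := by
  rw [← neg_one_smul ℝ, hessForm_smul, neg_one_mul]

section

variable {p : ℕ} (hp : 3 ≤ p) [Fintype (faceNodes p)]
  {b : (Fin 2 × Fin 2) ⊕ faceNodes p → ℝ → ℝ} (hb : IsSplDual 2 (faceNodes p) (FaceSpl p) b)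
  {Q : ConvexQuad} {c : (Fin 2 × Fin 2) ⊕ faceNodes p → (Fin 2 × Fin 2) ⊕ faceNodes p → ℝ}

include hb

theorem lift_poly (a a' : Fin (numSub p)) : ∃ c' : Fin (p + 1) → Fin (p + 1) → ℝ,
    ∀ s ∈ subInterval (numSub p) a, ∀ t ∈ subInterval (numSub p) a',
      lift Q c b (Q.param s t) = ∑ i, ∑ j, c' i j * s ^ (i : ℕ) * t ^ (j : ℕ) := by
  have h : ∀ (a : Fin (numSub p)) (j), ∃ P : Polynomial ℝ, P.natDegree ≤ p ∧
      ∀ s ∈ subInterval (numSub p) a, b j s = P.eval s := fun a j => by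
    obtain ⟨P, h1, h2⟩ := Spl.isPiecewise (hb.mem j) univ a
    exact ⟨P, h1, fun s hs => h2 s (mem_univ s) (subInterval_subset_linePiece a hs)⟩
  choose P hP hPe using h
  refine ⟨fun m l => ∑ i, ∑ j, c i j * ((P a i).coeff m * (P a' j).coeff l), fun s hs t ht => ?_⟩
  have h1 := lift_toPlane (b := b) Q c (ξ := (s, t))
    ⟨subInterval_subset_Icc a hs, subInterval_subset_Icc a' ht⟩
  refine h1.trans ?_
  simp only [tens, Finset.sum_mul]
  refine Eq.trans ?_
    ((Finset.sum_congr rfl fun m _ => Finset.sum_comm).trans Finset.sum_comm).symm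
  refine Finset.sum_congr rfl fun i _ => ?_
  refine Eq.trans ?_
    ((Finset.sum_congr rfl fun m _ => Finset.sum_comm).trans Finset.sum_comm).symm
  refine Finset.sum_congr rfl fun j _ => ?_
  rw [hPe a i s hs, hPe a' j t ht, eval_eq_sum_fin (hP a i), eval_eq_sum_fin (hP a' j),
    Finset.sum_mul_sum, Finset.mul_sum]
  refine Finset.sum_congr rfl fun m _ => ?_
  rw [Finset.mul_sum]
  exact Finset.sum_congr rfl fun l _ => by ring

include hp

theorem memSpace_lift {n : Fin 4 → Plane} (hn : Q.IsUnitNormal n)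
    (hu : ∀ i, sideTrace c b i ∈ EdgeSpl p) {v : Fin 4 → ℝ → ℝ} (hv : ∀ i, v i ∈ NormalSpl p)
    (hD : ∀ i s, sideFlux c b i s =
      Q.normalCoef n i s * v i s + Q.edgeCoef i s * deriv (sideTrace c b i) s) :
    MemSpace p Q n (lift Q c b) where
  poly := lift_poly hb
  normal i a := by
    obtain ⟨P, h1, h2⟩ := Spl.isPiecewise (hv i) univ a
    refine ⟨P, h1, fun s hs => ?_⟩
    have hs' := Ioo_subset_Icc_self hs.2
    rw [(smoothExt_lift hp hb Q c fun _ _ => rfl).eqOn_dirDeriv (n i)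
      (Q.edgeParam_mem_closed i hs'), ← h2 s (mem_univ s) (subInterval_subset_linePiece a hs.1)]
    exact (eqOn_fderiv_normal hp hb hn (fun s _ => hD i s) hs').symm
  smooth _ := by
    have h : ContDiffOn ℝ (p - 2 : ℕ) (lift Q c b) Q.inner := by
      intro x hx
      obtain ⟨ξ, hξ, rfl⟩ := Q.exists_of_mem_closed (Q.inner_subset_closed hx)
      exact (Q.contDiffAt_comp_toSquare (Q.square_subset_regular hξ)
        (tens_contDiff c (basis_contDiff hb)).contDiffAt).contDiffWithinAt
    exact h
  trace _ i := by
    have h : ContDiffOn ℝ (p - 1 : ℕ) (fun s => lift Q c b (Q.edgeParam i s)) (Ioo 0 1) :=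
      (Spl.contDiff (hu i)).contDiffOn.congr fun s hs =>
        lift_edgeParam Q c i (Ioo_subset_Icc_self hs)
    exact h

end

/-- The degrees of freedom can be prescribed. -/
theorem exists_memSpace {p : ℕ} (hp : 3 ≤ p) {Q : ConvexQuad} {n : Fin 4 → Plane}
    (hn : Q.IsUnitNormal n) (d : Dof p → ℝ) :
    ∃ f, MemSpace p Q n f ∧ Dof.eval Q n f = d := by
  let := (faceNodes_finite hp).fintype
  let := (edgeNormalNodes_finite p).fintype
  let := (edgeValueNodes_finite_ncard hp).1.fintype
  obtain ⟨b, hb⟩ := exists_face_dual hp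
  obtain ⟨e, he⟩ := exists_edge_dual hp
  obtain ⟨m, hm⟩ := exists_normal_dual hp
  set u : Fin 4 → ℝ → ℝ := fun i s => ∑ j, edgeData Q d i j * e j s with hu
  set v : Fin 4 → ℝ → ℝ := fun i s => ∑ j, normalData Q n d i j * m j s with hv
  have hum : ∀ i, u i ∈ EdgeSpl p := fun i => he.sum_mem _
  have hvm : ∀ i, v i ∈ NormalSpl p := fun i => hm.sum_mem _
  have hud : ∀ i j, splDof 3 (edgeValueNodes p) j (u i) = edgeData Q d i j := fun i => he.dof _
  have hvd : ∀ i j, splDof 2 (edgeNormalNodes p) j (v i) = normalData Q n d i j :=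
    fun i => hm.dof _
  -- The transversal derivative that trace and normal derivative force on the side.
  set D : Fin 4 → ℝ → ℝ := fun i s => Q.normalCoef n i s * v i s + Q.edgeCoef i s * deriv (u i) s
    with hD
  have hDm : ∀ i, D i ∈ FaceSpl p := fun i =>
    (FaceSpl p).add_mem (normalSpl_affine_mul hp (hvm i) _ _)
      (normalSpl_affine_mul hp (edgeSpl_deriv_mem hp (hum i)) _ _)
  have hend := fun i => flux_end hp hn (hum i) (hvm i) (hud i) (hvd i)
  have hu0 : ∀ i, u i 0 = d (.value i) := fun i => by simpa [splDof, edgeData, endIndex] using hud i (.inl (0, 0))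
  have hu1 : ∀ i, u (i - 1) 1 = d (.value i) := fun i => by
    simpa [splDof, edgeData, endIndex] using hud (i - 1) (.inl (0, 1))
  have hu0' : ∀ i, deriv (u i) 0 = gradForm d i (Q.edge i) := fun i => by
    simpa [splDof, edgeData, endIndex] using hud i (.inl (1, 0))
  have hu1' : ∀ i, deriv (u (i - 1)) 1 = gradForm d i (Q.edge (i - 1)) := fun i => by
    simpa [splDof, edgeData, endIndex] using hud (i - 1) (.inl (1, 1))
  have hD0 : ∀ i, D i 0 = gradForm d i (Q.inward i 0) := fun i => by
    simpa [endIndex] using (hend i 0).1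
  have hD1 : ∀ i, D (i - 1) 1 = gradForm d i (Q.inward (i - 1) 1) := fun i => by
    simpa [endIndex] using (hend (i - 1) 1).1
  have hD0' : ∀ i, deriv (D i) 0 = gradForm d i (Q.inward i 1 - Q.inward i 0) +
      hessForm d i (Q.edge i) (Q.inward i 0) := fun i => by
    simpa [endIndex] using (hend i 0).2
  have hD1' : ∀ i, deriv (D (i - 1)) 1 = gradForm d i (Q.inward (i - 1) 1 - Q.inward (i - 1) 0) +
      hessForm d i (Q.edge (i - 1)) (Q.inward (i - 1) 1) := fun i => by
    simpa [endIndex] using (hend (i - 1) 1).2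
  -- At a corner the transversal direction of one side is, up to sign, the edge of the other. The
  -- conditions thus compare one value, one gradient and, for the mixed derivative, one symmetric
  -- Hessian with the mixed derivative of the parametrization.
  obtain ⟨c, hcu, hcD, hcF⟩ := exists_coef hb (basis_differentiable hp hb)
    (fun _ h => Spl.comp_one_sub (numSub_pos p) h)
    (fun i => Spl.mono (numSub_pos p) le_rfl (by omega) (hum i)) hDm
    (fun x y => d (.face x y))
    (fun i => (hu0 i).trans (hu1 i).symm)
    (fun i => by rw [hD0, hu1', Q.inward_zero, gradForm_neg])
    (fun i => by rw [hu0', hD1, Q.inward_pred_one])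
    (fun i => by
      rw [hD0', hD1', Q.inward_one_sub_zero i, Q.inward_zero i, Q.inward_pred_one, gradForm_neg,
        hessForm_neg, hessForm_comm d i (Q.edge i), neg_add])
  have hcD' : ∀ i s, sideFlux c b i s =
      Q.normalCoef n i s * v i s + Q.edgeCoef i s * deriv (sideTrace c b i) s := fun i s => by
    rw [hcD, hcu]
  have hmem : MemSpace p Q n (lift Q c b) :=
    memSpace_lift hp hb hn (fun i => hcu i ▸ hum i) hvm hcD'
  have hs := smoothExt_lift hp hb Q c (f := lift Q c b) fun _ _ => rfl
  refine ⟨_, hmem, dof_ext hn (fun i => ?_) (fun i => ?_) fun x y => ?_⟩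
  · ext j
    rw [← hs.splDof_trace (u := u i) (n := n) (fun s hs => ?_) (edgeSpl_differentiable hp (hum i))
      (fun _ => normalSpl_differentiable hp (edgeSpl_deriv_mem hp (hum i)) _), hud]
    rw [← hcu]
    exact (lift_edgeParam Q c i hs).symm
  · ext j
    rw [← hs.splDof_normal (v := v i) (n := n)
      (eqOn_fderiv_normal hp hb hn fun s _ => hcD' i s) (normalSpl_differentiable hp (hvm i)), hvd]
  · refine Eq.trans ?_ (hcF x y)
    exact lift_toPlane Q c (ξ := (x, y)) ⟨Ioo_subset_Icc_self (faceNodes_subset hp x.2),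
      Ioo_subset_Icc_self (faceNodes_subset hp y.2)⟩

/-! ### Bounds for the coefficients in terms of the degrees of freedom -/

section C1Bdd

variable {K K' : ℝ} {u v : ℝ → ℝ}

theorem C1Bdd.nonneg (hu : C1Bdd K u) : 0 ≤ K :=
  (abs_nonneg _).trans (hu 0 (by simp)).1

theorem C1Bdd.mono (hu : C1Bdd K u) (h : K ≤ K') : C1Bdd K' u := fun s hs =>
  ⟨(hu s hs).1.trans h, (hu s hs).2.trans h⟩

theorem C1Bdd.add (hu : C1Bdd K u) (hv : C1Bdd K' v) (hud : Differentiable ℝ u)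
    (hvd : Differentiable ℝ v) : C1Bdd (K + K') fun s => u s + v s := by
  intro s hs
  rw [deriv_fun_add (hud s) (hvd s)]
  exact ⟨(abs_add_le _ _).trans (add_le_add (hu s hs).1 (hv s hs).1),
    (abs_add_le _ _).trans (add_le_add (hu s hs).2 (hv s hs).2)⟩

theorem C1Bdd.mul (hu : C1Bdd K u) (hv : C1Bdd K' v) (hud : Differentiable ℝ u)
    (hvd : Differentiable ℝ v) : C1Bdd (2 * K * K') fun s => u s * v s := by
  have hK := hu.nonneg
  have hK' := hv.nonneg
  intro s hs
  obtain ⟨h1, h2⟩ := hu s hs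
  obtain ⟨h3, h4⟩ := hv s hs
  have h5 := mul_nonneg hK hK'
  rw [deriv_fun_mul (hud s) (hvd s)]
  refine ⟨?_, (abs_add_le _ _).trans ?_⟩
  · change |u s * v s| ≤ _
    rw [abs_mul]
    have := mul_le_mul h1 h3 (abs_nonneg _) hK
    linarith
  · rw [abs_mul, abs_mul]
    have h6 := mul_le_mul h2 h3 (abs_nonneg _) hK
    have h7 := mul_le_mul h1 h4 (abs_nonneg _) hK
    linarith

theorem abs_sum_mul_le {ι : Type*} [Fintype ι] {c a : ι → ℝ} (hc : ∀ j, |c j| ≤ K)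
    (ha : ∀ j, |a j| ≤ K') : |∑ j, c j * a j| ≤ Fintype.card ι * (K * K') := by
  refine (Finset.abs_sum_le_sum_abs _ _).trans ?_
  rw [← nsmul_eq_mul, Fintype.card]
  refine Finset.sum_le_card_nsmul _ _ _ fun j _ => ?_
  rw [abs_mul]
  exact mul_le_mul (hc j) (ha j) (abs_nonneg _) ((abs_nonneg _).trans (hc j))

theorem deriv_sum_mul {ι : Type*} [Fintype ι] (c : ι → ℝ) {e : ι → ℝ → ℝ}
    (hd : ∀ j, Differentiable ℝ (e j)) :
    deriv (fun s => ∑ j, c j * e j s) = fun s => ∑ j, c j * deriv (e j) s :=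
  funext fun s => (HasDerivAt.fun_sum fun j _ => (hd j s).hasDerivAt.const_mul (c j)).deriv

theorem C1Bdd.sum_mul {ι : Type*} [Fintype ι] {c : ι → ℝ} {e : ι → ℝ → ℝ} (hc : ∀ j, |c j| ≤ K)
    (he : ∀ j, C1Bdd K' (e j)) (hd : ∀ j, Differentiable ℝ (e j)) :
    C1Bdd (Fintype.card ι * (K * K')) fun s => ∑ j, c j * e j s := by
  intro s hs
  rw [deriv_sum_mul c hd]
  exact ⟨abs_sum_mul_le hc fun j => (he j s hs).1, abs_sum_mul_le hc fun j => (he j s hs).2⟩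

theorem c1Bdd_affine {x y : ℝ} (hx : |x| ≤ K) (hy : |y| ≤ K) :
    C1Bdd (2 * K) fun s => (1 - s) * x + s * y := by
  have hK := (abs_nonneg x).trans hx
  intro s hs
  have h : HasDerivAt (fun s => (1 - s) * x + s * y) (-1 * x + 1 * y) s :=
    (((hasDerivAt_id s).const_sub 1).mul_const x).add ((hasDerivAt_id s).mul_const y)
  rw [h.deriv]
  refine ⟨(abs_add_le _ _).trans ?_, (abs_add_le _ _).trans ?_⟩
  · rw [abs_mul, abs_mul, abs_of_nonneg hs.1, abs_of_nonneg (sub_nonneg.2 hs.2)]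
    have h1 := mul_le_mul_of_nonneg_left hx (sub_nonneg.2 hs.2)
    have h2 := mul_le_mul_of_nonneg_left hy hs.1
    linarith
  · rw [neg_one_mul, abs_neg, one_mul]
    linarith

theorem exists_forall_c1Bdd {ι : Type*} [Fintype ι] {e : ι → ℝ → ℝ} (h : ∀ j, ∃ K, C1Bdd K (e j)) :
    ∃ K, ∀ j, C1Bdd K (e j) := by
  choose K hK using h
  exact ⟨∑ j, K j, fun j => (hK j).mono
    (Finset.single_le_sum (f := K) (fun i _ => (hK i).nonneg) (Finset.mem_univ j))⟩

theorem Spl.exists_c1Bdd {k d r d' r' : ℕ} (hu : u ∈ Spl k d r) (hu' : deriv u ∈ Spl k d' r') :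
    ∃ K, C1Bdd K u := by
  obtain ⟨M, hM⟩ := Spl.bddLip hu
  obtain ⟨M', hM'⟩ := Spl.bddLip hu'
  exact ⟨max M M', fun s hs => ⟨(hM.2 s hs).1.trans (le_max_left _ _),
    (hM'.2 s hs).1.trans (le_max_right _ _)⟩⟩

end C1Bdd

theorem normalSpl_deriv_mem {p : ℕ} (hp : 3 ≤ p) {v : ℝ → ℝ} (hv : v ∈ NormalSpl p) :
    deriv v ∈ Spl (numSub p) (p - 2) (p - 3) := by
  obtain ⟨q, rfl⟩ : ∃ q, p = q + 3 := ⟨p - 3, by omega⟩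
  exact Spl.deriv_mem (numSub_pos _) hv

section Data

variable {p : ℕ} {d : Dof p → ℝ} (hd : ∀ l, |d l| ≤ 1)

include hd

theorem abs_gradForm_le (i : Fin 4) (w : Plane) : |gradForm d i w| ≤ 2 * ‖w‖ := by
  have h : ∀ a l, |w a * d l| ≤ ‖w‖ * 1 := fun a l => by
    rw [abs_mul]
    exact mul_le_mul (abs_apply_le_norm w a) (hd l) (abs_nonneg _) (norm_nonneg _)
  refine (abs_add_le _ _).trans ?_
  have h1 := h 0 (.grad i 0)
  have h2 := h 1 (.grad i 1)
  linarith

theorem abs_hessForm_le (i : Fin 4) (w z : Plane) : |hessForm d i w z| ≤ 4 * (‖w‖ * ‖z‖) := by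
  have h0 : ∀ a a', |w a * z a'| ≤ ‖w‖ * ‖z‖ := fun a a' => by
    rw [abs_mul]
    exact mul_le_mul (abs_apply_le_norm w a) (abs_apply_le_norm z a') (abs_nonneg _) (norm_nonneg _)
  have h : ∀ (x M : ℝ) l, |x| ≤ M → |x * d l| ≤ M * 1 := fun x M l hx => by
    rw [abs_mul]
    exact mul_le_mul hx (hd l) (abs_nonneg _) ((abs_nonneg _).trans hx)
  have h1 := h _ _ (.hess i ⟨(0, 0), le_rfl⟩) (h0 0 0)
  have h2 := h _ _ (.hess i ⟨(0, 1), zero_le_one⟩)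
    ((abs_add_le _ _).trans (add_le_add (h0 0 1) (h0 1 0)))
  have h3 := h _ _ (.hess i ⟨(1, 1), le_rfl⟩) (h0 1 1)
  refine (abs_add_le _ _).trans ((add_le_add_left (abs_add_le _ _) _).trans ?_)
  linarith

variable {Q : ConvexQuad} {n : Fin 4 → Plane} {h : ℝ} (hQ : ∀ i, ‖Q.edge i‖ ≤ h)

include hQ

/-- One constant for all cases: it dominates `1`, `2 h` and `4 h ^ 2` here, and also `2` and `4 h`
for the normal data. -/
theorem abs_edgeData_le (i : Fin 4) (j) : |edgeData Q d i j| ≤ 3 + 4 * h + 4 * h ^ 2 := by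
  have h0 := norm_nonneg (Q.edge i)
  have h1 := hQ i
  have h2 := mul_self_le_mul_self h0 h1
  rcases j with ⟨m, e⟩ | x
  · fin_cases m
    · exact (hd _).trans (by nlinarith)
    · exact (abs_gradForm_le hd _ _).trans (by nlinarith)
    · exact (abs_hessForm_le hd _ _ _).trans (by nlinarith)
  · exact (hd _).trans (by nlinarith)

theorem abs_normalData_le (hn : Q.IsUnitNormal n) (i : Fin 4) (j) :
    |normalData Q n d i j| ≤ 3 + 4 * h + 4 * h ^ 2 := by
  have h0 := norm_nonneg (Q.edge i)
  have h1 := hQ i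
  have h2 := mul_self_le_mul_self h0 h1
  have h3 := (hn i).1
  rcases j with ⟨m, e⟩ | x
  · fin_cases m
    · exact (abs_gradForm_le hd _ _).trans (by rw [h3]; nlinarith)
    · exact (abs_hessForm_le hd _ _ _).trans (by rw [h3]; nlinarith)
  · exact (hd _).trans (by nlinarith)

end Data

namespace ConvexQuad.ShapeBounds

variable {Q : ConvexQuad} {h ℓ δ : ℝ} (hQ : Q.ShapeBounds h ℓ δ)

include hQ

theorem norm_side_le (i : Fin 4) : ‖Q.vertex (i - 1) - Q.vertex i‖ ≤ h ∧
    ‖Q.vertex (i + 2) - Q.vertex (i + 1)‖ ≤ h := by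
  have h1 := hQ.edge_le (i - 1)
  have h2 := hQ.edge_le (i + 1)
  have h3 : i + 1 + 1 = i + 2 := by rw [add_assoc]; rfl
  rw [edge, sub_add_cancel, norm_sub_rev] at h1
  rw [edge, h3] at h2
  exact ⟨h1, h2⟩

theorem c1Bdd_normalCoef {n : Fin 4 → Plane} (hn : Q.IsUnitNormal n) (i : Fin 4) :
    C1Bdd (2 * h) (Q.normalCoef n i) := by
  obtain ⟨h1, h2⟩ := hQ.norm_side_le i
  have h3 : ∀ w : Plane, |Inner.inner ℝ w (n i)| ≤ ‖w‖ := fun w => by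
    simpa [(hn i).1] using abs_real_inner_le_norm w (n i)
  exact c1Bdd_affine ((h3 _).trans h1) ((h3 _).trans h2)

/-- The lower bound for the edge lengths enters the coefficient estimate here only, through division
by the squared norm of the edge. -/
theorem c1Bdd_edgeCoef (hℓ : 0 < ℓ) (i : Fin 4) : C1Bdd (2 * (h / ℓ)) (Q.edgeCoef i) := by
  obtain ⟨h1, h2⟩ := hQ.norm_side_le i
  have h4 := hQ.le_edge i
  have h5 := hℓ.trans_le h4
  have h3 : ∀ w : Plane, ‖w‖ ≤ h → |Inner.inner ℝ w (Q.edge i) / ‖Q.edge i‖ ^ 2| ≤ h / ℓ := by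
    intro w hw
    rw [abs_div, abs_of_nonneg (sq_nonneg ‖Q.edge i‖), div_le_div_iff₀ (by positivity) hℓ]
    have h6 := abs_real_inner_le_norm w (Q.edge i)
    calc _ ≤ h * ‖Q.edge i‖ * ‖Q.edge i‖ := by
          refine mul_le_mul (h6.trans ?_) h4 hℓ.le (mul_nonneg ((norm_nonneg _).trans hw) h5.le)
          exact mul_le_mul_of_nonneg_right hw h5.le
      _ = h * ‖Q.edge i‖ ^ 2 := by ring
  exact c1Bdd_affine (h3 _ h1) (h3 _ h2)

end ConvexQuad.ShapeBounds

/-- The univariate dual families on `[0, 1]` do not depend on the quadrilateral. Traces and normal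
derivatives are therefore bounded by their data, the fluxes by these and by the affine coefficients,
and the matrix entries by all of them. -/
theorem exists_coef_bound {p : ℕ} (hp : 3 ≤ p) [Fintype (faceNodes p)]
    {b : (Fin 2 × Fin 2) ⊕ faceNodes p → ℝ → ℝ} (hb : IsSplDual 2 (faceNodes p) (FaceSpl p) b)
    (h : ℝ) {ℓ : ℝ} (hℓ : 0 < ℓ) : ∃ K, ∀ (δ : ℝ) (Q : ConvexQuad) (n : Fin 4 → Plane)
      (f : Plane → ℝ) (c), Q.ShapeBounds h ℓ δ → Q.IsUnitNormal n → MemSpace p Q n f →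
        EqOn f (lift Q c b) Q.closed → (∀ l : Dof p, |Dof.eval Q n f l| ≤ 1) → ∀ i j, |c i j| ≤ K := by
  let := (edgeNormalNodes_finite p).fintype
  let := (edgeValueNodes_finite_ncard hp).1.fintype
  obtain ⟨e, he⟩ := exists_edge_dual hp
  obtain ⟨m, hm⟩ := exists_normal_dual hp
  have hed := fun j => edgeSpl_differentiable hp (he.mem j)
  have hed' := fun j => normalSpl_differentiable hp (edgeSpl_deriv_mem hp (he.mem j))
  have hmd := fun j => normalSpl_differentiable hp (hm.mem j)
  obtain ⟨A₀, hA₀⟩ := exists_forall_c1Bdd fun j =>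
    Spl.exists_c1Bdd (he.mem j) (edgeSpl_deriv_mem hp (he.mem j))
  obtain ⟨A₁, hA₁⟩ := exists_forall_c1Bdd fun j => Spl.exists_c1Bdd
    (edgeSpl_deriv_mem hp (he.mem j)) (normalSpl_deriv_mem hp (edgeSpl_deriv_mem hp (he.mem j)))
  obtain ⟨A₂, hA₂⟩ := exists_forall_c1Bdd fun j =>
    Spl.exists_c1Bdd (hm.mem j) (normalSpl_deriv_mem hp (hm.mem j))
  set κ := 3 + 4 * h + 4 * h ^ 2
  -- Bounds, together with one derivative, for the trace (`B₀`), the tangential derivative (`B₁`),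
  -- the normal derivative (`B₂`) and the flux (`B₃`).
  set B₀ := Fintype.card ((Fin 3 × Fin 2) ⊕ edgeValueNodes p) * (κ * A₀)
  set B₁ := Fintype.card ((Fin 3 × Fin 2) ⊕ edgeValueNodes p) * (κ * A₁)
  set B₂ := Fintype.card ((Fin 2 × Fin 2) ⊕ edgeNormalNodes p) * (κ * A₂)
  set B₃ := 2 * (2 * h) * B₂ + 2 * (2 * (h / ℓ)) * B₁
  refine ⟨max (max B₀ B₃) 1, fun δ Q n f c hQ hn hf hfc hd => ?_⟩
  have hs := smoothExt_lift hp hb Q c hfc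
  have hmem := fun i => hf.sideTrace_mem hb hfc i
  have hu : ∀ i, sideTrace c b i = fun s => ∑ j, edgeData Q (Dof.eval Q n f) i j * e j s := by
    intro i
    rw [he.repr _ (hmem i)]
    ext s
    refine Finset.sum_congr rfl fun j _ => ?_
    rw [hs.splDof_trace (n := n) (fun s hs => (lift_edgeParam Q c i hs).symm)
      (edgeSpl_differentiable hp (hmem i))
      fun _ => normalSpl_differentiable hp (edgeSpl_deriv_mem hp (hmem i)) _]
  have hB₀ : ∀ i, C1Bdd B₀ (sideTrace c b i) := fun i => by
    rw [hu i]
    exact C1Bdd.sum_mul (abs_edgeData_le hd hQ.edge_le i) hA₀ hed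
  have hB₁ : ∀ i, C1Bdd B₁ (deriv (sideTrace c b i)) := fun i => by
    rw [hu i, deriv_sum_mul _ hed]
    exact C1Bdd.sum_mul (abs_edgeData_le hd hQ.edge_le i) hA₁ hed'
  have hB₃ : ∀ i, C1Bdd B₃ (sideFlux c b i) := fun i => by
    obtain ⟨v, hv, hD⟩ := hf.exists_normal hp hb hn hfc i
    have hB₂ : C1Bdd B₂ v := by
      have h1 : v = fun s => ∑ j, normalData Q n (Dof.eval Q n f) i j * m j s := by
        conv_lhs => rw [hm.repr _ hv]
        ext s
        refine Finset.sum_congr rfl fun j _ => ?_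
        rw [hs.splDof_normal (eqOn_fderiv_normal hp hb hn fun s _ => hD s)
          (normalSpl_differentiable hp hv)]
      rw [h1]
      exact C1Bdd.sum_mul (abs_normalData_le hd hQ.edge_le hn i) hA₂ hmd
    rw [funext hD]
    have h2 := normalSpl_differentiable hp hv
    have h3 := normalSpl_differentiable hp (edgeSpl_deriv_mem hp (hmem i))
    have h4 : Differentiable ℝ (Q.normalCoef n i) := fun s =>
      (Q.hasDerivAt_normalCoef n i s).differentiableAt
    have h5 : Differentiable ℝ (Q.edgeCoef i) := fun s => (Q.hasDerivAt_edgeCoef i s).differentiableAt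
    exact ((hQ.c1Bdd_normalCoef hn i).mul hB₂ h4 h2).add
      ((hQ.c1Bdd_edgeCoef hℓ i).mul (hB₁ i) h5 h3) (h4.mul h2) (h5.mul h3)
  refine abs_coef_le hb (basis_differentiable hp hb) c (faceNodes_subset hp)
    (fun i => (hB₀ i).mono ((le_max_left _ _).trans (le_max_left _ _)))
    (fun i => (hB₃ i).mono ((le_max_right _ _).trans (le_max_left _ _))) fun x y => ?_
  have hxy : ((x : ℝ), (y : ℝ)) ∈ ConvexQuad.square :=
    ⟨Ioo_subset_Icc_self (faceNodes_subset hp x.2), Ioo_subset_Icc_self (faceNodes_subset hp y.2)⟩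
  rw [← lift_toPlane (b := b) Q c hxy, ← hfc (Q.toPlane_mem_closed hxy)]
  exact (hd (.face x y)).trans (le_max_right _ _)

/-! ### Bounds for the functions -/

theorem bddLip_affine {x y B : ℝ} (hx : |x| ≤ B) (hy : |y| ≤ B) :
    BddLip (Icc (0 : ℝ) 1) (2 * B) fun s => (1 - s) * x + s * y := by
  have hB := (abs_nonneg x).trans hx
  refine ⟨by positivity, fun s hs => ⟨(c1Bdd_affine hx hy s hs).1, fun t _ => ?_⟩⟩
  have h1 : (1 - s) * x + s * y - ((1 - t) * x + t * y) = (y - x) * (s - t) := by ring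
  rw [h1, abs_mul, Real.dist_eq]
  exact mul_le_mul_of_nonneg_right ((abs_sub _ _).trans (by linarith)) (abs_nonneg _)

section Square

variable {M : ℝ} {u : ℝ → ℝ} (hu : BddLip (Icc (0 : ℝ) 1) M u)

include hu

theorem BddLip.comp_fst : BddLip ConvexQuad.square (M + M * 1) fun ξ => u ξ.1 :=
  hu.comp (fun _ hξ => hξ.1) zero_le_one fun x _ y _ => by
    rw [one_mul, Prod.dist_eq]
    exact le_max_left _ _

theorem BddLip.comp_snd : BddLip ConvexQuad.square (M + M * 1) fun ξ => u ξ.2 :=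
  hu.comp (fun _ hξ => hξ.2) zero_le_one fun x _ y _ => by
    rw [one_mul, Prod.dist_eq]
    exact le_max_right _ _

end Square

theorem exists_bddLip_tensor {ι : Type*} [Fintype ι] {a a' : ι → ℝ → ℝ}
    (ha : ∀ i, ∃ M, BddLip (Icc (0 : ℝ) 1) M (a i)) (ha' : ∀ i, ∃ M, BddLip (Icc (0 : ℝ) 1) M (a' i))
    (K : ℝ) : ∃ M, ∀ c : ι → ι → ℝ, (∀ i j, |c i j| ≤ K) →
      BddLip ConvexQuad.square M fun ξ => ∑ i, ∑ j, c i j * (a i ξ.1 * a' j ξ.2) := by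
  choose A hA using ha
  choose A' hA' using ha'
  refine ⟨_, fun c hc => BddLip.sum _ fun i _ => BddLip.sum _ fun j _ =>
    BddLip.mul (M := K) (M' := 2 * (A i + A i * 1) * (A' j + A' j * 1)) ((BddLip.const (c i j)).mono (hc i j)) ?_⟩
  exact (hA i).comp_fst.mul (hA' j).comp_snd

namespace ConvexQuad.ShapeBounds

theorem exists_bddLip_det2 (h : ℝ) : ∃ M, ∀ (ℓ δ : ℝ) (Q : ConvexQuad), Q.ShapeBounds h ℓ δ →
    ∀ a, BddLip square M (fun ξ => det2 (unitVec a) (Q.tVec ξ.1)) ∧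
      BddLip square M (fun ξ => det2 (Q.sVec ξ.2) (unitVec a)) := by
  refine ⟨2 * h + 2 * h * 1, fun ℓ δ Q hQ a => ⟨?_, ?_⟩⟩
  · have h1 : ∀ w : Plane, ‖w‖ ≤ h → |det2 (unitVec a) w| ≤ h := fun w hw =>
      (abs_det2_le _ _).trans (by rwa [norm_unitVec, one_mul])
    refine BddLip.congr (bddLip_affine (h1 (Q.vertex 3 - Q.vertex 0) ?_)
      (h1 (Q.vertex 2 - Q.vertex 1) (hQ.edge_le 1))).comp_fst fun ξ _ => ?_
    · rw [norm_sub_rev]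
      exact hQ.edge_le 3
    · simp only [det2_apply, tVec, PiLp.add_apply, PiLp.smul_apply, smul_eq_mul]
      ring
  · have h1 : ∀ w : Plane, ‖w‖ ≤ h → |det2 w (unitVec a)| ≤ h := fun w hw =>
      (abs_det2_le _ _).trans (by rwa [norm_unitVec, mul_one])
    refine BddLip.congr (bddLip_affine (h1 (Q.vertex 1 - Q.vertex 0) (hQ.edge_le 0))
      (h1 (Q.vertex 2 - Q.vertex 3) ?_)).comp_snd fun ξ _ => ?_
    · rw [norm_sub_rev]
      exact hQ.edge_le 2
    · simp only [det2_apply, sVec, PiLp.add_apply, PiLp.smul_apply, smul_eq_mul]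
      ring

theorem exists_bddLip_inv_jac (h : ℝ) {δ : ℝ} (hδ : 0 < δ) : ∃ M, ∀ (ℓ : ℝ) (Q : ConvexQuad),
    Q.ShapeBounds h ℓ δ → BddLip square M (fun ξ => (Q.jac ξ.1 ξ.2)⁻¹) := by
  obtain ⟨M, hM⟩ := exists_bddLip_det2 h
  refine ⟨_, fun ℓ Q hQ => BddLip.inv hδ (M := 2 * M * M + 2 * |-1| * (2 * M * M)) ?_
    fun ξ hξ => Q.le_jac hQ.le_corner hξ.1 hξ.2⟩
  have h0 := hM _ _ Q hQ 0
  have h1 := hM _ _ Q hQ 1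
  -- The determinants with unit vectors are, up to sign, the coordinates of the tangent vectors;
  -- this combination is the Jacobian.
  refine BddLip.congr ((h0.1.mul h1.2).add ((BddLip.const (-1)).mul (h1.1.mul h0.2))) fun ξ _ => ?_
  simp only [jac, det2_apply]
  simp [unitVec]
  ring

end ConvexQuad.ShapeBounds

/-- The derivative of a face spline is a spline of smoothness `p - 3 ≥ 0`, hence Lipschitz. Function
and gradient are thus bounded and Lipschitz in the parameters, and composition with the Lipschitz
inverse of the parametrization keeps this. -/
theorem exists_bddLip_lift {p : ℕ} (hp : 3 ≤ p) [Fintype (faceNodes p)]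
    {b : (Fin 2 × Fin 2) ⊕ faceNodes p → ℝ → ℝ} (hb : IsSplDual 2 (faceNodes p) (FaceSpl p) b)
    (K h : ℝ) {δ : ℝ} (hδ : 0 < δ) : ∃ M, ∀ (ℓ : ℝ) (Q : ConvexQuad) (c), Q.ShapeBounds h ℓ δ →
      (∀ i j, |c i j| ≤ K) → BddLip Q.closed M (lift Q c b) ∧
        ∀ a, BddLip Q.closed M fun x => fderiv ℝ (lift Q c b) x (unitVec a) := by
  have hb0 : ∀ i, ∃ M, BddLip (Icc (0 : ℝ) 1) M (b i) := fun i => Spl.bddLip (hb.mem i)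
  have hb1 : ∀ i, ∃ M, BddLip (Icc (0 : ℝ) 1) M (deriv (b i)) := fun i => by
    have h1 : b i ∈ FaceSpl p := hb.mem i
    obtain ⟨q, rfl⟩ : ∃ q, p = q + 3 := ⟨p - 3, by omega⟩
    exact Spl.bddLip (Spl.deriv_mem (d := q + 2) (r := q) (numSub_pos _) h1)
  obtain ⟨A, hA⟩ := exists_bddLip_tensor hb0 hb0 K
  obtain ⟨A₁, hA₁⟩ := exists_bddLip_tensor hb1 hb0 K
  obtain ⟨A₂, hA₂⟩ := exists_bddLip_tensor hb0 hb1 K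
  obtain ⟨D, hD⟩ := ConvexQuad.ShapeBounds.exists_bddLip_det2 h
  obtain ⟨J, hJ⟩ := ConvexQuad.ShapeBounds.exists_bddLip_inv_jac h hδ
  set B := 2 * (2 * D * A₁ + 2 * D * A₂) * J
  refine ⟨max (A + A * (h / δ)) (B + B * (h / δ)), fun ℓ Q c hQ hc => ?_⟩
  have hh : 0 ≤ h / δ := div_nonneg ((norm_nonneg _).trans (hQ.edge_le 0)) hδ.le
  have hmaps : MapsTo Q.toSquare Q.closed ConvexQuad.square := fun x hx => Q.toSquare_mem hx
  have hlip : ∀ x ∈ Q.closed, ∀ y ∈ Q.closed,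
      dist (Q.toSquare x) (Q.toSquare y) ≤ h / δ * dist x y := fun x hx y hy =>
    hQ.dist_toSquare_le hδ hx hy
  refine ⟨((hA c hc).comp hmaps hh hlip).mono (le_max_left _ _), fun a => ?_⟩
  obtain ⟨h1, h2⟩ := hD _ _ Q hQ a
  refine (BddLip.congr (((h1.mul (hA₁ c hc)).add (h2.mul (hA₂ c hc))).mul
    (hJ _ Q hQ) |>.comp hmaps hh hlip) fun x hx => ?_).mono (le_max_right _ _)
  have hd := basis_differentiable hp hb
  have h3 := Q.fderiv_comp_toSquare (Q.square_subset_regular (Q.toSquare_mem hx))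
    (tens_hasFDerivAt c hd (Q.toSquare x)).differentiableAt (unitVec a)
  rw [Q.toPlane_toSquare hx, tens_fderiv c hd, tens_fderiv c hd] at h3
  simp only [one_mul, zero_mul, add_zero, zero_add] at h3
  exact h3

/-- Every vertex is joined to `v_0` by at most two edges, so the quadrilateral lies in a ball of
radius `2 h`. -/
theorem ConvexQuad.volume_inner_le (Q : ConvexQuad) {h : ℝ} (hQ : ∀ i, ‖Q.edge i‖ ≤ h) :
    volume Q.inner ≤
      ENNReal.ofReal (volume (Metric.closedBall (0 : Plane) (2 * h))).toReal := by
  rw [ENNReal.ofReal_toReal measure_closedBall_lt_top.ne,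
    ← Measure.addHaar_closedBall_center volume (Q.vertex 0) (2 * h)]
  refine measure_mono (Q.inner_subset_closed.trans ?_)
  refine convexHull_min ?_ (convex_closedBall _ _)
  have hh : 0 ≤ h := (norm_nonneg _).trans (hQ 0)
  have h1 : ‖Q.vertex 1 - Q.vertex 0‖ ≤ h := hQ 0
  have h2 : ‖Q.vertex 2 - Q.vertex 1‖ ≤ h := hQ 1
  have h3 : ‖Q.vertex 0 - Q.vertex 3‖ ≤ h := hQ 3
  rintro _ ⟨i, rfl⟩
  rw [Metric.mem_closedBall, dist_eq_norm]
  fin_cases i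
  · simpa using hh
  · exact h1.trans (by linarith)
  · have h4 := norm_add_le (Q.vertex 2 - Q.vertex 1) (Q.vertex 1 - Q.vertex 0)
    rw [sub_add_sub_cancel] at h4
    exact h4.trans (by linarith)
  · refine le_trans ?_ (h3.trans (by linarith))
    rw [norm_sub_rev]
    rfl

/-- The bound holds for every member of the space with degrees of freedom in `[-1, 1]`, so
uniqueness of the dual basis is not needed. -/
theorem exists_norm_bound {p : ℕ} (hp : 3 ≤ p) (h : ℝ) {ℓ δ : ℝ} (hℓ : 0 < ℓ) (hδ : 0 < δ) :
    ∃ C, 0 < C ∧ ∀ (Q : ConvexQuad) (n : Fin 4 → Plane) (f : Plane → ℝ), Q.ShapeBounds h ℓ δ →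
      Q.IsUnitNormal n → MemSpace p Q n f → (∀ l : Dof p, |Dof.eval Q n f l| ≤ 1) →
        eLpNorm f ⊤ (volume.restrict Q.inner) ≤ ENNReal.ofReal C ∧
        eLpNorm f 2 (volume.restrict Q.inner) ≤ ENNReal.ofReal C ∧
        ∀ k : ℕ, k ≤ 2 → sobolevNorm k Q.inner f ≤ ENNReal.ofReal C := by
  let := (faceNodes_finite hp).fintype
  obtain ⟨b, hb⟩ := exists_face_dual hp
  obtain ⟨K, hK⟩ := exists_coef_bound hp hb h hℓ
  obtain ⟨M, hM⟩ := exists_bddLip_lift hp hb K h hδ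
  set V := (volume (Metric.closedBall (0 : Plane) (2 * h))).toReal
  refine ⟨max 1 (max M (max (√V * M) (3 * (√V * M)))), one_pos.trans_le (le_max_left _ _),
    fun Q n f hQ hn hf hd => ?_⟩
  obtain ⟨c, hc⟩ := hf.exists_lift hb
  obtain ⟨h1, h2⟩ := hM ℓ Q c hQ (hK δ Q n f c hQ hn hf hc hd)
  have hU : IsOpen Q.inner := isOpen_interior
  have hsub := Q.inner_subset_closed
  have hV := Q.volume_inner_le hQ.edge_le
  have hbd : ∀ {g : Plane → ℝ}, BddLip Q.closed M g → BddLip Q.inner M g := fun hg =>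
    ⟨hg.1, fun x hx => ⟨(hg.2 x (hsub hx)).1, fun y hy => (hg.2 x (hsub hx)).2 y (hsub hy)⟩⟩
  have hf0 : BddLip Q.inner M f := (hbd h1).congr (hc.mono hsub)
  have hM₁ := ENNReal.ofReal_le_ofReal
    ((le_max_left M (max (√V * M) (3 * (√V * M)))).trans (le_max_right 1 _))
  have hM₂ := ENNReal.ofReal_le_ofReal (((le_max_left (√V * M) (3 * (√V * M))).trans
    (le_max_right M _)).trans (le_max_right 1 _))
  have hM₃ := ENNReal.ofReal_le_ofReal (((le_max_right (√V * M) (3 * (√V * M))).trans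
    (le_max_right M _)).trans (le_max_right 1 _))
  refine ⟨?_, (eLpNorm_two_le hU hV fun x hx => (hf0.2 x hx).1).trans hM₂, fun k hk => (sobolevNorm_le hU hV hf0
      (fun a => hbd (h2 a)) (fun a x hx => ?_) hk).trans hM₃⟩
  · rw [eLpNorm_exponent_top]
    refine (eLpNormEssSup_le_of_ae_bound ((ae_restrict_iff' hU.measurableSet).2
      (Eventually.of_forall fun x hx => (hf0.2 x hx).1))).trans hM₁
  · have h3 := ((smoothExt_lift hp hb Q c hc).differentiableAt x (hsub hx)).hasFDerivAt
    refine (h3.congr_of_eventuallyEq ?_).hasLineDerivAt _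
    filter_upwards [hU.mem_nhds hx] with y hy
    exact hc (hsub hy)

/-! ### The dual basis and its bounds -/

theorem exists_dualBasis {p : ℕ} (hp : 3 ≤ p) {Q : ConvexQuad} {n : Fin 4 → Plane}
    (hn : Q.IsUnitNormal n) : ∃ β : Dof p → Plane → ℝ, IsDualBasis p Q n β := by
  classical
  choose β hβ hd using fun l : Dof p => exists_memSpace hp hn fun l' => if l' = l then 1 else 0
  refine ⟨β, fun l => ⟨hβ l, fun l' => ?_⟩⟩
  rw [hd l]

theorem exists_dualBasis_bound (h ρ : ℝ) (p : ℕ) : ∃ C : ℝ, 0 < C ∧ (3 ≤ p →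
    ∀ (Q : ConvexQuad) (n : Fin 4 → Plane), Q.size = h → Q.minAngle = ρ → Q.IsUnitNormal n →
      ∀ β : Dof p → Plane → ℝ, IsDualBasis p Q n β → ∀ l : Dof p,
        eLpNorm (β l) ⊤ (volume.restrict Q.inner) ≤ ENNReal.ofReal C ∧
        eLpNorm (β l) 2 (volume.restrict Q.inner) ≤ ENNReal.ofReal C ∧
        ∀ k : ℕ, k ≤ 2 → sobolevNorm k Q.inner (β l) ≤ ENNReal.ofReal C) := by
  -- A quadrilateral with these parameters serves only to make `h` and `sin ρ` positive. If there is
  -- none, or `p < 3`, the claim is vacuous and `C = 1` will do.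
  by_cases hex : 3 ≤ p ∧ ∃ Q : ConvexQuad, Q.size = h ∧ Q.minAngle = ρ
  · obtain ⟨hp, Q₀, rfl, rfl⟩ := hex
    have hs := Q₀.sin_minAngle_pos
    have hh := Q₀.size_pos
    have hℓ : 0 < Q₀.size * Real.sin Q₀.minAngle ^ 3 := by positivity
    obtain ⟨C, hC, hb⟩ := exists_norm_bound hp Q₀.size hℓ (mul_pos hs (pow_pos hℓ 2))
    refine ⟨C, hC, fun _ Q n h1 h2 hn β hβ l => hb Q n (β l) ?_ hn (hβ l).1 fun l' => ?_⟩
    · rw [← h1, ← h2]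
      exact Q.shapeBounds
    · rw [(hβ l).2 l']
      split_ifs <;> simp
  · exact ⟨1, one_pos, fun hp Q n h1 h2 => absurd ⟨hp, Q, h1, h2⟩ hex⟩

end BSQuad

end

theorem mainTheorem6 :
    ∃ C : ℝ → ℝ → ℕ → ℝ, (∀ h ρ p, 0 < C h ρ p) ∧
      ∀ (p : ℕ), 3 ≤ p → ∀ (Q : BSQuad.ConvexQuad) (n : Fin 4 → BSQuad.Plane), Q.IsUnitNormal n →
        (∃ β : BSQuad.Dof p → BSQuad.Plane → ℝ, BSQuad.IsDualBasis p Q n β) ∧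
        ∀ β : BSQuad.Dof p → BSQuad.Plane → ℝ, BSQuad.IsDualBasis p Q n β →
          ∀ l : BSQuad.Dof p,
            MeasureTheory.eLpNorm (β l) ⊤ (MeasureTheory.volume.restrict Q.inner) ≤
                ENNReal.ofReal (C Q.size Q.minAngle p) ∧
            MeasureTheory.eLpNorm (β l) 2 (MeasureTheory.volume.restrict Q.inner) ≤
                ENNReal.ofReal (C Q.size Q.minAngle p) ∧
            ∀ k : ℕ, k ≤ 2 →
              BSQuad.sobolevNorm k Q.inner (β l) ≤
                ENNReal.ofReal (C Q.size Q.minAngle p) := by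
  choose C hC hb using BSQuad.exists_dualBasis_bound
  exact ⟨C, hC, fun p hp Q n hn => ⟨BSQuad.exists_dualBasis hp hn,
    fun β hβ => hb _ _ p hp Q n rfl rfl hn β hβ⟩⟩
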